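/- **Theorem (p-time correctness for conflict nets).** Erasability of a slicing $\lambda : L\to\Gamma$ can be decided in time polynomial in the sizes of $L$ and $\Gamma$ (the number of tokens of $L$, and the number of vertices of the parse forest of $\Gamma$). Precisely: there are one program for a random access machine (registers and arrays of natural numbers, addition, truncated subtraction, indirect access, unit cost) and one polynomial $p$ such that for every slicing $\lambda : L\to\Gamma$ with $|L|=l$ and $|\Gamma|=g$, presented by tables (for any enumeration of the vertices of $\Gamma$ and of the tokens of $L$: the parse forest with its connectives, which leaves carry equal or dual literals, the conflict relation of $L$, and the relation $\lambda$), the program halts after at most $p(l+g)$ steps, accepting if and only if $\lambda$ is erasable. *Definitions.* Formulas are built from a set of literals (with a fixed-point-free involution $P\mapsto\overline P$) by $\otimes$, ⅋, $\&$, $\oplus$; a sequent $\Gamma$ is a finite list of formulas, identified with its parse forest. A coherence space is given by its tokens and a symmetric irreflexive *conflict* relation $\#$; distinct tokens not in conflict are *adjacent* ($\frown$). A map of coherence spaces is a binary relation that preserves $\frown$ and reflects $\#$. Let $|\Gamma|_{coh}$ be the coherence space of leaves of $\Gamma$, with $x\# y$ iff $x\ne y$ and the smallest subformula containing both exists and is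 additive ($\&$ or $\oplus$). A *linking* is a binary relation $\lambda$ from a finite coherence space $L$ (of *links*) to the leaves of $\Gamma$ that sends each link to a pair of leaves with dual literals and such that distinct links sharing a leaf are in conflict. It is a *slicing* if it is inclusion-maximal among maps $L\to|\Gamma|_{coh}$ and $L$ is contractible (the graph $\#$ has no induced four-vertex path). The graph $\lambda^\#$ consists of the parse forest of $\Gamma$, the conflict graph of $L$, and an edge from each link to each of its leaves; $\lambda$ is *connected* if it is non-empty and $\lambda^\#$ is connected. A *piece* of $\lambda$ is its restriction to a connected component of the $\frown$-graph of $L$. For a root $r$ of a formula $A_0\,\square\,A_1$ of $\Gamma$, $\lambda$ *touches* $A_i$ if some leaf of $A_i$ is in its image, *chooses* $A_i$ if it touches $A_i$ and not $A_{1-i}$, and $r$ is *unary* under $\lambda$ if exactly one $A_i$ is touched. For connected $\lambda$, $r$ is *ready* if: $\square=\otimes$ and $r$ lies on no cycle of $\lambda^\#$; or $\square=$ ⅋; or $\square=\oplus$ and $r$ is unary under $\lambda$; or $\square=\&$ and $r$ is unary under every piece of $\lambda$. Erasing a ready $r$ gives the set $\lambda\setminus r$ of slicings: for $\otimes$, the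 two connected components after deleting $r$; for ⅋, the result of deleting $r$; for $\oplus$, the result of deleting $r$ and the untouched $A_{1-j}$; for $\&$, the two slicings $\lambda_i$ ($i=0,1$) consisting of all pieces choosing $A_i$, on the sequent with $A_i$ in place of $A_0\& A_1$. A *cluster* is a set of slicings or an error symbol $\mathsf E$. Erasure $\leadsto$ on clusters is: $Y\leadsto\mathsf E$ if some slicing in $Y$ is not connected; and, when $\lambda\notin X$ and all slicings of $X$ are connected, $X\cup\{\lambda\}\leadsto X\cup(\lambda\setminus r)$ for $r$ ready in $\lambda$, and $X\cup\{\lambda\}\leadsto X$ if $\lambda$ is a single link on a sequent $P,\overline P$. A slicing $\lambda$ is *erasable* if $\{\lambda\}\leadsto^*\emptyset$. -/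

import Mathlib

namespace MALL

/-! ### Formulas and sequents -/

/-- The connectives tensor, par, with, plus. -/
inductive Conn
  | tensor | par | amp | plus

/-- The additive connectives are with and plus. -/
def Conn.Additive : Conn → Prop
  | .amp => True
  | .plus => True
  | .tensor => False
  | .par => False

/-- MALL formulas over a set `A` of literals. -/
inductive Formula (A : Type*)
  | lit (a : A) : Formula A
  | bin (c : Conn) (F G : Formula A) : Formula A

abbrev Sequent (A : Type*) := List (Formula A)

/-- Labels of the vertices of a parse tree: literals on leaves, connectives on internal vertices. -/
inductive Label (A : Type*)
  | lit (a : A) : Label A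
  | conn (c : Conn) : Label A

/-- The label of the vertex of a parse tree that is reached from the root by a path
(`false` = first argument, `true` = second argument), if there is such a vertex. -/
def Formula.label {A : Type*} : Formula A → List Bool → Option (Label A)
  | .lit a, [] => some (.lit a)
  | .lit _, _ :: _ => none
  | .bin c _ _, [] => some (.conn c)
  | .bin _ F _, false :: p => F.label p
  | .bin _ _ G, true :: p => G.label p

/-- A vertex of the parse forest is addressed by the position of its formula in the sequent
and the path to it from the root of that formula. -/
def Sequent.label {A : Type*} (Γ : Sequent A) (v : ℕ × List Bool) : Option (Label A) :=
  (Γ[v.1]?).bind (fun F => F.label v.2)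

/-- The vertices of the parse forest of a sequent. -/
abbrev Vertex {A : Type*} (Γ : Sequent A) : Type :=
  {v : ℕ × List Bool // (Sequent.label Γ v).isSome}

variable {A : Type*} {Γ : Sequent A}

def Vertex.label (v : Vertex Γ) : Label A := (Sequent.label Γ v.1).get v.2

/-- `u` is the root of the argument `A_b` of the subformula `A_0 □ A_1` rooted at `r`. -/
def IsArg (b : Bool) (u r : Vertex Γ) : Prop :=
  u.1 = (r.1.1, r.1.2 ++ [b])

/-- `v` is a vertex of the argument `A_b` of the subformula `A_0 □ A_1` rooted at `r`. -/
def InArg (b : Bool) (v r : Vertex Γ) : Prop :=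
  v.1.1 = r.1.1 ∧ r.1.2 ++ [b] <+: v.1.2

/-- The leaves of a sequent. -/
abbrev Leaf (Γ : Sequent A) : Type := {v : Vertex Γ // ∃ a, v.label = .lit a}

/-! ### Coherence spaces

A coherence space with web `T` is given by its conflict (strict incoherence) relation, a
symmetric irreflexive relation on `T`; adjacency (strict coherence) is the complementary graph:
two distinct tokens are adjacent iff they are not in conflict. -/

/-- Maps of coherence spaces preserve adjacency and reflect conflict. -/
def IsCohMap {S T : Type*} (X : SimpleGraph S) (Y : SimpleGraph T) (R : S → T → Prop) : Prop :=
  (∀ x₁ x₂ y₁ y₂, Xᶜ.Adj x₁ x₂ → R x₁ y₁ → R x₂ y₂ → Yᶜ.Adj y₁ y₂) ∧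
  (∀ x₁ x₂ y₁ y₂, Y.Adj y₁ y₂ → R x₁ y₁ → R x₂ y₂ → X.Adj x₁ x₂)

/-- Contractible: finite web, and the conflict graph has no induced path on four vertices. -/
def Contractible {S : Type*} (X : SimpleGraph S) : Prop :=
  Finite S ∧ ∀ x₁ x₂ x₃ x₄ : S, [x₁, x₂, x₃, x₄].Nodup →
    X.Adj x₁ x₂ → X.Adj x₂ x₃ → X.Adj x₃ x₄ → X.Adj x₁ x₃ ∨ X.Adj x₂ x₄ ∨ X.Adj x₁ x₄

/-- The coherence space of a sequent: two leaves are in conflict iff they lie in the two different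
arguments of some additive vertex (which is then the root of the smallest subformula containing
both). -/
def leafConflict (Γ : Sequent A) : SimpleGraph (Leaf Γ) where
  Adj x y := ∃ (r : Vertex Γ) (c : Conn) (b : Bool),
    r.label = .conn c ∧ c.Additive ∧ InArg b x.1 r ∧ InArg (!b) y.1 r
  symm := ⟨by
    rintro x y ⟨r, c, b, hr, hc, hx, hy⟩
    exact ⟨r, c, !b, hr, hc, hy, by simpa using hx⟩⟩
  loopless := ⟨by
    rintro x ⟨r, c, b, -, -, ⟨-, s, hs⟩, ⟨-, t, ht⟩⟩
    rw [← ht] at hs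
    simp only [List.append_assoc, List.append_cancel_left_eq, List.cons_append,
      List.nil_append, List.cons.injEq] at hs
    cases b <;> simp at hs⟩

/-! ### Linkings and slicings -/

/-- A binary relation from a coherence space with web `L` to the leaves of `Γ`. -/
structure Links (Γ : Sequent A) (L : Type*) where
  conflict : SimpleGraph L
  rel : L → Leaf Γ → Prop

variable {L : Type*}

/-- `{x, y}` is a dual pair of leaves (`bar` is the duality on literals). -/
def DualLeaves (bar : A → A) (x y : Leaf Γ) : Prop :=
  ∃ a, x.1.label = .lit a ∧ y.1.label = .lit (bar a)

/-- A linking: a finite coherence space of links, each link being sent to a dual pair, and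
overlapping links being in conflict. -/
def Links.IsLinking (lam : Links Γ L) (bar : A → A) : Prop :=
  Finite L ∧
  (∀ l, ∃ x y, DualLeaves bar x y ∧ {z | lam.rel l z} = {x, y}) ∧
  (∀ l m x, lam.rel l x → lam.rel m x → l ≠ m → lam.conflict.Adj l m)

/-- A slicing: a linking which is a maximal map out of a contractible coherence space. -/
def Links.IsSlicing (lam : Links Γ L) (bar : A → A) : Prop :=
  lam.IsLinking bar ∧ Contractible lam.conflict ∧
  Maximal (IsCohMap lam.conflict (leafConflict Γ)) lam.rel

/-! ### The conflict graph, and the slicings met during erasure -/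

/-- The restriction of a graph to a set of vertices (the other vertices become isolated and are
disregarded). -/
def restrict {T : Type*} (G : SimpleGraph T) (S : Set T) : SimpleGraph T :=
  SimpleGraph.fromRel (fun x y => G.Adj x y ∧ x ∈ S ∧ y ∈ S)

/-- The conflict graph of `lam`: the parse forest of `Γ`, the conflict edges between links, and
an edge between a link and each of its leaves. -/
def Links.graph (lam : Links Γ L) : SimpleGraph (Vertex Γ ⊕ L) :=
  SimpleGraph.fromRel (fun x y =>
    match x, y with
    | .inl u, .inl v => ∃ b, IsArg b u v
    | .inr l, .inr m => lam.conflict.Adj l m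
    | .inr l, .inl v => ∃ x : Leaf Γ, lam.rel l x ∧ x.1 = v
    | .inl _, .inr _ => False)

/-- Erasure only ever deletes vertices of the parse forest and links. A slicing obtained by erasure
from `lam : L → Γ` is therefore recorded by the set of vertices of its sequent (a sub-forest of `Γ`)
and the set of its links; labels, edges, conflicts and the relation to leaves are those of `lam`. -/
@[ext] structure Part (Γ : Sequent A) (L : Type*) where
  verts : Set (Vertex Γ)
  links : Set L

/-- The vertices of the conflict graph of a slicing. -/
def Part.carrier (μ : Part Γ L) : Set (Vertex Γ ⊕ L) :=
  {x | Sum.elim (fun v => v ∈ μ.verts) (fun l => l ∈ μ.links) x}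

namespace Links

variable (lam : Links Γ L)

/-- Connected: non-empty, with connected conflict graph. -/
def ConnectedPart (μ : Part Γ L) : Prop :=
  μ.links.Nonempty ∧
  ∀ x ∈ μ.carrier, ∀ y ∈ μ.carrier, (restrict lam.graph μ.carrier).Reachable x y

/-- `r` is a root of the sequent of `μ`. -/
def IsRoot (μ : Part Γ L) (r : Vertex Γ) : Prop :=
  r ∈ μ.verts ∧ ∀ u ∈ μ.verts, ∀ b, ¬ IsArg b r u

/-- The links of `K` touch the argument `A_b` of the formula rooted at `r`. -/
def Touches (K : Set L) (r : Vertex Γ) (b : Bool) : Prop :=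
  ∃ l ∈ K, ∃ x : Leaf Γ, lam.rel l x ∧ InArg b x.1 r

def Chooses (K : Set L) (r : Vertex Γ) (b : Bool) : Prop :=
  lam.Touches K r b ∧ ¬ lam.Touches K r (!b)

/-- `r` is unary under `K`: exactly one of the two arguments is touched. -/
def Unary (K : Set L) (r : Vertex Γ) : Prop :=
  ∃ b, lam.Chooses K r b

/-- The pieces of `μ`: the connected components of the adjacency graph on its links. -/
def IsPiece (μ : Part Γ L) (K : Set L) : Prop :=
  ∃ l ∈ μ.links, K = {m | (restrict lam.conflictᶜ μ.links).Reachable l m}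

/-- `r` is a root of the connected slicing `μ` that is ready. -/
def Ready (μ : Part Γ L) (r : Vertex Γ) : Prop :=
  lam.ConnectedPart μ ∧ IsRoot μ r ∧
  match r.label with
  | .lit _ => False
  | .conn .tensor => ¬ ∃ w : (restrict lam.graph μ.carrier).Walk (.inl r) (.inl r), w.IsCycle
  | .conn .par => True
  | .conn .plus => lam.Unary μ.links r
  | .conn .amp => ∀ K, lam.IsPiece μ K → lam.Unary K r

/-- The connected component of the root of `A_b` once `r` is deleted from the conflict graph. -/
def tensorPart (μ : Part Γ L) (r : Vertex Γ) (b : Bool) : Part Γ L where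
  verts := {v | ∃ u, IsArg b u r ∧
    (restrict lam.graph (μ.carrier \ {Sum.inl r})).Reachable (.inl u) (.inl v)}
  links := {l | ∃ u, IsArg b u r ∧
    (restrict lam.graph (μ.carrier \ {Sum.inl r})).Reachable (.inl u) (.inr l)}

/-- The sequent in which the formula `A_0 □ A_1` rooted at `r` is replaced by `A_b`. -/
def chooseVerts (μ : Part Γ L) (r : Vertex Γ) (b : Bool) : Set (Vertex Γ) :=
  {v ∈ μ.verts | v ≠ r ∧ ¬ InArg (!b) v r}

/-- The union of all pieces that choose `A_b`, on the sequent with `A_b` in place of `A_0 & A_1`. -/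
def ampPart (μ : Part Γ L) (r : Vertex Γ) (b : Bool) : Part Γ L where
  verts := chooseVerts μ r b
  links := {l | ∃ K, lam.IsPiece μ K ∧ lam.Chooses K r b ∧ l ∈ K}

/-- The set of slicings that results from erasing a ready root `r`. -/
def erase (μ : Part Γ L) (r : Vertex Γ) : Set (Part Γ L) :=
  match r.label with
  | .lit _ => ∅
  | .conn .tensor => {lam.tensorPart μ r false, lam.tensorPart μ r true}
  | .conn .par => {⟨μ.verts \ {r}, μ.links⟩}
  | .conn .plus => {ν | ∃ b, lam.Chooses μ.links r b ∧ ν = ⟨chooseVerts μ r b, μ.links⟩}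
  | .conn .amp => {lam.ampPart μ r false, lam.ampPart μ r true}

/-- `μ` is a single link on a sequent consisting of two dual literals. -/
def IsAxiomPart (bar : A → A) (μ : Part Γ L) : Prop :=
  ∃ (l : L) (x y : Leaf Γ), DualLeaves bar x y ∧ μ.links = {l} ∧ μ.verts = {x.1, y.1} ∧
    ∀ z, lam.rel l z ↔ z = x ∨ z = y

end Links

/-- A cluster is either the error symbol or a set of slicings. -/
inductive Cluster (Γ : Sequent A) (L : Type*)
  | error : Cluster Γ L
  | slicings (X : Set (Part Γ L)) : Cluster Γ L

/-- One step of erasure on clusters. -/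
inductive Links.Step (lam : Links Γ L) (bar : A → A) : Cluster Γ L → Cluster Γ L → Prop
  | error (Y : Set (Part Γ L)) (μ : Part Γ L) : μ ∈ Y → ¬ lam.ConnectedPart μ →
      Links.Step lam bar (.slicings Y) .error
  | erase (X : Set (Part Γ L)) (μ : Part Γ L) (r : Vertex Γ) : μ ∉ X →
      (∀ ν ∈ X, lam.ConnectedPart ν) → lam.Ready μ r →
      Links.Step lam bar (.slicings (X ∪ {μ})) (.slicings (X ∪ lam.erase μ r))
  | ax (X : Set (Part Γ L)) (μ : Part Γ L) : μ ∉ X →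
      (∀ ν ∈ X, lam.ConnectedPart ν) → lam.IsAxiomPart bar μ →
      Links.Step lam bar (.slicings (X ∪ {μ})) (.slicings X)

/-- `lam` is erasable: the cluster `{lam}` rewrites to the empty cluster. -/
def Links.Erasable (lam : Links Γ L) (bar : A → A) : Prop :=
  Relation.ReflTransGen (Links.Step lam bar)
    (.slicings {⟨Set.univ, Set.univ⟩}) (.slicings ∅)

/-! ### Encoding of slicings as input data -/

/-- An `n × m` table, row by row. -/
def table (n m : ℕ) (f : Fin n → Fin m → ℕ) : List ℕ :=
  List.ofFn (fun k : Fin (n * m) => f k.divNat k.modNat)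

def Label.code : Label A → ℕ
  | .lit _ => 0
  | .conn .tensor => 1
  | .conn .par => 2
  | .conn .amp => 3
  | .conn .plus => 4

open Classical in
/-- `1` for equal literals, `2` for dual literals, `0` otherwise. -/
noncomputable def Label.compare (bar : A → A) : Label A → Label A → ℕ
  | .lit a, .lit b => if a = b then 1 else if b = bar a then 2 else 0
  | _, _ => 0

open Classical in
/-- The input arrays that present a slicing, for an enumeration of the vertices of `Γ` and of
the tokens of `L`: the two sizes; the kind of each vertex of `Γ`; the edges of the parse forest;
which leaves carry equal or dual literals; the conflicts between links; the relation from links to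
leaves. -/
noncomputable def Links.encode (lam : Links Γ L) (bar : A → A) {g l : ℕ}
    (eV : Fin g ≃ Vertex Γ) (eL : Fin l ≃ L) : List (List ℕ) :=
  [ [g, l],
    List.ofFn (fun v => (eV v).label.code),
    table g g (fun u v => if IsArg false (eV u) (eV v) then 1
      else if IsArg true (eV u) (eV v) then 2 else 0),
    table g g (fun u v => Label.compare bar (eV u).label (eV v).label),
    table l l (fun i j => if lam.conflict.Adj (eL i) (eL j) then 1 else 0),
    table l g (fun i v => if ∃ x : Leaf Γ, lam.rel (eL i) x ∧ x.1 = eV v then 1 else 0) ]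

end MALL

/-! ### Random access machines

Programs over registers and arrays of natural numbers, with addition and truncated subtraction but
no multiplication, at unit cost. Up to polynomial factors this is the time of Turing machines. -/

namespace RAM

/-- Programs. Each mentions finitely many registers and arrays, named by natural numbers. -/
inductive Program
  | skip : Program
  | const (x n : ℕ) : Program
  | copy (x y : ℕ) : Program
  | add (x y z : ℕ) : Program
  | sub (x y z : ℕ) : Program
  | load (x a y : ℕ) : Program
  | store (a x y : ℕ) : Program
  | seq (P Q : Program) : Program
  | ite (x : ℕ) (P Q : Program) : Program
  | loop (x : ℕ) (P : Program) : Program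

/-- The contents of the registers and of the arrays. -/
structure State where
  reg : ℕ → ℕ
  arr : ℕ → ℕ → ℕ

def State.setReg (s : State) (x n : ℕ) : State :=
  { s with reg := Function.update s.reg x n }

def State.setArr (s : State) (a i n : ℕ) : State :=
  { s with arr := Function.update s.arr a (Function.update (s.arr a) i n) }

/-- `Runs P s s' t`: started in state `s`, the program `P` halts in state `s'` after `t` steps.
Every elementary instruction and every test of a register counts as one step. -/
inductive Runs : Program → State → State → ℕ → Prop
  | skip (s) : Runs .skip s s 1
  | const (s x n) : Runs (.const x n) s (s.setReg x n) 1
  | copy (s x y) : Runs (.copy x y) s (s.setReg x (s.reg y)) 1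
  | add (s x y z) : Runs (.add x y z) s (s.setReg x (s.reg y + s.reg z)) 1
  | sub (s x y z) : Runs (.sub x y z) s (s.setReg x (s.reg y - s.reg z)) 1
  | load (s x a y) : Runs (.load x a y) s (s.setReg x (s.arr a (s.reg y))) 1
  | store (s a x y) : Runs (.store a x y) s (s.setArr a (s.reg x) (s.reg y)) 1
  | seq (P Q s s' s'' t t') : Runs P s s' t → Runs Q s' s'' t' → Runs (.seq P Q) s s'' (t + t')
  | ite_pos (x P Q s s' t) : s.reg x ≠ 0 → Runs P s s' t → Runs (.ite x P Q) s s' (t + 1)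
  | ite_neg (x P Q s s' t) : s.reg x = 0 → Runs Q s s' t → Runs (.ite x P Q) s s' (t + 1)
  | loop_stop (x P s) : s.reg x = 0 → Runs (.loop x P) s s 1
  | loop_step (x P s s' s'' t t') : s.reg x ≠ 0 → Runs P s s' t → Runs (.loop x P) s' s'' t' →
      Runs (.loop x P) s s'' (t + t' + 1)

/-- The initial state: the `a`-th list of the input is stored in the `a`-th array; all other
cells and all registers are `0`. -/
def State.init (input : List (List ℕ)) : State where
  reg := fun _ => 0
  arr := fun a i => (input.getD a []).getD i 0

end RAM

/-! The core is that no search among the orders of erasure is needed: erasing a ready root of a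
slicing that can be erased leaves only slicings that can be erased (`Links.Reduces.erase`). This is
an induction on a given erasure. Suppose that it begins with `s`, while `r` is ready too. Then `r`
stays ready wherever it survives the erasure of `s` (`Links.Ready.of_erase`), erasing `r` at once
also gives connected slicings (`Links.connectedPart_of_erase`), and the two erasures commute, up to
the possibility that one root lies outside the component in which the other is erased
(`Links.erase_erase`, `Links.mem_erase_of_not_mem`). The troublesome combination, a tensor and a
with that are ready together, does not occur in an erasable slicing. There, both arguments of a
tensor or with must carry links (`Links.Reduces.full`). Links on opposite sides of a ready tensor
are adjacent, so all links form a single piece, and the with is not unary under it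
(`Links.not_ready_tensor_amp`).

Hence a greedy strategy is correct. The slicings of a cluster evolve independently, so erasability
becomes the existence of a derivation tree `Links.Reduces` (`Links.erasable_iff`). Erasing a root
never duplicates a link: each link passes to exactly one of the results. So the fate of one link is
a linear sequence of slicings, `Links.run`, instead of a tree. A sweep through all vertices either
finds nothing to erase or deletes a vertex, so as many sweeps as there are vertices suffice. The
slicing is erasable iff there is a link and the run of every link ends in an axiom
(`Links.erasable_iff_run`). The run only erases roots whose erasure gives slicings with links, so
every branch of the tree is observed by some link.

For the time bound, a slicing met on the way is stored as a subset of the vertices of the conflict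
graph. One step of the run is defined by a fixed first-order formula with transitive closure
(`Links.sat_stepF`); the cycle condition for a tensor becomes a reachability condition, as a root
has only two neighbours (`exists_isCycle_iff`). Formulas are translated to arithmetic expressions
(`Form.eval_expr`), and these, with simultaneous array updates and loops over the domain, to machine
code with an explicit polynomial bound (`Expr.compile_correct`, `Stmt.compile_correct`). The
algorithm is three nested loops over the `g + l` vertices around such a step. -/

namespace RAM

/-! ### Hoare triples with time bounds -/

/-- Started in `s`, the program `P` halts after at most `T` steps in a state satisfying `Q`. -/
def Does (P : Program) (s : State) (T : ℕ) (Q : State → Prop) : Prop :=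
  ∃ s' t, Runs P s s' t ∧ t ≤ T ∧ Q s'

@[simp] theorem State.reg_setReg (s : State) (x n y : ℕ) :
    (s.setReg x n).reg y = if y = x then n else s.reg y := by
  simp [State.setReg, Function.update_apply]

@[simp] theorem State.arr_setReg (s : State) (x n : ℕ) : (s.setReg x n).arr = s.arr := rfl

@[simp] theorem State.reg_setArr (s : State) (a i n : ℕ) : (s.setArr a i n).reg = s.reg := rfl

@[simp] theorem State.arr_setArr (s : State) (a i n b j : ℕ) :
    (s.setArr a i n).arr b j = if b = a ∧ j = i then n else s.arr b j := by
  by_cases h : b = a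
  · subst h; simp [State.setArr, Function.update_apply]
  · simp [State.setArr, h]

theorem State.arr_setArr_of_ne (s : State) {a b : ℕ} (i n : ℕ) (h : b ≠ a) :
    (s.setArr a i n).arr b = s.arr b := by
  funext j; simp [h]

theorem Does.mono {P : Program} {s : State} {T T' : ℕ} {Q Q' : State → Prop}
    (h : Does P s T Q) (hT : T ≤ T') (hQ : ∀ s', Q s' → Q' s') : Does P s T' Q' := by
  obtain ⟨s', t, hr, ht, hq⟩ := h
  exact ⟨s', t, hr, ht.trans hT, hQ _ hq⟩

theorem Does.skip {s : State} {Q : State → Prop} (h : Q s) : Does .skip s 1 Q :=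
  ⟨_, _, .skip s, le_rfl, h⟩

theorem Does.const {s : State} {x n : ℕ} {Q : State → Prop} (h : Q (s.setReg x n)) :
    Does (.const x n) s 1 Q :=
  ⟨_, _, .const s x n, le_rfl, h⟩

theorem Does.copy {s : State} {x y : ℕ} {Q : State → Prop} (h : Q (s.setReg x (s.reg y))) :
    Does (.copy x y) s 1 Q :=
  ⟨_, _, .copy s x y, le_rfl, h⟩

theorem Does.add {s : State} {x y z : ℕ} {Q : State → Prop}
    (h : Q (s.setReg x (s.reg y + s.reg z))) : Does (.add x y z) s 1 Q :=
  ⟨_, _, .add s x y z, le_rfl, h⟩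

theorem Does.sub {s : State} {x y z : ℕ} {Q : State → Prop}
    (h : Q (s.setReg x (s.reg y - s.reg z))) : Does (.sub x y z) s 1 Q :=
  ⟨_, _, .sub s x y z, le_rfl, h⟩

theorem Does.load {s : State} {x a y : ℕ} {Q : State → Prop}
    (h : Q (s.setReg x (s.arr a (s.reg y)))) : Does (.load x a y) s 1 Q :=
  ⟨_, _, .load s x a y, le_rfl, h⟩

theorem Does.store {s : State} {a x y : ℕ} {Q : State → Prop}
    (h : Q (s.setArr a (s.reg x) (s.reg y))) : Does (.store a x y) s 1 Q :=
  ⟨_, _, .store s a x y, le_rfl, h⟩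

theorem Does.seq {P P' : Program} {s : State} {T T' : ℕ} {Q R : State → Prop}
    (h : Does P s T Q) (h' : ∀ s', Q s' → Does P' s' T' R) : Does (.seq P P') s (T + T') R := by
  obtain ⟨s', t, hr, ht, hq⟩ := h
  obtain ⟨s'', t', hr', ht', hq'⟩ := h' s' hq
  exact ⟨s'', t + t', .seq _ _ _ _ _ _ _ hr hr', add_le_add ht ht', hq'⟩

theorem Does.ite {P P' : Program} {s : State} {x T : ℕ} {Q : State → Prop}
    (h : s.reg x ≠ 0 → Does P s T Q) (h' : s.reg x = 0 → Does P' s T Q) :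
    Does (.ite x P P') s (T + 1) Q := by
  by_cases hx : s.reg x = 0
  · obtain ⟨s', t, hr, ht, hq⟩ := h' hx
    exact ⟨s', t + 1, .ite_neg _ _ _ _ _ _ hx hr, by omega, hq⟩
  · obtain ⟨s', t, hr, ht, hq⟩ := h hx
    exact ⟨s', t + 1, .ite_pos _ _ _ _ _ _ hx hr, by omega, hq⟩

theorem Does.seq_copy {P : Program} {s : State} {x y T : ℕ} {Q : State → Prop}
    (h : Does P (s.setReg x (s.reg y)) T Q) : Does (.seq (.copy x y) P) s (1 + T) Q :=
  Does.seq (Q := fun s' => s' = s.setReg x (s.reg y)) (Does.copy rfl) (by rintro _ rfl; exact h)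

theorem Does.seq_const {P : Program} {s : State} {x n T : ℕ} {Q : State → Prop}
    (h : Does P (s.setReg x n) T Q) : Does (.seq (.const x n) P) s (1 + T) Q :=
  Does.seq (Q := fun s' => s' = s.setReg x n) (Does.const rfl) (by rintro _ rfl; exact h)

theorem Does.seq_store {P : Program} {s : State} {a x y T : ℕ} {Q : State → Prop}
    (h : Does P (s.setArr a (s.reg x) (s.reg y)) T Q) :
    Does (.seq (.store a x y) P) s (1 + T) Q :=
  Does.seq (Q := fun s' => s' = s.setArr a (s.reg x) (s.reg y)) (Does.store rfl)
    (by rintro _ rfl; exact h)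

theorem Does.seq_load {P : Program} {s : State} {a x y T : ℕ} {Q : State → Prop}
    (h : Does P (s.setReg x (s.arr a (s.reg y))) T Q) :
    Does (.seq (.load x a y) P) s (1 + T) Q :=
  Does.seq (Q := fun s' => s' = s.setReg x (s.arr a (s.reg y))) (Does.load rfl)
    (by rintro _ rfl; exact h)

/-- Run `P` with register `c` counting down from the contents of register `1` (exclusive) to `0`.
Register `c + 1` is scratch. -/
def forLoop (c : ℕ) (P : Program) : Program :=
  .seq (.copy c 1) (.loop c (.seq (.const (c + 1) 1) (.seq (.sub c c (c + 1)) P)))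

/-- The counter is decremented before the body runs, so the body sees the indices `n - 1`, …, `0`,
and `Inv i` describes the state once index `i` is done. The `3` pays for the test, the constant and
the subtraction; the final `1` for the failing test. -/
theorem Does.loop {c B : ℕ} {P : Program} (Inv : ℕ → State → Prop) (n : ℕ)
    (step : ∀ i < n, ∀ s, s.reg c = i + 1 → Inv (i + 1) s →
      Does P ((s.setReg (c + 1) 1).setReg c i) B (fun s' => s'.reg c = i ∧ Inv i s'))
    (s : State) (hc : s.reg c = n) (h : Inv n s) :
    Does (.loop c (.seq (.const (c + 1) 1) (.seq (.sub c c (c + 1)) P))) s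
      (n * (B + 3) + 1) (Inv 0) := by
  induction n generalizing s with
  | zero => exact ⟨s, 1, by constructor; exact hc, by omega, h⟩
  | succ n ih =>
    obtain ⟨s', t, hr, ht, hq, hq'⟩ := step n (Nat.lt_succ_self n) s hc h
    obtain ⟨s'', t', hr', ht', hq''⟩ := ih (fun i hi => step i (by omega)) s' hq hq'
    refine ⟨s'', _, .loop_step _ _ _ s' _ (1 + (1 + t)) _ (by omega)
      (.seq _ _ _ _ _ _ _ (.const _ _ _) (.seq _ _ _ _ _ _ _ (.sub _ _ _ _) ?_)) hr', ?_, hq''⟩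
    · simpa [hc] using hr
    · rw [Nat.succ_mul]; omega

theorem Does.forLoop {c B N : ℕ} {P : Program} (Inv : ℕ → State → Prop) {s : State}
    (hN : s.reg 1 = N)
    (step : ∀ i < N, ∀ s, s.reg c = i + 1 → Inv (i + 1) s →
      Does P ((s.setReg (c + 1) 1).setReg c i) B (fun s' => s'.reg c = i ∧ Inv i s'))
    (h : Inv N (s.setReg c N)) : Does (forLoop c P) s (N * (B + 3) + 2) (Inv 0) := by
  refine Does.mono (Does.seq_copy (T := N * (B + 3) + 1) ?_) (by omega) (fun _ h => h)
  rw [hN]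
  exact Does.loop Inv N step _ (by simp) h

/-! ### Expressions -/

/-- Arithmetic expressions; `sum x e` is the sum of `e` over all values of `x` below the size `N`
of the domain, and `tc a b e x y` tells whether `x` is related to `y` by the reflexive transitive
closure of the relation that `e` defines, in terms of `a` and `b`, on the domain. -/
inductive Expr
  | var (x : ℕ)
  | const (n : ℕ)
  | add (e f : Expr)
  | sub (e f : Expr)
  | rd (a : ℕ) (e : Expr)
  | ite (c e f : Expr)
  | sum (x : ℕ) (e : Expr)
  | tc (a b : ℕ) (e : Expr) (x y : ℕ)

namespace Expr

open Classical in
noncomputable def eval (N : ℕ) (A : ℕ → ℕ → ℕ) : Expr → (ℕ → ℕ) → ℕ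
  | var x, ρ => ρ x
  | const n, _ => n
  | add e f, ρ => e.eval N A ρ + f.eval N A ρ
  | sub e f, ρ => e.eval N A ρ - f.eval N A ρ
  | rd a e, ρ => A a (e.eval N A ρ)
  | ite c e f, ρ => if c.eval N A ρ ≠ 0 then e.eval N A ρ else f.eval N A ρ
  | sum x e, ρ => ∑ i ∈ Finset.range N, e.eval N A (Function.update ρ x i)
  | tc a b e x y, ρ =>
    if Relation.ReflTransGen (fun i j => i < N ∧ j < N ∧
      e.eval N A (Function.update (Function.update ρ a i) b j) ≠ 0) (ρ x) (ρ y) then 1 else 0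

/-- All variables lie in `[2, k)`, and all arrays in `[0, k)`. -/
def WF (k : ℕ) : Expr → Bool
  | var x => 2 ≤ x && x < k
  | const _ => true
  | add e f => e.WF k && f.WF k
  | sub e f => e.WF k && f.WF k
  | rd a e => a < k && e.WF k
  | ite c e f => c.WF k && e.WF k && f.WF k
  | sum x e => 2 ≤ x && x < k && e.WF k
  | tc a b e x y => 2 ≤ a && a < k && 2 ≤ b && b < k && 2 ≤ x && x < k && 2 ≤ y && y < k && e.WF k

/-- This is what allows compiled code to use everything from `k` upwards as scratch space, and
registers `0` and `1` for the answer and the size of the domain. -/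
theorem eval_congr {N k : ℕ} {A A' : ℕ → ℕ → ℕ} {ρ ρ' : ℕ → ℕ} (e : Expr) (he : e.WF k = true)
    (hA : ∀ a < k, A a = A' a) (hρ : ∀ x, 2 ≤ x → x < k → ρ x = ρ' x) :
    e.eval N A ρ = e.eval N A' ρ' := by
  have upd : ∀ {ρ ρ' : ℕ → ℕ} (x i : ℕ), (∀ x, 2 ≤ x → x < k → ρ x = ρ' x) →
      ∀ y, 2 ≤ y → y < k → Function.update ρ x i y = Function.update ρ' x i y := by
    intro ρ ρ' x i h y h2 hk
    simp only [Function.update_apply, h y h2 hk]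
  induction e generalizing ρ ρ' with
  | var x => simp [WF] at he; exact hρ x he.1 he.2
  | const n => rfl
  | add e f ihe ihf => simp [WF] at he; simp only [eval, ihe he.1 hρ, ihf he.2 hρ]
  | sub e f ihe ihf => simp [WF] at he; simp only [eval, ihe he.1 hρ, ihf he.2 hρ]
  | rd a e ih => simp [WF] at he; simp only [eval, ih he.2 hρ, hA a he.1]
  | ite c e f ihc ihe ihf =>
    simp [WF] at he; simp only [eval, ihc he.1.1 hρ, ihe he.1.2 hρ, ihf he.2 hρ]
  | sum x e ih =>
    simp [WF] at he
    exact Finset.sum_congr rfl fun i _ => ih he.2 (upd x i hρ)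
  | tc a b e x y ih =>
    simp [WF] at he
    have h : ∀ i j, e.eval N A (Function.update (Function.update ρ a i) b j) =
        e.eval N A' (Function.update (Function.update ρ' a i) b j) :=
      fun i j => ih he.2 (upd b j (upd a i hρ))
    rw [eval, eval, hρ x (by omega) (by omega), hρ y (by omega) (by omega)]
    have hr : (fun i j => i < N ∧ j < N ∧
          e.eval N A (Function.update (Function.update ρ a i) b j) ≠ 0) =
        fun i j => i < N ∧ j < N ∧
          e.eval N A' (Function.update (Function.update ρ' a i) b j) ≠ 0 := by
      funext i j; rw [h]
    rw [hr]

/-- The relation defined by `e`, and the loop that extends a set, stored in array `d`, by the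
successors of its members. -/
def closeStep (a b d : ℕ) (P : Program) : Program :=
  forLoop (d + 8) (forLoop (d + 10)
    (.seq (.copy a (d + 8)) (.seq (.copy b (d + 10)) (.seq P
      (.ite (d + 12) (.seq (.load (d + 13) d (d + 8))
        (.ite (d + 13) (.store d (d + 10) (d + 4)) .skip)) .skip)))))

/-- Code that evaluates an expression into register `d`, leaving all registers and arrays below
`d` as they were. -/
def compile : Expr → ℕ → Program
  | var x, d => .copy d x
  | const n, d => .const d n
  | add e f, d => .seq (e.compile d) (.seq (f.compile (d + 1)) (.add d d (d + 1)))
  | sub e f, d => .seq (e.compile d) (.seq (f.compile (d + 1)) (.sub d d (d + 1)))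
  | rd a e, d => .seq (e.compile d) (.load d a d)
  | ite c e f, d => .seq (c.compile d) (.ite d (e.compile d) (f.compile d))
  | sum x e, d => .seq (.copy d x) (.seq (.const (d + 1) 0)
      (.seq (forLoop (d + 2) (.seq (.copy x (d + 2)) (.seq (e.compile (d + 4))
        (.add (d + 1) (d + 1) (d + 4)))))
      (.seq (.copy x d) (.copy d (d + 1)))))
  | tc a b e x y, d => .seq (.copy d a) (.seq (.copy (d + 1) b) (.seq (.copy (d + 2) x)
      (.seq (.copy (d + 3) y) (.seq (.const (d + 4) 1) (.seq (.const (d + 5) 0)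
      (.seq (.store d (d + 3) (d + 5)) (.seq (forLoop (d + 6) (.store d (d + 6) (d + 5)))
      (.seq (.store d (d + 2) (d + 4))
      (.seq (forLoop (d + 6) (closeStep a b d (e.compile (d + 12))))
      (.seq (.copy a d) (.seq (.copy b (d + 1)) (.seq (.load d d (d + 3))
        (.ite d (.const d 1) (.const d 0))))))))))))))

open Polynomial in
/-- A bound on the time that the evaluation of an expression takes. -/
noncomputable def time : Expr → Polynomial ℕ
  | var _ => 1
  | const _ => 1
  | add e f => e.time + f.time + 1
  | sub e f => e.time + f.time + 1
  | rd _ e => e.time + 1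
  | ite c e f => c.time + e.time + f.time + 1
  | sum _ e => X * (e.time + 5) + 6
  | tc _ _ e _ _ => X * (X * (X * (e.time + 9) + 5) + 5) + X * 4 + 17

/-- Two states with the same registers and arrays below `d`. -/
def Agree (d : ℕ) (s s' : State) : Prop :=
  (∀ x < d, s'.reg x = s.reg x) ∧ ∀ a < d, s'.arr a = s.arr a

/-- The specification of the code for `e`. -/
def Correct (e : Expr) (N d : ℕ) : Prop :=
  ∀ s : State, s.reg 1 = N → Does (e.compile d) s (e.time.eval N)
    (fun s' => s'.reg d = e.eval N s.arr s.reg ∧ Agree d s s')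

theorem Agree.refl (d : ℕ) (s : State) : Agree d s s := ⟨fun _ _ => rfl, fun _ _ => rfl⟩

theorem Agree.trans {d : ℕ} {s s' s'' : State} (h : Agree d s s') (h' : Agree d s' s'') :
    Agree d s s'' :=
  ⟨fun x hx => (h'.1 x hx).trans (h.1 x hx), fun a ha => (h'.2 a ha).trans (h.2 a ha)⟩

theorem Agree.mono {d d' : ℕ} {s s' : State} (h : Agree d s s') (hd : d' ≤ d) : Agree d' s s' :=
  ⟨fun x hx => h.1 x (by omega), fun a ha => h.2 a (by omega)⟩

theorem Agree.eval {N k d : ℕ} {s s' : State} (h : Agree d s s') {e : Expr} (he : e.WF k = true)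
    (hk : k ≤ d) : e.eval N s'.arr s'.reg = e.eval N s.arr s.reg :=
  eval_congr e he (fun a ha => h.2 a (by omega)) (fun x _ hx => h.1 x (by omega))

theorem Agree.setReg {d x n : ℕ} {s s' : State} (h : Agree d s s') (hx : d ≤ x) :
    Agree d s (s'.setReg x n) :=
  ⟨fun y hy => by rw [State.reg_setReg, if_neg (by omega), h.1 y hy], h.2⟩

/-- The second operand is compiled one register higher, which protects the value of the first.
Shared by addition and subtraction. -/
theorem correct_binary {e f : Expr} {N k d : ℕ} (hf : f.WF k = true) (hd : k ≤ d)
    (h1 : 1 < d) (ihe : Correct e N d) (ihf : Correct f N (d + 1)) (s : State) (hs : s.reg 1 = N)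
    {P : Program} {Q : State → Prop}
    (hP : ∀ s', s'.reg d = e.eval N s.arr s.reg → s'.reg (d + 1) = f.eval N s.arr s.reg →
      Agree d s s' → Does P s' 1 Q) :
    Does (.seq (e.compile d) (.seq (f.compile (d + 1)) P)) s
      (e.time.eval N + f.time.eval N + 1) Q := by
  refine Does.mono (Does.seq (ihe s hs) fun s1 h => Does.seq (ihf s1 ?_) fun s2 h2 =>
    hP s2 ?_ ?_ ?_) (by rw [add_assoc]) (fun _ h => h)
  · rw [h.2.1 1 h1, hs]
  · rw [h2.2.1 d (by omega), h.1]
  · rw [h2.1, h.2.eval hf hd]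
  · exact h.2.trans (h2.2.mono (by omega))

/-! Reachability in at most `n` steps. -/

def Steps (R : ℕ → ℕ → Prop) (x : ℕ) : ℕ → ℕ → Prop
  | 0, z => z = x
  | n + 1, z => Steps R x n z ∨ ∃ w, Steps R x n w ∧ R w z

theorem Steps.mono {R : ℕ → ℕ → Prop} {x z n m : ℕ} (h : Steps R x n z) (hnm : n ≤ m) :
    Steps R x m z := by
  induction m, hnm using Nat.le_induction with
  | base => exact h
  | succ m _ ih => exact Or.inl ih

/-- Pigeonhole: the sets of points reached in at most `n` steps increase with `n`, and a point
gained after the start lies below `N`. So they are stationary from some stage `n ≤ N` on, even if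
`x` itself lies outside the domain. -/
theorem Steps.of_reflTransGen {R : ℕ → ℕ → Prop} {N x y : ℕ} (hR : ∀ i j, R i j → j < N)
    (h : Relation.ReflTransGen R x y) : Steps R x N y := by
  classical
  have stable : ∃ n ≤ N, ∀ z, Steps R x (n + 1) z → Steps R x n z := by
    by_contra! hcon
    -- If each of the stages `0`, …, `N` gained a point, stage `N + 1` would contain `N + 1` points
    -- below `N`.
    have card : ∀ n ≤ N + 1, n ≤ ((Finset.range N).filter (Steps R x n)).card := by
      intro n
      induction n with
      | zero => simp
      | succ n ih =>
        intro hn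
        obtain ⟨z, hz, hz'⟩ := hcon n (by omega)
        refine Nat.succ_le_of_lt (lt_of_le_of_lt (ih (by omega)) (Finset.card_lt_card ?_))
        refine Finset.ssubset_iff_subset_ne.2 ⟨fun w hw => ?_, fun heq => ?_⟩
        · simp only [Finset.mem_filter] at hw ⊢
          exact ⟨hw.1, Or.inl hw.2⟩
        · obtain h | ⟨w, hw, hwz⟩ := hz
          · exact hz' h
          · have : z ∈ (Finset.range N).filter (Steps R x n) := by
              rw [heq]
              simpa using ⟨hR _ _ hwz, Or.inr ⟨w, hw, hwz⟩⟩
            exact hz' (Finset.mem_filter.1 this).2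
    have h1 := card (N + 1) le_rfl
    have h2 := Finset.card_filter_le (Finset.range N) (Steps R x (N + 1))
    rw [Finset.card_range] at h2
    omega
  obtain ⟨n, hn, hst⟩ := stable
  refine Steps.mono ?_ hn
  induction h with
  | refl => exact Steps.mono (n := 0) rfl (Nat.zero_le n)
  | tail _ hr ih => exact hst _ (Or.inr ⟨_, ih, hr⟩)

/-! ### Code for transitive closures -/

/-- The registers during the computation of a transitive closure. -/
structure Frame (a b x y d : ℕ) (s₀ s : State) : Prop where
  reg : ∀ z < d, z ≠ a → z ≠ b → s.reg z = s₀.reg z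
  arr : ∀ c < d, s.arr c = s₀.arr c
  reg0 : s.reg d = s₀.reg a
  reg1 : s.reg (d + 1) = s₀.reg b
  reg2 : s.reg (d + 2) = s₀.reg x
  reg3 : s.reg (d + 3) = s₀.reg y
  reg4 : s.reg (d + 4) = 1
  reg5 : s.reg (d + 5) = 0

theorem Frame.setReg {a b x y d z n : ℕ} {s₀ s : State} (h : Frame a b x y d s₀ s)
    (hz : d + 6 ≤ z ∨ z < d ∧ (z = a ∨ z = b)) : Frame a b x y d s₀ (s.setReg z n) where
  reg w hw ha hb := by rw [State.reg_setReg, if_neg (by omega), h.reg w hw ha hb]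
  arr := h.arr
  reg0 := by rw [State.reg_setReg, if_neg (by omega), h.reg0]
  reg1 := by rw [State.reg_setReg, if_neg (by omega), h.reg1]
  reg2 := by rw [State.reg_setReg, if_neg (by omega), h.reg2]
  reg3 := by rw [State.reg_setReg, if_neg (by omega), h.reg3]
  reg4 := by rw [State.reg_setReg, if_neg (by omega), h.reg4]
  reg5 := by rw [State.reg_setReg, if_neg (by omega), h.reg5]

theorem Frame.setArr {a b x y d c i n : ℕ} {s₀ s : State} (h : Frame a b x y d s₀ s)
    (hc : d ≤ c) : Frame a b x y d s₀ (s.setArr c i n) where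
  reg := h.reg
  arr e he := by rw [State.arr_setArr_of_ne _ _ _ (by omega), h.arr e he]
  reg0 := h.reg0
  reg1 := h.reg1
  reg2 := h.reg2
  reg3 := h.reg3
  reg4 := h.reg4
  reg5 := h.reg5

theorem Frame.agree {a b x y d : ℕ} {s₀ s s' : State} (h : Frame a b x y d s₀ s)
    (h' : Agree (d + 12) s s') : Frame a b x y d s₀ s' where
  reg w hw ha hb := by rw [h'.1 w (by omega), h.reg w hw ha hb]
  arr e he := by rw [h'.2 e (by omega), h.arr e he]
  reg0 := by rw [h'.1 _ (by omega), h.reg0]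
  reg1 := by rw [h'.1 _ (by omega), h.reg1]
  reg2 := by rw [h'.1 _ (by omega), h.reg2]
  reg3 := by rw [h'.1 _ (by omega), h.reg3]
  reg4 := by rw [h'.1 _ (by omega), h.reg4]
  reg5 := by rw [h'.1 _ (by omega), h.reg5]

/-- The treatment of one pair `(i, j)`: `j` joins the stored set if `i` is a member and the relation
holds, and otherwise the set stays as it is. The expression is compiled at `d + 12`, above all
registers in use here. -/
theorem closeBody_spec {a b x y d k N : ℕ} {e : Expr} (he : e.WF k = true) (hd : k ≤ d)
    (ha : 2 ≤ a) (ha' : a < k) (hb : 2 ≤ b) (hb' : b < k) (ih : Correct e N (d + 12))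
    {s₀ : State} (h0 : s₀.reg 1 = N) {i j : ℕ} (s : State) (hs : Frame a b x y d s₀ s)
    (hi : s.reg (d + 8) = i) (hj : s.reg (d + 10) = j) :
    Does (.seq (.copy a (d + 8)) (.seq (.copy b (d + 10)) (.seq (e.compile (d + 12))
      (.ite (d + 12) (.seq (.load (d + 13) d (d + 8))
        (.ite (d + 13) (.store d (d + 10) (d + 4)) .skip)) .skip)))) s (e.time.eval N + 6)
      (fun s' => Frame a b x y d s₀ s' ∧
        (∀ z, d + 6 ≤ z → z < d + 12 → s'.reg z = s.reg z) ∧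
        ((e.eval N s₀.arr (Function.update (Function.update s₀.reg a i) b j) ≠ 0 ∧
            s.arr d i ≠ 0 ∧ ∀ z, s'.arr d z = if z = j then 1 else s.arr d z) ∨
          (¬ (e.eval N s₀.arr (Function.update (Function.update s₀.reg a i) b j) ≠ 0 ∧
            s.arr d i ≠ 0) ∧ s'.arr d = s.arr d))) := by
  refine Does.mono (T := 1 + (1 + (e.time.eval N + 4))) (Does.seq_copy (Does.seq_copy
    (Does.seq (ih _ ?_) (R := _) fun s' hs' => ?_))) (by omega) (fun _ h => h)
  · rw [State.reg_setReg, if_neg (by omega), State.reg_setReg, if_neg (by omega),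
      hs.reg 1 (by omega) (by omega) (by omega), h0]
  · have hF : Frame a b x y d s₀ s' :=
      ((hs.setReg (.inr (by omega))).setReg (.inr (by omega))).agree hs'.2
    have hr : ∀ z, d + 6 ≤ z → z < d + 12 → s'.reg z = s.reg z := by
      intro z hz hz'
      rw [hs'.2.1 z hz', State.reg_setReg, if_neg (by omega), State.reg_setReg,
        if_neg (by omega)]
    have harr : s'.arr d = s.arr d := hs'.2.2 d (by omega)
    have hev : s'.reg (d + 12) =
        e.eval N s₀.arr (Function.update (Function.update s₀.reg a i) b j) := by
      rw [hs'.1]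
      refine eval_congr e he (fun c hc => hs.arr c (by omega)) fun z h2 hz => ?_
      simp only [State.reg_setReg, Function.update_apply, hi]
      rw [if_neg (show d + 10 ≠ a by omega), hj]
      split_ifs with h1 h3
      · rfl
      · rfl
      · exact hs.reg z (by omega) h3 h1
    refine Does.mono (Does.ite (T := 3) (fun hne => ?_) fun h0 => ?_) le_rfl (fun _ h => h)
    · refine Does.mono (Does.seq_load (T := 1 + 1) (Does.ite (T := 1) (fun hW => ?_) fun hW => ?_))
        (by omega) (fun _ h => h)
      · refine Does.store ⟨((hF.setReg (.inl (by omega))).setArr le_rfl), fun z hz hz' => ?_,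
          Or.inl ⟨hev ▸ hne, ?_, fun z => ?_⟩⟩
        · rw [State.reg_setArr, State.reg_setReg, if_neg (by omega), hr z hz hz']
        · simpa [hr, hi, harr] using hW
        · simp [hr, hj, harr, hF.reg4]
      · refine Does.skip ⟨hF.setReg (.inl (by omega)), fun z hz hz' => ?_, Or.inr ⟨?_, harr⟩⟩
        · rw [State.reg_setReg, if_neg (by omega), hr z hz hz']
        · simp only [State.reg_setReg, if_true, hr (d + 8) (by omega) (by omega), hi, harr] at hW
          simp [hW]
    · refine (Does.skip ⟨hF, hr, Or.inr ⟨?_, harr⟩⟩).mono (by omega) (fun _ h => h)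
      rw [← hev, h0]; simp

/-- What remains true of the stored set `W` during one round that extends the set `W₀`: its
members satisfy `T`, and it contains `W₀`. -/
structure Grows (W₀ : ℕ → ℕ) (T dom : ℕ → Prop) (W : ℕ → ℕ) : Prop where
  sound : ∀ z, dom z → W z ≠ 0 → T z
  grow : ∀ z, W₀ z ≠ 0 → W z ≠ 0

/-- The set is extended in place, so points added early in the round may themselves contribute
successors, and the result need not be exactly one step further. Hence two one-sided bounds: the set
stays inside any `T` that is closed under the relation, and it gains all successors of its initial
members. Cells outside `dom` may hold rubbish. -/
theorem closeStep_spec {a b x y d k N : ℕ} {e : Expr} (he : e.WF k = true) (hd : k ≤ d)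
    (ha : 2 ≤ a) (ha' : a < k) (hb : 2 ≤ b) (hb' : b < k) (ih : Correct e N (d + 12))
    {s₀ : State} (h0 : s₀.reg 1 = N) {R : ℕ → ℕ → Prop} (hR : R = fun i j => i < N ∧ j < N ∧
      e.eval N s₀.arr (Function.update (Function.update s₀.reg a i) b j) ≠ 0)
    {T dom : ℕ → Prop} (hT : ∀ i j, R i j → T i → T j) (hdom : ∀ z < N, dom z) (s : State)
    (hs : Frame a b x y d s₀ s) (hWT : ∀ z, dom z → s.arr d z ≠ 0 → T z) :
    Does (closeStep a b d (e.compile (d + 12))) s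
      (N * (N * (e.time.eval N + 9) + 5) + 2)
      (fun s' => Frame a b x y d s₀ s' ∧ s'.reg (d + 6) = s.reg (d + 6) ∧
        Grows (s.arr d) T dom (s'.arr d) ∧
        ∀ i j, R i j → s.arr d i ≠ 0 → s'.arr d j ≠ 0) := by
  subst hR
  have reg1 : ∀ s', Frame a b x y d s₀ s' → s'.reg 1 = N := fun s' h => by
    rw [h.reg 1 (by omega) (by omega) (by omega), h0]
  refine Does.mono (Does.forLoop (N := N) (B := N * (e.time.eval N + 9) + 2)
    (fun m s' => Frame a b x y d s₀ s' ∧ s'.reg (d + 6) = s.reg (d + 6) ∧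
      Grows (s.arr d) T dom (s'.arr d) ∧ ∀ i j, m ≤ i → (i < N ∧ j < N ∧
      e.eval N s₀.arr (Function.update (Function.update s₀.reg a i) b j) ≠ 0) →
        s.arr d i ≠ 0 → s'.arr d j ≠ 0) (reg1 s hs)
    (fun i hi s1 hc h1 => ?_) ?_) (by ring_nf; rfl)
    (fun s' h => ⟨h.1, h.2.1, h.2.2.1, fun i j hij => h.2.2.2 i j (Nat.zero_le i) hij⟩)
  · obtain ⟨hF, h6, hG, hcl⟩ := h1
    refine Does.mono (Does.forLoop (N := N) (B := e.time.eval N + 6)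
      (fun m s' => Frame a b x y d s₀ s' ∧ s'.reg (d + 6) = s.reg (d + 6) ∧ s'.reg (d + 8) = i ∧
        Grows (s.arr d) T dom (s'.arr d) ∧
        (∀ z, s1.arr d z ≠ 0 → s'.arr d z ≠ 0) ∧ ∀ j, m ≤ j → (i < N ∧ j < N ∧
        e.eval N s₀.arr (Function.update (Function.update s₀.reg a i) b j) ≠ 0) →
          s.arr d i ≠ 0 → s'.arr d j ≠ 0) ?_
      (fun j hj s2 hc2 h2 => ?_) ?_) (by ring_nf; rfl) (fun s' h => ?_)
    · refine reg1 _ ((hF.setReg (.inl (by omega))).setReg (.inl (by omega)))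
    · obtain ⟨hF2, h62, h82, hG2, hg2, hcl2⟩ := h2
      refine Does.mono (closeBody_spec (i := i) (j := j) he hd ha ha' hb hb' ih h0 _
        ((hF2.setReg (.inl (by omega))).setReg (.inl (by omega))) ?_ ?_) le_rfl (fun s3 h3 => ?_)
      · simp [h82]
      · simp
      · obtain ⟨hF3, hr3, h3⟩ := h3
        simp only [State.arr_setReg] at h3
        refine ⟨by rw [hr3 _ (by omega) (by omega)]; simp, hF3,
          by rw [hr3 _ (by omega) (by omega)]; simp [h62],
          by rw [hr3 _ (by omega) (by omega)]; simp [h82], ?_⟩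
        rcases h3 with ⟨hne, hW, h3⟩ | ⟨hne, h3⟩
        · refine ⟨⟨fun z hz hz' => ?_, fun z hz => ?_⟩, fun z hz => ?_, fun z hz hR hz' => ?_⟩
          · rw [h3] at hz'
            split_ifs at hz' with hzj
            · subst hzj
              exact hT i z ⟨hi, hj, hne⟩ (hG2.sound i (hdom i hi) hW)
            · exact hG2.sound z hz hz'
          · rw [h3]; split_ifs
            · simp
            · exact hG2.grow z hz
          · rw [h3]; split_ifs
            · simp
            · exact hg2 z hz
          · rw [h3]; split_ifs with hzj
            · simp
            · exact hcl2 z (by omega) hR hz'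
        · rw [h3]
          refine ⟨hG2, hg2, fun z hz hR hz' => ?_⟩
          rcases Nat.eq_or_lt_of_le hz with rfl | hlt
          -- The pair just treated: `i` was a member at the start of the round, hence still is, so
          -- the test cannot have failed.
          · exact absurd ⟨hR.2.2, hG2.grow i hz'⟩ hne
          · exact hcl2 z hlt hR hz'
    · refine ⟨(((hF.setReg (.inl (by omega))).setReg (.inl (by omega))).setReg
        (.inl (by omega))), by simp [h6], by simp, hG, fun z hz => hz, fun j hj hR => ?_⟩
      omega
    · obtain ⟨hF2, h62, h82, hG2, hg2, hcl2⟩ := h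
      refine ⟨h82, hF2, h62, hG2, fun i' j hi' hR hW => ?_⟩
      rcases Nat.eq_or_lt_of_le hi' with rfl | hlt
      · exact hcl2 j (Nat.zero_le j) hR hW
      · exact hg2 j (hcl i' j hlt hR hW)
  · exact ⟨hs.setReg (.inl (by omega)), by simp, ⟨fun z hz => hWT z hz, fun z hz => hz⟩,
      fun i j hi hR => by omega⟩

/-- After `N` rounds the stored set contains all points reachable in `N` steps, thus all reachable
ones, and never anything else among the cells that matter. -/
theorem correct_tc {a b x y d k N : ℕ} {e : Expr} (he : (tc a b e x y).WF k = true) (hd : k ≤ d)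
    (ih : Correct e N (d + 12)) : Correct (tc a b e x y) N d := by
  intro s h0
  simp only [WF, Bool.and_eq_true, decide_eq_true_eq] at he
  obtain ⟨⟨⟨⟨⟨⟨⟨⟨ha, ha'⟩, hb⟩, hb'⟩, hx⟩, hx'⟩, hy⟩, hy'⟩, he⟩ := he
  set R : ℕ → ℕ → Prop := fun i j => i < N ∧ j < N ∧
    e.eval N s.arr (Function.update (Function.update s.reg a i) b j) ≠ 0 with hR
  have reg1 : ∀ s', Frame a b x y d s s' → s'.reg 1 = N := fun s' h => by
    rw [h.reg 1 (by omega) (by omega) (by omega), h0]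
  have hT : ∀ i j, R i j → Relation.ReflTransGen R (s.reg x) i →
    Relation.ReflTransGen R (s.reg x) j := fun i j hij h => h.tail hij
  refine Does.mono (T := 1 + (1 + (1 + (1 + (1 + (1 + (1 + ((N * (1 + 3) + 2) + (1 +
    ((N * ((N * (N * (e.time.eval N + 9) + 5) + 2) + 3) + 2) + (1 + (1 + (1 + (1 + 1))))))))))))))
    ?_ ?_ (fun _ h => h)
  · rw [compile]
    iterate 4 refine Does.seq_copy ?_
    iterate 2 refine Does.seq_const ?_
    refine Does.seq_store (Does.seq (Does.forLoop (N := N) (fun m s' => Frame a b x y d s s' ∧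
      s'.arr d (s.reg y) = 0 ∧ ∀ j, m ≤ j → j < N → s'.arr d j = 0) ?_
        (fun i hi s1 hc h1 => ?_) ?_) fun s1 h1 => Does.seq_store
      -- The cell of `y` is cleared and controlled separately, because `y` may lie outside the
      -- domain and its cell is read at the end.
      (Does.seq (Does.forLoop (N := N) (fun m s' => Frame a b x y d s s' ∧
        (∀ z, (z < N ∨ z = s.reg y) → s'.arr d z ≠ 0 → Relation.ReflTransGen R (s.reg x) z) ∧
        ∀ z, Steps R (s.reg x) (N - m) z → s'.arr d z ≠ 0) ?_
          (fun i hi s2 hc h2 => ?_) ?_) fun s2 h2 => Does.seq_copy (Does.seq_copy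
            (Does.seq_load (Does.ite (fun hne => Does.const ?_) fun h0 => Does.const ?_)))))
    · simp [h0, show d ≠ 0 by omega, show 1 ≠ d by omega]
    · obtain ⟨hF, hy0, h1⟩ := h1
      refine Does.store ⟨by simp, ((hF.setReg (.inl (by omega))).setReg (.inl (by omega))).setArr
        le_rfl, ?_, fun j hj hjN => ?_⟩
      · simp [hF.reg5, hy0]
      · rcases Nat.eq_or_lt_of_le hj with rfl | hlt
        · simp [hF.reg5]
        · simp [hF.reg5, h1 j hlt hjN]
    · refine ⟨Frame.setReg (Frame.setArr ?_ le_rfl) (.inl (by omega)), ?_, fun j hj hjN => ?_⟩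
      · constructor
        · intro z hz _ _
          simp [show z ≠ d by omega, show z ≠ d + 1 by omega, show z ≠ d + 2 by omega,
            show z ≠ d + 3 by omega, show z ≠ d + 4 by omega, show z ≠ d + 5 by omega]
        · intro c hc; rfl
        · simp
        · simp [show b ≠ d by omega]
        · simp [show x ≠ d by omega, show x ≠ d + 1 by omega]
        · simp [show y ≠ d by omega, show y ≠ d + 1 by omega, show y ≠ d + 2 by omega]
        · simp
        · simp
      · simp [show y ≠ d by omega, show y ≠ d + 1 by omega, show y ≠ d + 2 by omega]
      · omega
    · exact reg1 _ (h1.1.setArr le_rfl)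
    · obtain ⟨hF, hS, hC⟩ := h2
      refine Does.mono (closeStep_spec he hd ha ha' hb hb' ih h0 hR hT
        (dom := fun z => z < N ∨ z = s.reg y) (fun z hz => Or.inl hz) _
        ((hF.setReg (.inl (by omega))).setReg (.inl (by omega))) hS) le_rfl (fun s3 h3 => ?_)
      obtain ⟨hF3, h63, hG3, hC3⟩ := h3
      refine ⟨by rw [h63]; simp, hF3, hG3.sound, fun z hz => ?_⟩
      rw [show N - i = N - (i + 1) + 1 by omega] at hz
      rcases hz with hz | ⟨w, hw, hwz⟩
      · exact hG3.grow z (hC z hz)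
      · exact hC3 w z hwz (hC w hw)
    · obtain ⟨hF, hy0, h1⟩ := h1
      refine ⟨(hF.setArr le_rfl).setReg (.inl (by omega)), fun z hz hz' => ?_, fun z hz => ?_⟩
      · simp only [State.arr_setReg, State.arr_setArr, hF.reg2, hF.reg4, true_and] at hz'
        split_ifs at hz' with hzx
        · rw [hzx]
        · rcases hz with hz | rfl
          · exact absurd (h1 z (Nat.zero_le z) hz) hz'
          · exact absurd hy0 hz'
      · rw [Nat.sub_self] at hz
        simp [hz.symm ▸ hF.reg2, hF.reg4, show z = s.reg x from hz]
    · obtain ⟨hF, hS, hC⟩ := h2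
      refine ⟨?_, fun c hc => ?_, fun c hc => hF.arr c hc⟩
      · simp only [State.reg_setReg, if_true, if_neg (show d + 3 ≠ a by omega),
          if_neg (show d + 3 ≠ b by omega), State.arr_setReg, hF.reg3] at hne
        rw [State.reg_setReg, if_pos rfl, eval, if_pos]
        exact hS _ (Or.inr rfl) hne
      · simp only [State.reg_setReg, if_neg (show c ≠ d by omega),
          if_neg (show d + 1 ≠ a by omega), hF.reg0, hF.reg1]
        split_ifs with h1 h2
        · rw [h1]
        · rw [h2]
        · exact hF.reg c (by omega) h2 h1
    · obtain ⟨hF, hS, hC⟩ := h2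
      refine ⟨?_, fun c hc => ?_, fun c hc => hF.arr c hc⟩
      · simp only [State.reg_setReg, if_true, if_neg (show d + 3 ≠ a by omega),
          if_neg (show d + 3 ≠ b by omega), State.arr_setReg, hF.reg3] at h0
        rw [State.reg_setReg, if_pos rfl, eval, if_neg]
        intro h
        exact hC _ (Steps.of_reflTransGen (fun i j hij => hij.2.1) h) h0
      · simp only [State.reg_setReg, if_neg (show c ≠ d by omega),
          if_neg (show d + 1 ≠ a by omega), hF.reg0, hF.reg1]
        split_ifs with h1 h2
        · rw [h1]
        · rw [h2]
        · exact hF.reg c (by omega) h2 h1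
  · simp only [time, Polynomial.eval_add, Polynomial.eval_mul, Polynomial.eval_X,
      Polynomial.eval_ofNat]
    exact le_of_eq (by ring)

/-! ### Code for sums and for all expressions -/

theorem correct_sum {x d k N : ℕ} {e : Expr} (he : (sum x e).WF k = true) (hd : k ≤ d)
    (ih : Correct e N (d + 4)) : Correct (sum x e) N d := by
  intro s h0
  simp only [WF, Bool.and_eq_true, decide_eq_true_eq] at he
  obtain ⟨⟨hx, hx'⟩, he⟩ := he
  refine Does.mono (T := 1 + (1 + ((N * ((1 + (e.time.eval N + 1)) + 3) + 2) + (1 + 1)))) 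
    ?_ ?_ (fun _ h => h)
  · rw [compile]
    refine Does.seq_copy (Does.seq_const (Does.seq (Does.forLoop (N := N)
      -- The loop counts down, so the partial sum runs over `[m, N)` and grows at its lower end. The
      -- bound variable is saved in register `d` and restored at the end.
      (fun m s' => (∀ z < d, z ≠ x → s'.reg z = s.reg z) ∧ (∀ c < d, s'.arr c = s.arr c) ∧
        s'.reg d = s.reg x ∧ s'.reg (d + 1) =
          ∑ i ∈ Finset.Ico m N, e.eval N s.arr (Function.update s.reg x i))
      ?_ (fun i hi s1 hc h1 => ?_) ?_) fun s1 h1 => Does.seq_copy (Does.copy ?_)))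
    · simp [h0, show d ≠ 0 by omega, show 1 ≠ d by omega]
    · obtain ⟨hr, ha, h2, h3⟩ := h1
      refine Does.seq_copy (Does.seq (ih _ ?_) fun s2 hs2 => Does.add ?_)
      · simp [show 1 ≠ x by omega, show d ≠ 0 by omega]
        rw [hr 1 (by omega) (by omega), h0]
      · obtain ⟨hv, hA⟩ := hs2
        have hv' : s2.reg (d + 4) = e.eval N s.arr (Function.update s.reg x i) := by
          rw [hv]
          refine eval_congr e he (fun c hc => ha c (by omega)) fun z h2 hz => ?_
          simp only [State.reg_setReg, Function.update_apply, if_true,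
            if_neg (show z ≠ d + 2 by omega), if_neg (show z ≠ d + 2 + 1 by omega)]
          split_ifs with h1
          · rfl
          · exact hr z (by omega) h1
        refine ⟨?_, fun z hz hzx => ?_, fun c hc => ?_, ?_, ?_⟩
        · rw [State.reg_setReg, if_neg (by omega), hA.1 _ (by omega)]
          simp [show d + 2 ≠ x by omega]
        · rw [State.reg_setReg, if_neg (by omega), hA.1 _ (by omega)]
          simp [hzx, show z ≠ d + 2 by omega, show z ≠ d + 2 + 1 by omega, hr z hz hzx]
        · rw [State.arr_setReg, hA.2 _ (by omega)]
          exact ha c hc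
        · rw [State.reg_setReg, if_neg (by omega), hA.1 _ (by omega)]
          simp [show d ≠ x by omega, show d ≠ d + 2 + 1 by omega, h2]
        · rw [State.reg_setReg, if_pos rfl, hA.1 _ (by omega), hv', Finset.sum_eq_sum_Ico_succ_bot hi,
            add_comm]
          simp [show d + 1 ≠ x by omega, h3]
    · refine ⟨fun z hz hzx => ?_, fun c hc => rfl, ?_, ?_⟩
      · simp [show z ≠ d by omega, show z ≠ d + 1 by omega, show z ≠ d + 2 by omega]
      · simp
      · simp
    · obtain ⟨hr, ha, h2, h3⟩ := h1
      refine ⟨?_, fun z hz => ?_, fun c hc => ha c hc⟩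
      · rw [State.reg_setReg, if_pos rfl, State.reg_setReg, if_neg (by omega), h3, eval,
          Finset.range_eq_Ico]
      · rw [State.reg_setReg, if_neg (by omega), State.reg_setReg]
        split_ifs with h
        · rw [h2, h]
        · exact hr z hz h
  · simp only [time, Polynomial.eval_add, Polynomial.eval_mul, Polynomial.eval_X,
      Polynomial.eval_ofNat]
    exact le_of_eq (by ring)

theorem compile_correct {k N : ℕ} (e : Expr) (he : e.WF k = true) (hk : 2 ≤ k) (d : ℕ)
    (hd : k ≤ d) : Correct e N d := by
  induction e generalizing d with
  | var x =>
    intro s _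
    simp only [time, Polynomial.eval_one]
    exact Does.copy ⟨by simp [eval], (Agree.refl d s).setReg le_rfl⟩
  | const n =>
    intro s _
    simp only [time, Polynomial.eval_one]
    exact Does.const ⟨by simp [eval], (Agree.refl d s).setReg le_rfl⟩
  | add e f ihe ihf =>
    intro s hs
    simp only [WF, Bool.and_eq_true] at he
    simp only [time, Polynomial.eval_add, Polynomial.eval_one]
    exact correct_binary he.2 hd (by omega) (ihe he.1 d hd) (ihf he.2 _ (by omega)) s hs
      fun s' h h' hA => Does.add ⟨by simp [eval, h, h'], hA.setReg le_rfl⟩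
  | sub e f ihe ihf =>
    intro s hs
    simp only [WF, Bool.and_eq_true] at he
    simp only [time, Polynomial.eval_add, Polynomial.eval_one]
    exact correct_binary he.2 hd (by omega) (ihe he.1 d hd) (ihf he.2 _ (by omega)) s hs
      fun s' h h' hA => Does.sub ⟨by simp [eval, h, h'], hA.setReg le_rfl⟩
  | rd a e ih =>
    intro s hs
    simp only [WF, Bool.and_eq_true, decide_eq_true_eq] at he
    simp only [time, Polynomial.eval_add, Polynomial.eval_one]
    exact Does.seq (ih he.2 d hd s hs) fun s' h => Does.load
      ⟨by simp [eval, h.1, h.2.2 a (by omega)], h.2.setReg le_rfl⟩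
  | ite c e f ihc ihe ihf =>
    intro s hs
    simp only [WF, Bool.and_eq_true] at he
    simp only [time, Polynomial.eval_add, Polynomial.eval_one]
    refine Does.mono (T := c.time.eval N + (e.time.eval N + f.time.eval N + 1))
      (Does.seq (ihc he.1.1 d hd s hs) fun s' h => Does.ite (fun hc => ?_) fun hc => ?_)
      (by omega) (fun _ h => h)
    · refine (ihe he.1.2 d hd s' (by rw [h.2.1 1 (by omega), hs])).mono (by omega) fun s'' h' => ?_
      rw [h.1] at hc
      exact ⟨by rw [h'.1, eval, if_pos hc, h.2.eval he.1.2 hd], h.2.trans h'.2⟩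
    · refine (ihf he.2 d hd s' (by rw [h.2.1 1 (by omega), hs])).mono (by omega) fun s'' h' => ?_
      rw [h.1] at hc
      exact ⟨by rw [h'.1, eval, if_neg (by simpa using hc), h.2.eval he.2 hd], h.2.trans h'.2⟩
  | sum x e ih =>
    refine correct_sum he hd (ih ?_ _ (by omega))
    simp only [WF, Bool.and_eq_true] at he
    exact he.2
  | tc a b e x y ih =>
    refine correct_tc he hd (ih ?_ _ (by omega))
    simp only [WF, Bool.and_eq_true] at he
    exact he.2

end Expr

end RAM

namespace RAM

/-! ### Statements -/

/-- Statements: assignment to a variable, simultaneous assignment to all cells of an array below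
the size of the domain, composition, and iteration over the domain. -/
inductive Stmt
  | asg (x : ℕ) (e : Expr)
  | upd (a x : ℕ) (e : Expr)
  | seq (S T : Stmt)
  | loop (x : ℕ) (S : Stmt)

/-- Apply `f (n - 1)`, …, `f 0` in this order. -/
def countdown {α : Type*} (f : ℕ → α → α) : ℕ → α → α
  | 0, s => s
  | n + 1, s => countdown f n (f n s)

namespace Stmt

open _root_.RAM.Expr

noncomputable def den (N : ℕ) : Stmt → State → State
  | asg x e, s => s.setReg x (e.eval N s.arr s.reg)
  | upd a x e, s => { s with
      arr := Function.update s.arr a fun i =>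
        if i < N then e.eval N s.arr (Function.update s.reg x i) else s.arr a i }
  | seq S T, s => T.den N (S.den N s)
  | loop x S, s => countdown (fun i s => S.den N (s.setReg x i)) N s

/-- All variables lie in `[2, k)`, and all arrays in `[0, k)`. -/
def WF (k : ℕ) : Stmt → Bool
  | asg x e => 2 ≤ x && x < k && e.WF k
  | upd a x e => a < k && 2 ≤ x && x < k && e.WF k
  | seq S T => S.WF k && T.WF k
  | loop x S => 2 ≤ x && x < k && S.WF k

def compile : Stmt → ℕ → Program
  | asg x e, d => .seq (e.compile d) (.copy x d)
  | upd a x e, d => .seq (.copy d x) (.seq (forLoop (d + 1) (.seq (.copy x (d + 1))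
      (.seq (e.compile (d + 3)) (.store d (d + 1) (d + 3)))))
      (.seq (.copy x d) (forLoop (d + 1) (.seq (.load (d + 3) d (d + 1))
        (.store a (d + 1) (d + 3))))))
  | seq S T, d => .seq (S.compile d) (T.compile d)
  | loop x S, d => forLoop d (.seq (.copy x d) (S.compile (d + 2)))

open Polynomial in
/-- A bound on the time that the execution of a statement takes. -/
noncomputable def time : Stmt → Polynomial ℕ
  | asg _ e => e.time + 1
  | upd _ _ e => X * (e.time + 10) + 6
  | seq S T => S.time + T.time
  | loop _ S => X * (S.time + 4) + 2

/-- Variables start at `2`, so the size of the domain stays in register `1` for the code that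
follows. -/
theorem den_reg_one {k N : ℕ} (S : Stmt) (hS : S.WF k = true) (s : State) :
    (S.den N s).reg 1 = s.reg 1 := by
  have hcd : ∀ (f : ℕ → State → State), (∀ i s, (f i s).reg 1 = s.reg 1) → ∀ n s,
      (countdown f n s).reg 1 = s.reg 1 := by
    intro f hf n
    induction n with
    | zero => intro s; rfl
    | succ n ih => intro s; rw [countdown, ih, hf]
  induction S generalizing s with
  | asg x e =>
    simp only [WF, Bool.and_eq_true, decide_eq_true_eq] at hS
    rw [den, State.reg_setReg, if_neg (by omega)]
  | upd a x e => rfl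
  | seq S T ihS ihT =>
    simp only [WF, Bool.and_eq_true] at hS
    rw [den, ihT hS.2, ihS hS.1]
  | loop x S ih =>
    simp only [WF, Bool.and_eq_true, decide_eq_true_eq] at hS
    refine hcd _ (fun i s => ?_) N s
    rw [ih hS.2, State.reg_setReg, if_neg (by omega)]

theorem countdown_congr {k : ℕ} {f : ℕ → State → State}
    (hf : ∀ i s s', Agree k s s' → Agree k (f i s) (f i s')) (n : ℕ) {s s' : State}
    (h : Agree k s s') : Agree k (countdown f n s) (countdown f n s') := by
  induction n generalizing s s' with
  | zero => exact h
  | succ n ih => exact ih (hf n s s' h)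

theorem Agree.setReg_congr {k : ℕ} {s s' : State} (h : Agree k s s') (x n : ℕ) :
    Agree k (s.setReg x n) (s'.setReg x n) :=
  ⟨fun y hy => by simp only [State.reg_setReg, h.1 y hy], h.2⟩

/-- Compiled code reaches the intended state only up to scratch space; this lets the next statement
start from the actual state instead of the intended one. -/
theorem den_congr {k N : ℕ} (S : Stmt) (hS : S.WF k = true) {s s' : State} (h : Agree k s s') :
    Agree k (S.den N s) (S.den N s') := by
  induction S generalizing s s' with
  | asg x e =>
    simp only [WF, Bool.and_eq_true] at hS
    rw [den, den, h.eval hS.2 le_rfl]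
    exact Agree.setReg_congr h x _
  | upd a x e =>
    simp only [WF, Bool.and_eq_true, decide_eq_true_eq] at hS
    refine ⟨h.1, fun b hb => ?_⟩
    simp only [den, Function.update_apply]
    split_ifs with hba
    · funext i
      split_ifs with hi
      · refine eval_congr e hS.2 (fun c hc => h.2 c hc) fun z _ hz => ?_
        simp only [Function.update_apply, h.1 z hz]
      · rw [h.2 a hS.1.1.1]
    · exact h.2 b hb
  | seq S T ihS ihT =>
    simp only [WF, Bool.and_eq_true] at hS
    exact ihT hS.2 (ihS hS.1 h)
  | loop x S ih =>
    simp only [WF, Bool.and_eq_true] at hS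
    exact countdown_congr (fun i s s' h => ih hS.2 (Agree.setReg_congr h x i)) N h

/-- The specification of the code for `S`. -/
def Correct (S : Stmt) (N k d : ℕ) : Prop :=
  ∀ s : State, s.reg 1 = N → Does (S.compile d) s (S.time.eval N)
    (fun s' => Agree k (S.den N s) s' ∧ ∀ z, k ≤ z → z < d → s'.reg z = s.reg z)

/-- The expression may read the very array that is overwritten, so all new values are first
collected in the scratch array `d` and then copied. -/
theorem correct_upd {a x d k N : ℕ} {e : Expr} (hS : (upd a x e).WF k = true) (hk : 2 ≤ k)
    (hd : k ≤ d) : Correct (upd a x e) N k d := by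
  intro s h0
  simp only [WF, Bool.and_eq_true, decide_eq_true_eq] at hS
  obtain ⟨⟨⟨ha, hx⟩, hx'⟩, he⟩ := hS
  refine Does.mono (T := 1 + ((N * ((1 + (e.time.eval N + 1)) + 3) + 2) + (1 +
    (N * ((1 + 1) + 3) + 2)))) ?_ ?_ (fun _ h => h)
  · rw [compile]
    refine Does.seq_copy (Does.seq (Does.forLoop (N := N)
      (fun m s' => (∀ z < d, z ≠ x → s'.reg z = s.reg z) ∧ (∀ c < d, s'.arr c = s.arr c) ∧
        s'.reg d = s.reg x ∧ ∀ i, m ≤ i → i < N →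
          s'.arr d i = e.eval N s.arr (Function.update s.reg x i))
      ?_ (fun i hi s1 hc h1 => ?_) ?_) fun s1 h1 => Does.seq_copy
        (Does.mono (Does.forLoop (N := N)
      (fun m s' => (∀ z < d, s'.reg z = s.reg z) ∧ (∀ c < d, c ≠ a → s'.arr c = s.arr c) ∧
        s'.arr d = s1.arr d ∧ ∀ i, s'.arr a i = if m ≤ i ∧ i < N then s1.arr d i else s.arr a i)
      ?_ (fun i hi s2 hc h2 => ?_) ?_) le_rfl fun s2 h2 => ?_))
    · simp [h0, show 1 ≠ d by omega]
    · obtain ⟨hr, hA, h2, h3⟩ := h1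
      refine Does.seq_copy (Does.seq (compile_correct e he hk _ (by omega) _ ?_)
        fun s2 hs2 => Does.store ?_)
      · simp [show 1 ≠ x by omega, show d ≠ 0 by omega]
        rw [hr 1 (by omega) (by omega), h0]
      · obtain ⟨hv, hA2⟩ := hs2
        have hv' : s2.reg (d + 3) = e.eval N s.arr (Function.update s.reg x i) := by
          rw [hv]
          refine eval_congr e he (fun c hc => hA c (by omega)) fun z h2 hz => ?_
          simp only [State.reg_setReg, Function.update_apply, if_true,
            if_neg (show z ≠ d + 1 by omega), if_neg (show z ≠ d + 1 + 1 by omega)]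
          split_ifs with h1
          · rfl
          · exact hr z (by omega) h1
        have hc2 : s2.reg (d + 1) = i := by
          rw [hA2.1 _ (by omega)]
          simp [show d + 1 ≠ x by omega]
        refine ⟨hc2, fun z hz hzx => ?_, fun c hc => ?_, ?_, fun j hj hjN => ?_⟩
        · rw [State.reg_setArr, hA2.1 _ (by omega)]
          simp [hzx, show z ≠ d + 1 by omega, show z ≠ d + 1 + 1 by omega, hr z hz hzx]
        · rw [State.arr_setArr_of_ne _ _ _ (by omega), hA2.2 _ (by omega)]
          exact hA c hc
        · rw [State.reg_setArr, hA2.1 _ (by omega)]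
          simp [show d ≠ x by omega, show d ≠ d + 1 + 1 by omega, h2]
        · rw [State.arr_setArr, hc2, hv']
          rcases Nat.eq_or_lt_of_le hj with rfl | hlt
          · simp
          · rw [if_neg (by omega), hA2.2 d (by omega)]
            exact h3 j hlt hjN
    · refine ⟨fun z hz hzx => ?_, fun c hc => rfl, ?_, fun i hi hi' => by omega⟩
      · simp [show z ≠ d by omega, show z ≠ d + 1 by omega]
      · simp
    · simp [show 1 ≠ x by omega, h1.1 1 (by omega) (by omega), h0]
    · obtain ⟨hr, hA, h2, h3⟩ := h2
      refine Does.seq_load (Does.store ⟨?_, fun z hz => ?_, fun c hc hca => ?_, ?_, fun j => ?_⟩)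
      · simp
      · simp [show z ≠ d + 1 by omega, show z ≠ d + 1 + 1 by omega, show z ≠ d + 3 by omega,
          hr z hz]
      · rw [State.arr_setArr_of_ne _ _ _ hca]
        exact hA c hc hca
      · rw [State.arr_setArr_of_ne _ _ _ (by omega)]
        exact h2
      · simp only [State.arr_setArr, State.reg_setReg, State.arr_setReg, if_true, true_and,
          if_neg (show d + 1 ≠ d + 3 by omega), h2, h3]
        by_cases hji : j = i
        · subst hji; simp [hi]
        · rw [if_neg hji]
          exact if_congr (by omega) rfl rfl
    · obtain ⟨hr, hA, h2, h3⟩ := h1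
      refine ⟨fun z hz => ?_, fun c hc _ => hA c hc, rfl, fun i => ?_⟩
      · rw [State.reg_setReg, if_neg (by omega), State.reg_setReg]
        split_ifs with h
        · rw [h2, h]
        · exact hr z hz h
      · rw [if_neg (by omega)]
        exact congrFun (hA a (by omega)) i
    · obtain ⟨hr, hA, h2, h3⟩ := h2
      refine ⟨⟨fun z hz => hr z (by omega), fun c hc => ?_⟩, fun z hz hzd => hr z hzd⟩
      simp only [den, Function.update_apply]
      split_ifs with hca
      · subst hca
        funext i
        rw [h3]
        by_cases hi : i < N
        · rw [if_pos ⟨Nat.zero_le i, hi⟩, if_pos hi, h1.2.2.2 i (Nat.zero_le i) hi]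
        · rw [if_neg (fun h => hi h.2), if_neg hi]
      · exact hA c (by omega) hca
  · simp only [time, Polynomial.eval_add, Polynomial.eval_mul, Polynomial.eval_X,
      Polynomial.eval_ofNat]
    exact le_of_eq (by ring)

/-- Nested loops are safe because the body is compiled two registers above the counter and preserves
the registers between `k` and its own base. -/
theorem compile_correct {k N : ℕ} (S : Stmt) (hS : S.WF k = true) (hk : 2 ≤ k) (d : ℕ)
    (hd : k ≤ d) : Correct S N k d := by
  induction S generalizing d with
  | asg x e =>
    intro s hs
    simp only [WF, Bool.and_eq_true, decide_eq_true_eq] at hS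
    simp only [time, Polynomial.eval_add, Polynomial.eval_one]
    refine Does.seq (Expr.compile_correct e hS.2 hk d hd s hs) fun s' h => Does.copy ⟨?_, ?_⟩
    · rw [h.1]
      exact Agree.setReg_congr (h.2.mono hd) x _
    · intro z hz hzd
      rw [State.reg_setReg, if_neg (by omega), h.2.1 z hzd]
  | upd a x e => exact correct_upd hS hk hd
  | seq S T ihS ihT =>
    intro s hs
    simp only [WF, Bool.and_eq_true] at hS
    simp only [time, Polynomial.eval_add]
    refine Does.seq (ihS hS.1 d hd s hs) fun s' h => (ihT hS.2 d hd s' ?_).mono le_rfl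
      fun s'' h' => ⟨(den_congr T hS.2 h.1).trans h'.1, fun z hz hzd => ?_⟩
    · rw [h.1.1 1 (by omega), den_reg_one S hS.1, hs]
    · rw [h'.2 z hz hzd, h.2 z hz hzd]
  | loop x S ih =>
    intro s hs
    simp only [WF, Bool.and_eq_true, decide_eq_true_eq] at hS
    refine Does.mono (Does.forLoop (N := N) (B := 1 + S.time.eval N)
      -- The invariant looks ahead: carrying out the remaining `m` rounds from the present state
      -- would yield the intended final state, up to scratch space.
      (fun m s' => s'.reg 1 = N ∧ (∀ z, k ≤ z → z < d → s'.reg z = s.reg z) ∧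
        Agree k ((loop x S).den N s) (countdown (fun i s => S.den N (s.setReg x i)) m s')) hs
      (fun i hi s1 hc h1 => ?_) ?_) ?_ (fun s' h => ⟨h.2.2, h.2.1⟩)
    · obtain ⟨h1, hz, hA⟩ := h1
      refine Does.seq_copy ((ih hS.2 (d + 2) (by omega) _ ?_).mono le_rfl
        fun s2 h2 => ⟨?_, ?_, fun z hz' hzd => ?_, ?_⟩)
      · simp [show 1 ≠ x by omega, show 1 ≠ d by omega, show d ≠ 0 by omega, h1]
      · rw [h2.2 d hd (by omega)]
        simp [show d ≠ x by omega]
      · rw [h2.1.1 1 (by omega), den_reg_one S hS.2]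
        simp [show 1 ≠ x by omega, show 1 ≠ d by omega, show d ≠ 0 by omega, h1]
      · rw [h2.2 z hz' (by omega)]
        simp [show z ≠ x by omega, show z ≠ d by omega, show z ≠ d + 1 by omega, hz z hz' hzd]
      · refine hA.trans (countdown_congr
          (fun i s s' h => den_congr S hS.2 (Agree.setReg_congr h x i)) i
          (Agree.trans (den_congr S hS.2 ?_) h2.1))
        rw [State.reg_setReg, if_pos rfl]
        exact Agree.setReg_congr (((Agree.refl k s1).setReg (by omega)).setReg (by omega)) x i
    · refine ⟨by rw [State.reg_setReg, if_neg (by omega), hs], fun z hz hzd => ?_, ?_⟩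
      · rw [State.reg_setReg, if_neg (by omega)]
      · exact countdown_congr
          (fun i s s' h => den_congr S hS.2 (Agree.setReg_congr h x i)) N
          ((Agree.refl k s).setReg hd)
    · simp only [time, Polynomial.eval_add, Polynomial.eval_mul, Polynomial.eval_X,
        Polynomial.eval_ofNat]
      exact le_of_eq (by ring)

end Stmt

end RAM

namespace MALL

/-! ### Reachability inside a set of vertices -/

/-- `x` and `y` are joined by a path of `G` inside `S`. -/
def Joined {T : Type*} (G : SimpleGraph T) (S : Set T) (x y : T) : Prop :=
  Relation.ReflTransGen (fun a b => G.Adj a b ∧ a ∈ S ∧ b ∈ S) x y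

section Joined

variable {T : Type*} {G : SimpleGraph T} {S S' : Set T} {x y z : T}

theorem restrict_adj : (restrict G S).Adj x y ↔ G.Adj x y ∧ x ∈ S ∧ y ∈ S := by
  simp only [restrict, SimpleGraph.fromRel_adj]
  constructor
  · rintro ⟨-, h | ⟨h, h1, h2⟩⟩
    · exact h
    · exact ⟨h.symm, h2, h1⟩
  · rintro h
    exact ⟨h.1.ne, Or.inl h⟩

theorem reachable_restrict_iff : (restrict G S).Reachable x y ↔ Joined G S x y := by
  rw [SimpleGraph.reachable_iff_reflTransGen, Joined]
  have : (restrict G S).Adj = fun a b => G.Adj a b ∧ a ∈ S ∧ b ∈ S := by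
    funext a b; exact propext restrict_adj
  rw [this]

theorem Joined.refl (x : T) : Joined G S x x := Relation.ReflTransGen.refl

theorem Joined.trans (h : Joined G S x y) (h' : Joined G S y z) : Joined G S x z :=
  Relation.ReflTransGen.trans h h'

theorem Joined.symm (h : Joined G S x y) : Joined G S y x := by
  induction h with
  | refl => exact Joined.refl x
  | tail _ h ih => exact Relation.ReflTransGen.head ⟨h.1.symm, h.2.2, h.2.1⟩ ih

theorem Joined.single (h : G.Adj x y) (hx : x ∈ S) (hy : y ∈ S) : Joined G S x y :=
  Relation.ReflTransGen.single ⟨h, hx, hy⟩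

theorem Joined.mono (h : Joined G S x y) (hS : S ⊆ S') : Joined G S' x y := by
  induction h with
  | refl => exact Joined.refl x
  | tail _ h ih => exact ih.tail ⟨h.1, hS h.2.1, hS h.2.2⟩

theorem Joined.closed (h : Joined G S x y) {P : T → Prop}
    (hP : ∀ a b, P a → G.Adj a b → a ∈ S → b ∈ S → P b) (hx : P x) : P y := by
  induction h with
  | refl => exact hx
  | tail _ h ih => exact hP _ _ ih h.1 h.2.1 h.2.2

theorem Joined.mem (h : Joined G S x y) (hx : x ∈ S) : y ∈ S :=
  h.closed (P := (· ∈ S)) (fun _ _ _ _ _ h => h) hx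

/-- A path stays inside the component of its origin, so only that component has to fit into `S'`. -/
theorem Joined.within (h : Joined G S x y) (hS : ∀ z, Joined G S x z → z ∈ S') :
    Joined G S' x y := by
  induction h with
  | refl => exact Joined.refl x
  | tail h h' ih => exact ih.trans (Joined.single h'.1 (hS _ h) (hS _ (Relation.ReflTransGen.tail h h')))

theorem joined_of_walk (r : T) (w : (restrict G S).Walk x y) (hr : r ∉ w.support) :
    Joined G (S \ {r}) x y := by
  induction w with
  | nil => exact Joined.refl _
  | @cons x y z h p ih =>
    simp only [SimpleGraph.Walk.support_cons, List.mem_cons, not_or] at hr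
    have h' := restrict_adj.1 h
    have hx : x ∈ S \ {r} := ⟨h'.2.1, fun h => hr.1 h.symm⟩
    have hy : y ∈ S \ {r} :=
      ⟨h'.2.2, fun h => hr.2 (Set.mem_singleton_iff.1 h ▸ p.start_mem_support)⟩
    exact (Joined.single h'.1 hx hy).trans (ih hr.2)

/-- A vertex with exactly two neighbours lies on a cycle iff its neighbours are joined by a path
that avoids it. -/
theorem exists_isCycle_iff {r u v : T} (huv : u ≠ v) (hr : r ∈ S) (hu : u ∈ S) (hv : v ∈ S)
    (hru : G.Adj r u) (hrv : G.Adj r v) (hnb : ∀ a ∈ S, G.Adj r a → a = u ∨ a = v) :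
    (∃ w : (restrict G S).Walk r r, w.IsCycle) ↔ Joined G (S \ {r}) u v := by
  constructor
  · rintro ⟨w, hw⟩
    cases w with
    | nil => exact absurd hw SimpleGraph.Walk.not_isCycle_nil
    | @cons _ a _ h p =>
      rw [SimpleGraph.Walk.cons_isCycle_iff] at hw
      obtain ⟨hp, he⟩ := hw
      -- Reversing the rest of the cycle exposes its last edge. The two ends of the cycle at `r` use
      -- different edges, so they pass through the two different neighbours, and the part between
      -- avoids `r`.
      have hp' := hp.reverse
      have he' : s(r, a) ∉ p.reverse.edges := by
        simpa [SimpleGraph.Walk.edges_reverse] using he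
      revert hp' he'
      generalize p.reverse = q
      intro hp' he'
      cases q with
      | nil => exact absurd h (SimpleGraph.irrefl _)
      | @cons _ b _ h' q =>
        rw [SimpleGraph.Walk.cons_isPath_iff] at hp'
        have hj := joined_of_walk r q hp'.2
        have hba : b ≠ a := by
          rintro rfl
          simp at he'
        have h1 := restrict_adj.1 h
        have h2 := restrict_adj.1 h'
        rcases hnb a h1.2.2 h1.1 with rfl | rfl <;> rcases hnb b h2.2.2 h2.1 with rfl | rfl
        · exact absurd rfl hba
        · exact hj.symm
        · exact hj
        · exact absurd rfl hba
  · intro h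
    obtain ⟨q, hq⟩ := (reachable_restrict_iff.2 h).exists_isPath
    have hle : restrict G (S \ {r}) ≤ restrict G S := by
      intro a b hab
      have := restrict_adj.1 hab
      exact restrict_adj.2 ⟨this.1, this.2.1.1, this.2.2.1⟩
    have hrq : r ∉ q.support := by
      classical
      intro hmem
      have := reachable_restrict_iff.1 (q.takeUntil r hmem).reachable
      exact (this.mem ⟨hu, hru.ne'⟩).2 rfl
    have hrq' : r ∉ (q.mapLe hle).support := by simpa using hrq
    -- Conversely, a path from `u` to `v` that avoids `r` is closed up through `r`.
    refine ⟨SimpleGraph.Walk.cons (restrict_adj.2 ⟨hru, hr, hu⟩)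
      ((q.mapLe hle).concat (restrict_adj.2 ⟨hrv.symm, hv, hr⟩)), ?_⟩
    rw [SimpleGraph.Walk.cons_isCycle_iff]
    refine ⟨(hq.mapLe hle).concat hrq' _, ?_⟩
    rw [SimpleGraph.Walk.edges_concat]
    simp only [List.concat_eq_append, List.mem_append, List.mem_singleton, Sym2.eq_iff, not_or]
    refine ⟨fun h => hrq' (SimpleGraph.Walk.fst_mem_support_of_mem_edges _ h), ?_, ?_⟩
    · rintro ⟨rfl, h⟩
      exact hrv.ne rfl
    · rintro ⟨-, h⟩
      exact huv h

end Joined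

/-! ### Parse forests -/

/-- Addresses can be extended exactly at connectives; this also makes every prefix of an address an
address. -/
theorem Formula.label_append_singleton {A : Type*} (F : Formula A) (p : List Bool) (b : Bool) :
    (F.label (p ++ [b])).isSome ↔ ∃ c, F.label p = some (.conn c) := by
  induction p generalizing F with
  | nil =>
    cases F with
    | lit a => simp [Formula.label]
    | bin c F G =>
      cases b <;> cases F <;> cases G <;> simp [Formula.label]
  | cons d p ih =>
    cases F with
    | lit a => simp [Formula.label]
    | bin c F G => cases d <;> simp [Formula.label, ih]

theorem Sequent.label_append_singleton {A : Type*} (Γ : Sequent A) (n : ℕ) (p : List Bool)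
    (b : Bool) : (Sequent.label Γ (n, p ++ [b])).isSome ↔
      ∃ c, Sequent.label Γ (n, p) = some (.conn c) := by
  simp only [Sequent.label]
  cases Γ[n]? with
  | none => simp
  | some F => simpa using F.label_append_singleton p b

variable {A : Type*} {Γ : Sequent A} {u v r w : Vertex Γ} {b c : Bool}

theorem Vertex.label_eq_iff {l : Label A} : v.label = l ↔ Sequent.label Γ v.1 = some l := by
  rw [Vertex.label]
  exact ⟨fun h => h ▸ (Option.some_get v.2).symm, fun h => Option.get_of_eq_some v.2 h⟩

theorem exists_isArg {k : Conn} (h : r.label = .conn k) (b : Bool) : ∃ u : Vertex Γ, IsArg b u r :=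
  ⟨⟨(r.1.1, r.1.2 ++ [b]), (Sequent.label_append_singleton Γ _ _ b).2
    ⟨k, Vertex.label_eq_iff.1 h⟩⟩, rfl⟩

theorem IsArg.unique (h : IsArg b u r) (h' : IsArg b v r) : u = v :=
  Subtype.ext (h.trans h'.symm)

theorem IsArg.parent_unique (h : IsArg b u r) (h' : IsArg c u w) : r = w ∧ b = c := by
  have := h.symm.trans h'
  simp only [Prod.mk.injEq] at this
  have h2 := List.append_inj' this.2 rfl
  exact ⟨Subtype.ext (Prod.ext this.1 h2.1), by simpa using h2.2⟩

theorem IsArg.ne (h : IsArg b u r) : u ≠ r := by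
  rintro rfl
  have := congrArg (fun p => p.2.length) h
  simp at this

theorem IsArg.inArg (h : IsArg b u r) : InArg b u r := by
  rw [InArg, h]; exact ⟨rfl, List.prefix_refl _⟩

theorem not_inArg_self : ¬ InArg b r r := by
  rintro ⟨-, h⟩
  simpa using h.length_le

theorem InArg.ne (h : InArg b v r) : v ≠ r := by
  rintro rfl; exact not_inArg_self h

theorem InArg.disjoint (h : InArg b v r) (h' : InArg c v r) : b = c := by
  obtain ⟨-, s, hs⟩ := h
  obtain ⟨-, t, ht⟩ := h'
  rw [← ht] at hs
  simp only [List.append_assoc, List.append_cancel_left_eq, List.cons_append,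
    List.nil_append, List.cons.injEq] at hs
  exact hs.1

theorem InArg.down (h : InArg b v r) (hw : IsArg c w v) : InArg b w r := by
  rw [InArg, hw]
  exact ⟨h.1, h.2.trans (List.prefix_append _ _)⟩

theorem InArg.up (h : InArg b w r) (hw : IsArg c w v) : (v = r ∧ c = b) ∨ InArg b v r := by
  rw [InArg, hw] at h
  obtain ⟨h1, s, hs⟩ := h
  rcases List.eq_nil_or_concat s with rfl | ⟨s, d, rfl⟩
  · rw [List.append_nil] at hs
    have h2 := List.append_inj' hs rfl
    exact Or.inl ⟨Subtype.ext (Prod.ext h1 h2.1.symm), by simpa using h2.2.symm⟩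
  · rw [List.concat_eq_append, ← List.append_assoc] at hs
    have h2 := List.append_inj' hs rfl
    exact Or.inr ⟨h1, s, h2.1⟩

/-- Being below `r`, defined by prefixes of addresses, is turned into a chain of single parent-child
steps. In this form it gives paths in the conflict graph and can be expressed by a transitive
closure. -/
theorem inArg_iff : InArg b v r ↔ ∃ u, IsArg b u r ∧
    Relation.ReflTransGen (fun x y : Vertex Γ => ∃ c, IsArg c y x) u v := by
  constructor
  · rintro ⟨h1, s, hs⟩
    induction s using List.reverseRecOn generalizing v with
    | nil =>
      rw [List.append_nil] at hs
      exact ⟨v, Prod.ext h1 hs.symm, .refl⟩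
    | append_singleton s d ih =>
      rw [← List.append_assoc] at hs
      have hv := v.2
      rw [show v.1 = (r.1.1, (r.1.2 ++ [b] ++ s) ++ [d]) from Prod.ext h1 hs.symm] at hv
      obtain ⟨k, hk⟩ := (Sequent.label_append_singleton Γ _ _ d).1 hv
      obtain ⟨u, hu, hd⟩ := ih (v := ⟨(r.1.1, r.1.2 ++ [b] ++ s), by rw [hk]; rfl⟩) rfl rfl
      exact ⟨u, hu, hd.tail ⟨d, Prod.ext h1 hs.symm⟩⟩
  · rintro ⟨u, hu, hd⟩
    induction hd with
    | refl => exact hu.inArg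
    | tail _ h ih => exact ih.down h.choose_spec

namespace Links

variable {L : Type*} {lam : Links Γ L}

theorem graph_adj_vertex : lam.graph.Adj (.inl u) (.inl v) ↔ ∃ b, IsArg b u v ∨ IsArg b v u := by
  simp only [graph, SimpleGraph.fromRel_adj, ne_eq, Sum.inl.injEq, exists_or]
  exact ⟨fun h => h.2, fun h => ⟨by rintro rfl; rcases h with ⟨b, h⟩ | ⟨b, h⟩ <;> exact h.ne rfl, h⟩⟩

theorem graph_adj_link {l m : L} : lam.graph.Adj (.inr l) (.inr m) ↔ lam.conflict.Adj l m := by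
  simp only [graph, SimpleGraph.fromRel_adj, ne_eq, Sum.inr.injEq]
  exact ⟨fun h => h.2.elim id SimpleGraph.Adj.symm, fun h => ⟨h.ne, Or.inl h⟩⟩

theorem graph_adj_leaf {l : L} :
    lam.graph.Adj (.inr l) (.inl v) ↔ ∃ x : Leaf Γ, lam.rel l x ∧ x.1 = v := by
  simp [graph, SimpleGraph.fromRel_adj]

theorem graph_adj_leaf' {l : L} :
    lam.graph.Adj (.inl v) (.inr l) ↔ ∃ x : Leaf Γ, lam.rel l x ∧ x.1 = v := by
  rw [SimpleGraph.adj_comm, graph_adj_leaf]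

end Links

end MALL

/-! ### Sub-forests, roots, pieces and the results of erasure -/

namespace MALL

variable {A : Type*} {Γ : Sequent A} {L : Type*}

/-- The vertices of a sub-forest are closed under passing to arguments. -/
def Part.Closed (μ : Part Γ L) : Prop :=
  ∀ u v b, v ∈ μ.verts → IsArg b u v → u ∈ μ.verts

section Part

variable {μ : Part Γ L} {u v r : Vertex Γ} {b : Bool}

@[simp] theorem Part.inl_mem_carrier : (Sum.inl v : Vertex Γ ⊕ L) ∈ μ.carrier ↔ v ∈ μ.verts :=
  Iff.rfl

@[simp] theorem Part.inr_mem_carrier {l : L} :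
    (Sum.inr l : Vertex Γ ⊕ L) ∈ μ.carrier ↔ l ∈ μ.links :=
  Iff.rfl

theorem Part.carrier_injective : Function.Injective (Part.carrier : Part Γ L → _) := by
  intro μ ν h
  ext x
  · rw [← Part.inl_mem_carrier, h, Part.inl_mem_carrier]
  · rw [← Part.inr_mem_carrier, h, Part.inr_mem_carrier]

theorem Part.carrier_mono {μ ν : Part Γ L} (hv : μ.verts ⊆ ν.verts) (hl : μ.links ⊆ ν.links) :
    μ.carrier ⊆ ν.carrier := by
  rintro (v | l) h
  · exact hv h
  · exact hl h

theorem Part.Closed.inArg (h : μ.Closed) (hv : InArg b v r) (hr : r ∈ μ.verts) : v ∈ μ.verts := by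
  obtain ⟨u, hu, hd⟩ := inArg_iff.1 hv
  induction hd with
  | refl => exact h _ _ _ hr hu
  | tail hd h' ih =>
    obtain ⟨c, hc⟩ := h'
    exact h _ _ _ (ih (inArg_iff.2 ⟨u, hu, hd⟩)) hc

/-- A root is not a proper descendant of any vertex of the sub-forest. -/
theorem Part.Closed.not_inArg (h : μ.Closed) (hr : Links.IsRoot μ r) (hu : u ∈ μ.verts) :
    ¬ InArg b r u := by
  intro hru
  obtain ⟨w, hw, hd⟩ := inArg_iff.1 hru
  rcases Relation.ReflTransGen.cases_tail hd with rfl | ⟨x, hx, c, hc⟩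
  · exact hr.2 u hu b hw
  · exact hr.2 x (h.inArg (inArg_iff.2 ⟨w, hw, hx⟩) hu) c hc

end Part

namespace Links

variable {lam : Links Γ L} {μ ν σ ρ τ : Part Γ L} {u v r s : Vertex Γ} {b c : Bool} {k : Conn}
  {K K' : Set L}

theorem connectedPart_iff : lam.ConnectedPart μ ↔ μ.links.Nonempty ∧
    ∀ x ∈ μ.carrier, ∀ y ∈ μ.carrier, Joined lam.graph μ.carrier x y := by
  simp only [ConnectedPart, reachable_restrict_iff]

theorem connectedPart_of_forall {y : Vertex Γ ⊕ L} (h : μ.links.Nonempty)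
    (hy : ∀ x ∈ μ.carrier, Joined lam.graph μ.carrier x y) : lam.ConnectedPart μ :=
  connectedPart_iff.2 ⟨h, fun x hx z hz => (hy x hx).trans (hy z hz).symm⟩

theorem Touches.mono (h : lam.Touches K r b) (hK : K ⊆ K') : lam.Touches K' r b := by
  obtain ⟨l, hl, h⟩ := h
  exact ⟨l, hK hl, h⟩

theorem Chooses.unique (h : lam.Chooses K r b) (h' : lam.Chooses K r c) : b = c := by
  by_contra hbc
  rw [show c = !b by cases b <;> cases c <;> simp_all] at h'
  exact h.2 h'.1

theorem Chooses.of_subset (h : lam.Chooses K r b) (h' : lam.Chooses K' r c) (hK : K ⊆ K') :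
    b = c := by
  by_contra hbc
  rw [show b = !c by cases b <;> cases c <;> simp_all] at h
  exact h'.2 (h.1.mono hK)

/-- A root has no parent in the slicing, and a connective carries no link. -/
theorem root_adj (hr : IsRoot μ r) (hk : r.label = .conn k) {z : Vertex Γ ⊕ L}
    (h : lam.graph.Adj (.inl r) z) (hz : z ∈ μ.carrier) : ∃ b u, IsArg b u r ∧ z = .inl u := by
  rcases z with u | l
  · obtain ⟨b, h | h⟩ := graph_adj_vertex.1 h
    · exact absurd h (hr.2 u hz b)
    · exact ⟨b, u, h, rfl⟩
  · obtain ⟨⟨x, a, ha⟩, -, rfl⟩ := graph_adj_leaf'.1 h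
    rw [hk] at ha
    cases ha

/-- A path to a root enters it through one of its arguments. -/
theorem exists_isArg_joined (hr : IsRoot μ r) (hk : r.label = .conn k) {x : Vertex Γ ⊕ L}
    (hx : x ≠ .inl r) (h : Joined lam.graph μ.carrier x (.inl r)) :
    ∃ b u, IsArg b u r ∧ Joined lam.graph (μ.carrier \ {.inl r}) x (.inl u) := by
  induction h using Relation.ReflTransGen.head_induction_on with
  | refl => exact absurd rfl hx
  | @head x y h h' ih =>
    by_cases hy : y = .inl r
    · subst hy
      obtain ⟨b, u, hu, rfl⟩ := root_adj hr hk h.1.symm h.2.1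
      exact ⟨b, u, hu, Joined.refl _⟩
    · obtain ⟨b, u, hu, hj⟩ := ih hy
      have h1 : Joined lam.graph (μ.carrier \ {.inl r}) x y :=
        Joined.single h.1 ⟨h.2.1, hx⟩ ⟨h.2.2, hy⟩
      exact ⟨b, u, hu, h1.trans hj⟩

theorem joined_inArg (hu : IsArg b u r) (hv : InArg b v r) {S : Set (Vertex Γ ⊕ L)}
    (hS : ∀ w, InArg b w r → .inl w ∈ S) : Joined lam.graph S (.inl u) (.inl v) := by
  obtain ⟨u', hu', hd⟩ := inArg_iff.1 hv
  obtain rfl := hu'.unique hu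
  clear hv
  induction hd with
  | refl => exact Joined.refl _
  | tail hd h ih =>
    obtain ⟨c, hc⟩ := h
    have h1 := inArg_iff.2 ⟨_, hu, hd⟩
    exact ih.trans (Joined.single (graph_adj_vertex.2 ⟨c, Or.inr hc⟩) (hS _ h1)
      (hS _ (h1.down hc)))

/-- Deleting its root separates an untouched argument from everything else. -/
theorem inArg_of_joined {S : Set (Vertex Γ ⊕ L)} (hr : .inl r ∉ S)
    (hS : ∀ l, .inr l ∈ S → ∀ x : Leaf Γ, lam.rel l x → ¬ InArg b x.1 r) {z : Vertex Γ ⊕ L}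
    (h : Joined lam.graph S (.inl v) z) (hv : InArg b v r) : ∃ w, z = .inl w ∧ InArg b w r := by
  refine h.closed (P := fun z => ∃ w, z = .inl w ∧ InArg b w r) ?_ ⟨v, rfl, hv⟩
  rintro _ y ⟨w, rfl, hw⟩ hadj - hy
  rcases y with w' | l
  · obtain ⟨c, h | h⟩ := graph_adj_vertex.1 hadj
    · rcases hw.up h with ⟨rfl, -⟩ | h
      · exact absurd hy hr
      · exact ⟨w', rfl, h⟩
    · exact ⟨w', rfl, hw.down h⟩
  · obtain ⟨x, hx, rfl⟩ := graph_adj_leaf'.1 hadj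
    exact absurd hw (hS l hy x hx)

/-- A path from a link to `r` enters `r` through an argument; an untouched argument would be cut off
from the link once `r` is removed. -/
theorem exists_touches (hμ : lam.ConnectedPart μ) (hr : IsRoot μ r) (hk : r.label = .conn k) :
    ∃ b, lam.Touches μ.links r b := by
  rw [connectedPart_iff] at hμ
  obtain ⟨⟨l, hl⟩, hc⟩ := hμ
  obtain ⟨b, u, hu, hj⟩ := exists_isArg_joined hr hk (by simp) (hc (.inr l) hl (.inl r) hr.1)
  refine ⟨b, ?_⟩
  by_contra hcon
  obtain ⟨w, hw, -⟩ := inArg_of_joined (S := μ.carrier \ {.inl r}) (b := b) (r := r) (by simp)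
    (fun m hm x hx hin => hcon ⟨m, hm.1, x, hx, hin⟩) hj.symm hu.inArg
  cases hw

theorem Unary.of_subset (h : lam.Unary K r) (hK : K' ⊆ K) (ht : ∃ b, lam.Touches K' r b) :
    lam.Unary K' r := by
  obtain ⟨b, hb, hb'⟩ := h
  obtain ⟨c, hc⟩ := ht
  have : c = b := by
    by_contra hcb
    rw [show c = !b by cases b <;> cases c <;> simp_all] at hc
    exact hb' (hc.mono hK)
  exact ⟨b, this ▸ hc, fun h => hb' (h.mono hK)⟩

/-! ### Pieces -/

/-- The piece that contains a given link, for the set `K` of all links. -/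
def pieceOf (lam : Links Γ L) (K : Set L) (l : L) : Set L :=
  {m | Joined lam.conflictᶜ K l m}

theorem isPiece_iff : lam.IsPiece μ K ↔ ∃ l ∈ μ.links, K = lam.pieceOf μ.links l := by
  simp only [IsPiece, pieceOf, reachable_restrict_iff]

theorem mem_pieceOf_self {l : L} : l ∈ lam.pieceOf K l := Joined.refl l

theorem pieceOf_subset {l : L} (hl : l ∈ K) : lam.pieceOf K l ⊆ K := fun _ h => h.mem hl

theorem pieceOf_eq {l m : L} (h : m ∈ lam.pieceOf K l) : lam.pieceOf K m = lam.pieceOf K l :=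
  Set.ext fun _ => ⟨fun h' => Joined.trans h h', fun h' => (Joined.symm h).trans h'⟩

theorem mem_ampPart_links {l : L} : l ∈ (lam.ampPart μ r b).links ↔
    l ∈ μ.links ∧ lam.Chooses (lam.pieceOf μ.links l) r b := by
  simp only [ampPart, Set.mem_ofPred_eq, isPiece_iff]
  constructor
  · rintro ⟨_, ⟨m, hm, rfl⟩, hc, hl⟩
    exact ⟨pieceOf_subset hm hl, pieceOf_eq hl ▸ hc⟩
  · rintro ⟨hl, hc⟩
    exact ⟨_, ⟨l, hl, rfl⟩, hc, mem_pieceOf_self⟩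

/-- Erasing a with keeps or drops pieces as a whole, so surviving pieces do not break up. This is
why other withs remain ready. -/
theorem pieceOf_ampPart {l : L} (hl : l ∈ (lam.ampPart μ r b).links) :
    lam.pieceOf (lam.ampPart μ r b).links l = lam.pieceOf μ.links l := by
  ext m
  constructor
  · intro h
    exact Joined.mono h fun x hx => (mem_ampPart_links.1 hx).1
  · intro h
    refine Joined.within h fun z hz => mem_ampPart_links.2 ?_
    rw [mem_ampPart_links] at hl
    exact ⟨pieceOf_subset hl.1 hz, by rw [pieceOf_eq hz]; exact hl.2⟩

/-! ### Results of erasure -/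

/-- The vertices that go when a root is deleted, together with the argument `A_{1-b}` if the
argument `A_b` is chosen. -/
def deleted (r : Vertex Γ) (o : Option Bool) : Set (Vertex Γ) :=
  {v | v = r ∨ ∃ b ∈ o, InArg (!b) v r}

theorem chooseVerts_eq : chooseVerts μ r b = μ.verts \ deleted r (some b) := by
  ext v
  simp [chooseVerts, deleted]
  tauto

/-- Erasing the root `r` of `μ` simply deletes `r` (if `o = none`), or `r` and its untouched
argument `A_{1-b}` (if `o = some b`). -/
def Deletes (lam : Links Γ L) (μ : Part Γ L) (r : Vertex Γ) (o : Option Bool) : Prop :=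
  (r.label = .conn .par ∧ o = none) ∨
    (r.label = .conn .plus ∧ ∃ b, o = some b ∧ lam.Chooses μ.links r b)

theorem Deletes.label {o : Option Bool} (h : lam.Deletes μ r o) : ∃ k, r.label = .conn k := by
  rcases h with ⟨h, -⟩ | ⟨h, -⟩ <;> exact ⟨_, h⟩

theorem Deletes.erase {o : Option Bool} (h : lam.Deletes μ r o) :
    lam.erase μ r = {⟨μ.verts \ deleted r o, μ.links⟩} := by
  rcases h with ⟨h, rfl⟩ | ⟨h, b, rfl, hb⟩
  · simp [Links.erase, h, deleted]
  · ext ν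
    simp only [Links.erase, h, Set.mem_ofPred_eq, Set.mem_singleton_iff]
    constructor
    · rintro ⟨c, hc, rfl⟩
      rw [hb.unique hc, chooseVerts_eq]
    · rintro rfl
      exact ⟨b, hb, by rw [chooseVerts_eq]⟩

theorem Deletes.exists_isArg {o : Option Bool} (h : lam.Deletes μ r o) :
    ∃ b u, IsArg b u r ∧ (∀ c ∈ o, c = b) := by
  obtain ⟨k, hk⟩ := h.label
  rcases o with - | b
  · obtain ⟨u, hu⟩ := MALL.exists_isArg hk false
    exact ⟨false, u, hu, by simp⟩
  · obtain ⟨u, hu⟩ := MALL.exists_isArg hk b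
    exact ⟨b, u, hu, by simp⟩

theorem erase_tensor (h : r.label = .conn .tensor) :
    lam.erase μ r = {lam.tensorPart μ r false, lam.tensorPart μ r true} := by
  simp [erase, h]

theorem erase_amp (h : r.label = .conn .amp) :
    lam.erase μ r = {lam.ampPart μ r false, lam.ampPart μ r true} := by
  simp [erase, h]

theorem mem_erase_tensor (h : r.label = .conn .tensor) :
    ν ∈ lam.erase μ r ↔ ∃ b, ν = lam.tensorPart μ r b := by
  simp [erase_tensor h]

theorem mem_erase_amp (h : r.label = .conn .amp) :
    ν ∈ lam.erase μ r ↔ ∃ b, ν = lam.ampPart μ r b := by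
  simp [erase_amp h]

theorem mem_tensorPart_carrier {z : Vertex Γ ⊕ L} : z ∈ (lam.tensorPart μ r b).carrier ↔
    ∃ u, IsArg b u r ∧ Joined lam.graph (μ.carrier \ {.inl r}) (.inl u) z := by
  rcases z with v | l <;> simp [Part.carrier, tensorPart, reachable_restrict_iff]

theorem mem_tensorPart_carrier_of_isArg (hu : IsArg b u r) {z : Vertex Γ ⊕ L} :
    z ∈ (lam.tensorPart μ r b).carrier ↔
      Joined lam.graph (μ.carrier \ {.inl r}) (.inl u) z := by
  rw [mem_tensorPart_carrier]
  exact ⟨fun ⟨v, hv, h⟩ => hv.unique hu ▸ h, fun h => ⟨u, hu, h⟩⟩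

/-- A summary of what a root `r` being ready means, by cases on its label. -/
theorem Ready.cases (h : lam.Ready μ r) : r.label = .conn .tensor ∨ r.label = .conn .amp ∨
    ∃ o, lam.Deletes μ r o := by
  obtain ⟨-, -, h⟩ := h
  revert h
  cases hl : r.label with
  | lit a => exact fun h => h.elim
  | conn k =>
    cases k with
    | tensor => exact fun _ => Or.inl rfl
    | par => exact fun _ => Or.inr (Or.inr ⟨none, Or.inl ⟨hl, rfl⟩⟩)
    | amp => exact fun _ => Or.inr (Or.inl rfl)
    | plus => exact fun ⟨b, hb⟩ => Or.inr (Or.inr ⟨some b, Or.inr ⟨hl, b, rfl, hb⟩⟩)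

theorem Ready.label (h : lam.Ready μ r) : ∃ k, r.label = .conn k := by
  rcases h.cases with h | h | ⟨o, h⟩
  · exact ⟨_, h⟩
  · exact ⟨_, h⟩
  · exact h.label

end Links

end MALL

/-! ### Structure and readiness of the results of erasure -/

namespace MALL

variable {A : Type*} {Γ : Sequent A} {L : Type*}

namespace Links

variable {lam : Links Γ L} {μ ν σ ρ τ : Part Γ L} {u v r s : Vertex Γ} {b c : Bool} {k : Conn}
  {K K' : Set L} {o : Option Bool}

/-- A root that splits the slicing can only lead to connected slicings if both arguments are
touched. -/
def Full (lam : Links Γ L) (μ : Part Γ L) (r : Vertex Γ) : Prop :=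
  r.label = .conn .tensor ∨ r.label = .conn .amp → ∀ b, lam.Touches μ.links r b

/-- Every path to `r` ends through one of its two arguments, so deleting `r` leaves at most two
components. -/
theorem exists_joined_tensorPart (hμ : lam.ConnectedPart μ) (hr : IsRoot μ r)
    (hk : r.label = .conn k) {z : Vertex Γ ⊕ L} (hz : z ∈ μ.carrier) (hzr : z ≠ .inl r) :
    ∃ b, z ∈ (lam.tensorPart μ r b).carrier := by
  obtain ⟨b, u, hu, hj⟩ := exists_isArg_joined hr hk hzr ((connectedPart_iff.1 hμ).2 z hz _ hr.1)
  exact ⟨b, mem_tensorPart_carrier.2 ⟨u, hu, hj.symm⟩⟩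

theorem isArg_mem (hμ : μ.Closed) (hr : IsRoot μ r) (hu : IsArg b u r) :
    (.inl u : Vertex Γ ⊕ L) ∈ μ.carrier \ {.inl r} :=
  ⟨hμ _ _ _ hr.1 hu, by simpa using hu.ne⟩

theorem tensorPart_carrier_subset (hμ : μ.Closed) (hr : IsRoot μ r) :
    (lam.tensorPart μ r b).carrier ⊆ μ.carrier \ {.inl r} := by
  intro z hz
  obtain ⟨u, hu, h⟩ := mem_tensorPart_carrier.1 hz
  exact h.mem (isArg_mem hμ hr hu)

/-- The structure of the results of erasure. -/
theorem erase_subset (hμ : μ.Closed) (hr : lam.Ready μ r) (hν : ν ∈ lam.erase μ r) :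
    ν.carrier ⊆ μ.carrier \ {.inl r} := by
  rcases hr.cases with h | h | ⟨o, h⟩
  · obtain ⟨b, rfl⟩ := (mem_erase_tensor h).1 hν
    exact tensorPart_carrier_subset hμ hr.2.1
  · obtain ⟨b, rfl⟩ := (mem_erase_amp h).1 hν
    rintro (v | l) hz
    · exact ⟨hz.1, by simpa using hz.2.1⟩
    · exact ⟨(mem_ampPart_links.1 hz).1, by simp⟩
  · rw [h.erase] at hν
    obtain rfl := hν
    rintro (v | l) hz
    · exact ⟨hz.1, fun h => hz.2 (Or.inl (by simpa using h))⟩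
    · exact ⟨hz, by simp⟩

theorem erase_verts_subset (hμ : μ.Closed) (hr : lam.Ready μ r) (hν : ν ∈ lam.erase μ r) :
    ν.verts ⊆ μ.verts := fun v hv => (erase_subset hμ hr hν (show .inl v ∈ ν.carrier from hv)).1

theorem erase_links_subset (hμ : μ.Closed) (hr : lam.Ready μ r) (hν : ν ∈ lam.erase μ r) :
    ν.links ⊆ μ.links := fun v hv => (erase_subset hμ hr hν (show .inr v ∈ ν.carrier from hv)).1

theorem not_mem_erase_verts (hμ : μ.Closed) (hr : lam.Ready μ r) (hν : ν ∈ lam.erase μ r) :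
    r ∉ ν.verts := fun hv => (erase_subset hμ hr hν (show .inl r ∈ ν.carrier from hv)).2 rfl

theorem closed_diff_deleted (hμ : μ.Closed) (hr : IsRoot μ r) :
    Part.Closed ⟨μ.verts \ deleted r o, K⟩ := by
  rintro u v b ⟨hv, hvd⟩ hu
  refine ⟨hμ _ _ _ hv hu, ?_⟩
  rintro (rfl | ⟨c, hc, hin⟩)
  · exact hr.2 v hv b hu
  · rcases hin.up hu with ⟨rfl, -⟩ | h
    · exact hvd (Or.inl rfl)
    · exact hvd (Or.inr ⟨c, hc, h⟩)

theorem ampPart_eq : lam.ampPart μ r b =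
    ⟨μ.verts \ deleted r (some b), (lam.ampPart μ r b).links⟩ := by
  rw [← chooseVerts_eq]; rfl

theorem erase_closed (hμ : μ.Closed) (hr : lam.Ready μ r) (hν : ν ∈ lam.erase μ r) :
    ν.Closed := by
  rcases hr.cases with h | h | ⟨o, h⟩
  · obtain ⟨b, rfl⟩ := (mem_erase_tensor h).1 hν
    rintro u v c hv hu
    have hv' : Sum.inl v ∈ (lam.tensorPart μ r b).carrier := hv
    obtain ⟨w, hw, hj⟩ := mem_tensorPart_carrier.1 hv'
    have h1 := hj.mem (isArg_mem hμ hr.2.1 hw)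
    have h2 : (.inl u : Vertex Γ ⊕ L) ∈ μ.carrier \ {.inl r} := by
      refine ⟨hμ _ _ _ h1.1 hu, ?_⟩
      rintro ⟨⟩
      exact hr.2.1.2 v h1.1 c hu
    exact mem_tensorPart_carrier.2
      ⟨w, hw, hj.trans (Joined.single (graph_adj_vertex.2 ⟨c, Or.inr hu⟩) h1 h2)⟩
  · obtain ⟨b, rfl⟩ := (mem_erase_amp h).1 hν
    rw [ampPart_eq]
    exact closed_diff_deleted hμ hr.2.1
  · rw [h.erase] at hν
    obtain rfl := hν
    exact closed_diff_deleted hμ hr.2.1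

theorem not_mem_deleted (hμ : μ.Closed) (hr : IsRoot μ r) (hs : s ∈ μ.verts) (hrs : r ≠ s) :
    r ∉ deleted s o := by
  rintro (h | ⟨b, -, h⟩)
  · exact hrs h
  · exact hμ.not_inArg hr hs h

/-- A root is not below another root, so it is not deleted along with it; at a tensor it falls into
one of the components. -/
theorem exists_mem_erase (hμ : μ.Closed) (hs : lam.Ready μ s) (hr : IsRoot μ r) (hrs : r ≠ s) :
    ∃ σ ∈ lam.erase μ s, r ∈ σ.verts := by
  rcases hs.cases with h | h | ⟨o, h⟩
  · obtain ⟨b, hb⟩ := exists_joined_tensorPart hs.1 hs.2.1 h (z := .inl r) hr.1 (by simpa using hrs)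
    exact ⟨_, (mem_erase_tensor h).2 ⟨b, rfl⟩, hb⟩
  · refine ⟨_, (mem_erase_amp h).2 ⟨false, rfl⟩, ?_⟩
    rw [ampPart_eq]
    exact ⟨hr.1, not_mem_deleted hμ hr hs.2.1.1 hrs⟩
  · rw [h.erase]
    exact ⟨_, rfl, hr.1, not_mem_deleted hμ hr hs.2.1.1 hrs⟩

theorem isRoot_of_mem (hr : IsRoot μ r) (hν : ν.verts ⊆ μ.verts) (h : r ∈ ν.verts) :
    IsRoot ν r :=
  ⟨h, fun u hu b => hr.2 u (hν hu) b⟩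

/-- Readiness of a tensor, in terms of its two arguments. -/
theorem tensor_ready_iff (hμ : μ.Closed) (hr : IsRoot μ r) (hk : r.label = .conn .tensor) :
    lam.Ready μ r ↔ lam.ConnectedPart μ ∧ ∀ u v, IsArg false u r → IsArg true v r →
      ¬ Joined lam.graph (μ.carrier \ {.inl r}) (.inl u) (.inl v) := by
  obtain ⟨u, hu⟩ := exists_isArg hk false
  obtain ⟨v, hv⟩ := exists_isArg hk true
  have hne : u ≠ v := by
    rintro rfl
    exact absurd (hu.parent_unique hv).2 (by simp)
  have h1 := exists_isCycle_iff (G := lam.graph) (S := μ.carrier) (r := .inl r) (u := .inl u)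
    (v := .inl v) (by simpa using hne) hr.1 (hμ _ _ _ hr.1 hu) (hμ _ _ _ hr.1 hv)
    (graph_adj_vertex.2 ⟨_, Or.inr hu⟩) (graph_adj_vertex.2 ⟨_, Or.inr hv⟩) (by
      intro a ha hadj
      obtain ⟨b, w, hw, rfl⟩ := root_adj hr hk hadj ha
      cases b
      · exact Or.inl (by rw [hw.unique hu])
      · exact Or.inr (by rw [hw.unique hv]))
  rw [Ready, hk]
  simp only [h1]
  constructor
  · rintro ⟨h, -, h'⟩
    refine ⟨h, fun u' v' hu' hv' => ?_⟩
    rwa [hu'.unique hu, hv'.unique hv]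
  · rintro ⟨h, h'⟩
    exact ⟨h, hr, h' u v hu hv⟩

theorem Ready.not_joined (h : lam.Ready μ r) (hμ : μ.Closed) (hk : r.label = .conn .tensor)
    (hu : IsArg b u r) (hv : IsArg (!b) v r) :
    ¬ Joined lam.graph (μ.carrier \ {.inl r}) (.inl u) (.inl v) := by
  have := ((tensor_ready_iff hμ h.2.1 hk).1 h).2
  cases b
  · exact this u v hu hv
  · exact fun h => this v u hv hu h.symm

theorem tensorPart_disjoint (h : lam.Ready μ r) (hμ : μ.Closed) (hk : r.label = .conn .tensor)
    {z : Vertex Γ ⊕ L} (hz : z ∈ (lam.tensorPart μ r b).carrier)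
    (hz' : z ∈ (lam.tensorPart μ r c).carrier) : b = c := by
  by_contra hbc
  rw [show c = !b by cases b <;> cases c <;> simp_all] at hz'
  obtain ⟨u, hu, hj⟩ := mem_tensorPart_carrier.1 hz
  obtain ⟨v, hv, hj'⟩ := mem_tensorPart_carrier.1 hz'
  exact h.not_joined hμ hk hu hv (hj.trans hj'.symm)

theorem Ready.amp (h : lam.Ready μ r) (hk : r.label = .conn .amp) {l : L} (hl : l ∈ μ.links) :
    ∃ b, lam.Chooses (lam.pieceOf μ.links l) r b := by
  have h' := h.2.2
  rw [hk] at h'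
  exact h' _ (isPiece_iff.2 ⟨l, hl, rfl⟩)

theorem mem_tensorPart_of_touches (hμ : μ.Closed) (hr : IsRoot μ r) {l : L} (hl : l ∈ μ.links)
    {x : Leaf Γ} (hx : lam.rel l x) (hin : InArg b x.1 r) : l ∈ (lam.tensorPart μ r b).links := by
  obtain ⟨u, hu, -⟩ := inArg_iff.1 hin
  have h1 : ∀ w, InArg b w r → (.inl w : Vertex Γ ⊕ L) ∈ μ.carrier \ {.inl r} := fun w hw =>
    ⟨hμ.inArg hw hr.1, by simpa using hw.ne⟩
  have h2 : Sum.inr l ∈ (lam.tensorPart μ r b).carrier :=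
    mem_tensorPart_carrier.2 ⟨u, hu, (joined_inArg hu hin h1).trans
      (Joined.single (graph_adj_leaf'.2 ⟨x, hx, rfl⟩) (h1 _ hin) ⟨hl, by simp⟩)⟩
  exact h2

/-- A tensor and a with cannot be ready at the same time. -/
theorem not_ready_tensor_amp (hμ : μ.Closed) (hr : lam.Ready μ r) (hs : lam.Ready μ s)
    (hrk : r.label = .conn .tensor) (hsk : s.label = .conn .amp) (hrF : lam.Full μ r)
    (hsF : lam.Full μ s) : False := by
  have hpart : ∀ b, ∃ l, l ∈ (lam.tensorPart μ r b).links ∧ l ∈ μ.links := fun b => by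
    obtain ⟨l, hl, x, hx, hin⟩ := hrF (Or.inl hrk) b
    exact ⟨l, mem_tensorPart_of_touches hμ hr.2.1 hl hx hin, hl⟩
  have hadj : ∀ l m, l ∈ (lam.tensorPart μ r false).links → m ∈ (lam.tensorPart μ r true).links →
      l ∈ μ.links → m ∈ μ.links → Joined lam.conflictᶜ μ.links l m := by
    intro l m hl hm hl' hm'
    have hl2 : Sum.inr l ∈ (lam.tensorPart μ r false).carrier := hl
    have hm2 : Sum.inr m ∈ (lam.tensorPart μ r true).carrier := hm
    -- A conflict between links on opposite sides would be an edge that joins the two components.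
    refine Joined.single (SimpleGraph.compl_adj _ _ _ |>.2 ⟨?_, fun hc => ?_⟩) hl' hm'
    · rintro rfl
      exact absurd (tensorPart_disjoint hr hμ hrk hl2 hm2) (by simp)
    · obtain ⟨u, hu, hj⟩ := mem_tensorPart_carrier.1 hl2
      have : Sum.inr m ∈ (lam.tensorPart μ r false).carrier :=
        mem_tensorPart_carrier.2 ⟨u, hu, hj.trans
          (Joined.single (graph_adj_link.2 hc) ⟨hl', by simp⟩ ⟨hm', by simp⟩)⟩
      exact absurd (tensorPart_disjoint hr hμ hrk this hm2) (by simp)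
  obtain ⟨l₀, h0, h0'⟩ := hpart false
  obtain ⟨l₁, h1, h1'⟩ := hpart true
  -- Both sides contain links and all cross pairs are adjacent, so the adjacency graph is connected:
  -- there is one piece. The with would then be unary under all links, although both its arguments
  -- are touched.
  have hall : lam.pieceOf μ.links l₀ = μ.links := by
    refine (pieceOf_subset h0').antisymm fun m hm => ?_
    obtain ⟨b, hb⟩ := exists_joined_tensorPart hr.1 hr.2.1 hrk (z := .inr m) hm (by simp)
    cases b
    · exact (hadj l₀ l₁ h0 h1 h0' h1').trans (hadj m l₁ hb h1 hm h1').symm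
    · exact hadj l₀ m h0 hb h0' hm
  obtain ⟨b, hb⟩ := hs.amp hsk h0'
  rw [hall] at hb
  exact hb.2 (hsF (Or.inr hsk) _)

/-- Readiness persists. -/
theorem Ready.of_erase (hμ : μ.Closed) (hr : lam.Ready μ r) (hs : lam.Ready μ s)
    (hrF : lam.Full μ r) (hsF : lam.Full μ s) (hσ : σ ∈ lam.erase μ s)
    (hσc : lam.ConnectedPart σ) (hrσ : r ∈ σ.verts) : lam.Ready σ r := by
  have hv := erase_verts_subset hμ hs hσ
  have hl := erase_links_subset hμ hs hσ
  have hroot := isRoot_of_mem hr.2.1 hv hrσ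
  have hcl := erase_closed hμ hs hσ
  obtain ⟨k, hk⟩ := hr.label
  cases k with
  | tensor =>
    refine (tensor_ready_iff hcl hroot hk).2 ⟨hσc, fun u v hu hv' hj => ?_⟩
    -- Passing to a smaller slicing creates no new paths between the two arguments.
    exact hr.not_joined hμ hk hu hv' (hj.mono (Set.sdiff_subset_sdiff_left (Part.carrier_mono hv hl)))
  | par => exact ⟨hσc, hroot, by rw [hk]; trivial⟩
  | plus =>
    have h := hr.2.2
    rw [hk] at h
    exact ⟨hσc, hroot, by
      -- Fewer links can only make a plus untouched on both sides, and connectedness of `σ` excludes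
      -- that.
      rw [hk]; exact h.of_subset hl (exists_touches hσc hroot hk)⟩
  | amp =>
    have h := hr.2.2
    rw [hk] at h
    refine ⟨hσc, hroot, ?_⟩
    rw [hk]
    rcases hs.cases with hsk | hsk | ⟨o, ho⟩
    -- Cutting at a tensor could split a piece, possibly leaving a piece that touches neither
    -- argument; this case does not arise.
    · exact (not_ready_tensor_amp hμ hs hr hsk hk hsF hrF).elim
    · obtain ⟨b, rfl⟩ := (mem_erase_amp hsk).1 hσ
      intro K hK
      obtain ⟨l, hl', rfl⟩ := isPiece_iff.1 hK
      rw [pieceOf_ampPart hl']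
      exact hr.amp hk (hl hl')
    · rw [ho.erase] at hσ
      obtain rfl := hσ
      exact h

end Links

end MALL

namespace MALL

variable {A : Type*} {Γ : Sequent A} {L : Type*}

namespace Links

variable {lam : Links Γ L} {μ ν σ ρ τ : Part Γ L} {u v r s : Vertex Γ} {b c : Bool} {k : Conn}
  {K K' : Set L} {o : Option Bool}

/-! ### Connectedness of the results of erasure -/

theorem eq_not_of_ne (h : ¬ c = b) : c = !b := by
  cases b <;> cases c <;> simp_all

theorem connectedPart_tensorPart (hμ : μ.Closed) (hr : IsRoot μ r)
    (ht : lam.Touches μ.links r b) : lam.ConnectedPart (lam.tensorPart μ r b) := by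
  obtain ⟨l, hl, x, hx, hin⟩ := ht
  obtain ⟨u, hu, -⟩ := inArg_iff.1 hin
  refine connectedPart_of_forall (y := .inl u) ⟨l, mem_tensorPart_of_touches hμ hr hl hx hin⟩
    fun z hz => ?_
  rw [mem_tensorPart_carrier_of_isArg hu] at hz
  exact (hz.within fun w hw => (mem_tensorPart_carrier_of_isArg hu).2 hw).symm

/-- The untouched argument is attached to the rest only through `r`, so what remains after deleting
both is joined to the root of the chosen argument. -/
theorem connectedPart_delete_plus (hμ : lam.ConnectedPart μ) (hcl : μ.Closed) (hr : IsRoot μ r)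
    (hk : r.label = .conn k) (hb : lam.Chooses μ.links r b) :
    lam.ConnectedPart ⟨μ.verts \ deleted r (some b), μ.links⟩ := by
  obtain ⟨u, hu⟩ := exists_isArg hk b
  have hunt : ∀ l, .inr l ∈ μ.carrier \ {(.inl r : Vertex Γ ⊕ L)} → ∀ x : Leaf Γ, lam.rel l x →
      ¬ InArg (!b) x.1 r := fun l hl x hx hin => hb.2 ⟨l, hl.1, x, hx, hin⟩
  refine connectedPart_of_forall (y := .inl u) hμ.1 fun z hz => ?_
  have hz' : z ∈ μ.carrier \ {.inl r} := by
    rcases z with v | l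
    · exact ⟨hz.1, fun h => hz.2 (Or.inl (by simpa using h))⟩
    · exact ⟨hz, by simp⟩
  obtain ⟨c, u', hu', hj⟩ := exists_isArg_joined hr hk hz'.2
    ((connectedPart_iff.1 hμ).2 z hz'.1 _ hr.1)
  have hc : c = b := by
    by_contra hcb
    rw [eq_not_of_ne hcb] at hu'
    obtain ⟨w, rfl, hw⟩ := inArg_of_joined (by simp) hunt hj.symm hu'.inArg
    exact hz.2 (Or.inr ⟨b, rfl, hw⟩)
  subst hc
  obtain rfl := hu'.unique hu
  refine (hj.symm.within fun w hw => ?_).symm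
  have hw' := hw.mem (isArg_mem hcl hr hu)
  rcases w with w | l
  · refine ⟨hw'.1, ?_⟩
    rintro (rfl | ⟨d, hd, hin⟩)
    · exact hw'.2 rfl
    · cases hd
      obtain ⟨w', h, hin'⟩ := inArg_of_joined (by simp) hunt hw.symm hin
      obtain rfl := Sum.inl.inj h
      exact absurd (hin'.disjoint hu.inArg) (by simp)
  · exact hw'.1

theorem deletes_of_ready (h : lam.Ready μ r) (hk : r.label = .conn .plus) :
    ∃ b, lam.Chooses μ.links r b := by
  have h' := h.2.2
  rwa [hk] at h'

/-- Adjacent links share their piece. The conflicts obtained here reconnect the two halves of an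
erased with. -/
theorem joined_of_conflict {l m : L} (h : lam.pieceOf K l ≠ lam.pieceOf K m) (hl : l ∈ K)
    (hm : m ∈ K) : lam.conflict.Adj l m := by
  by_contra hcon
  refine h (pieceOf_eq (Joined.single ((SimpleGraph.compl_adj _ _ _).2 ⟨?_, hcon⟩) hl hm)).symm
  rintro rfl
  exact h rfl

/-- A deleted vertex is joined to a vertex that stays. -/
theorem exists_joined_of_deleted (hμ : μ.Closed) (hs : s ∈ μ.verts) (ho : lam.Deletes σ s o)
    (hv : v ∈ deleted s o) : ∃ u ∈ μ.verts, u ∉ deleted s o ∧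
      Joined lam.graph μ.carrier (.inl v) (.inl u) := by
  obtain ⟨b, u, hu, hb⟩ := ho.exists_isArg
  refine ⟨u, hμ _ _ _ hs hu, ?_, ?_⟩
  · rintro (rfl | ⟨c, hc, h⟩)
    · exact hu.ne rfl
    · rw [hb c hc] at h
      exact absurd (h.disjoint hu.inArg) (by simp)
  · have h1 : ∀ {c : Bool} {w : Vertex Γ}, IsArg c w s →
        Joined lam.graph μ.carrier (.inl w) (.inl s) := fun {c w} hw =>
      Joined.single (graph_adj_vertex.2 ⟨c, Or.inl hw⟩) (hμ _ _ _ hs hw) hs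
    refine Joined.trans ?_ (h1 hu).symm
    rcases hv with rfl | ⟨c, -, h⟩
    · exact Joined.refl _
    · obtain ⟨w, hw, -⟩ := inArg_iff.1 h
      exact (joined_inArg hw h fun w' hw' => hμ.inArg hw' hs).symm.trans (h1 hw)

/-- If erasing `s` and then `r` leaves only connected slicings, so does erasing `r` at once. -/
theorem connectedPart_of_erase (hμ : μ.Closed) (hr : lam.Ready μ r) (hs : lam.Ready μ s)
    (hrs : r ≠ s) (hrF : lam.Full μ r) (hsF : lam.Full μ s)
    (hc : ∀ σ ∈ lam.erase μ s, r ∈ σ.verts → lam.ConnectedPart σ ∧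
      ∀ τ ∈ lam.erase σ r, lam.ConnectedPart τ) (hρ : ρ ∈ lam.erase μ r) :
    lam.ConnectedPart ρ := by
  obtain ⟨k, hk⟩ := hr.label
  cases k with
  | tensor =>
    obtain ⟨b, rfl⟩ := (mem_erase_tensor hk).1 hρ
    exact connectedPart_tensorPart hμ hr.2.1 (hrF (Or.inl hk) b)
  | plus =>
    obtain ⟨b, hb⟩ := deletes_of_ready hr hk
    rw [Deletes.erase (Or.inr ⟨hk, b, rfl, hb⟩)] at hρ
    obtain rfl := hρ
    exact connectedPart_delete_plus hr.1 hμ hr.2.1 hk hb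
  | par =>
    -- Deleting a par could separate its two arguments. In a result `σ` that still contains `r` they
    -- remain joined after the deletion, by assumption; the same path exists in the larger slicing,
    -- and everything else is joined to one of the arguments.
    obtain ⟨σ, hσ, hrσ⟩ := exists_mem_erase hμ hs hr.2.1 hrs
    obtain ⟨hσc, hτ⟩ := hc σ hσ hrσ
    have hdel : ∀ ν, lam.erase ν r = {⟨ν.verts \ deleted r none, ν.links⟩} := fun ν =>
      Deletes.erase (Or.inl ⟨hk, rfl⟩)
    rw [hdel] at hρ
    obtain rfl := hρ
    have hτ' := connectedPart_iff.1 (hτ _ (by rw [hdel]; rfl))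
    have hclσ := erase_closed hμ hs hσ
    have hle : Part.carrier ⟨σ.verts \ deleted r none, σ.links⟩ ⊆
        Part.carrier (⟨μ.verts \ deleted r none, μ.links⟩ : Part Γ L) :=
      Part.carrier_mono (Set.sdiff_subset_sdiff_left (erase_verts_subset hμ hs hσ))
        (show σ.links ⊆ μ.links from erase_links_subset hμ hs hσ)
    have harg : ∀ {b u}, IsArg b u r →
        (.inl u : Vertex Γ ⊕ L) ∈ Part.carrier ⟨σ.verts \ deleted r none, σ.links⟩ := by
      intro b u hu
      refine ⟨hclσ _ _ _ hrσ hu, ?_⟩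
      rintro (rfl | ⟨c, hc, -⟩)
      · exact hu.ne rfl
      · cases hc
    obtain ⟨u, hu⟩ := exists_isArg hk false
    refine connectedPart_of_forall (y := .inl u) hr.1.1 fun z hz => ?_
    have hz' : z ∈ μ.carrier \ {.inl r} := by
      rcases z with v | l
      · exact ⟨hz.1, fun h => hz.2 (Or.inl (by simpa using h))⟩
      · exact ⟨hz, by simp⟩
    obtain ⟨c, u', hu', hj⟩ := exists_isArg_joined hr.2.1 hk hz'.2
      ((connectedPart_iff.1 hr.1).2 z hz'.1 _ hr.2.1.1)
    refine (hj.mono ?_).trans ((hτ'.2 _ (harg hu') _ (harg hu)).mono hle)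
    rintro (v | l) ⟨h1, h2⟩
    · refine ⟨h1, ?_⟩
      rintro (rfl | ⟨c, hc, -⟩)
      · exact h2 rfl
      · cases hc
    · exact h1
  | amp =>
    obtain ⟨b, rfl⟩ := (mem_erase_amp hk).1 hρ
    have hclρ := erase_closed hμ hr hρ
    have hsρ : s ∈ (lam.ampPart μ r b).verts := by
      rw [ampPart_eq]
      exact ⟨hs.2.1.1, not_mem_deleted hμ hs.2.1 hr.2.1.1 hrs.symm⟩
    rcases hs.cases with hsk | hsk | ⟨o, ho⟩
    · exact (not_ready_tensor_amp hμ hs hr hsk hk hsF hrF).elim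
    -- Two withs: the part for `r` is covered, except for the vertex `s`, by the two connected
    -- slicings obtained by also choosing a side at `s`. Their links belong to different pieces, so
    -- a conflict edge joins them.
    · have hτ : ∀ c, lam.ConnectedPart (lam.ampPart (lam.ampPart μ s c) r b) := by
        intro c
        have hσ := (mem_erase_amp (lam := lam) (μ := μ) hsk).2 ⟨c, rfl⟩
        refine (hc _ hσ ?_).2 _ ((mem_erase_amp hk).2 ⟨b, rfl⟩)
        rw [ampPart_eq]
        exact ⟨hr.2.1.1, not_mem_deleted hμ hr.2.1 hs.2.1.1 hrs⟩
      have hle : ∀ c, (lam.ampPart (lam.ampPart μ s c) r b).carrier ⊆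
          (lam.ampPart μ r b).carrier := by
        intro c
        refine Part.carrier_mono (fun v hv => ⟨hv.1.1, hv.2⟩) fun l hl => ?_
        have h1 := mem_ampPart_links.1 hl
        rw [pieceOf_ampPart h1.1] at h1
        exact mem_ampPart_links.2 ⟨(mem_ampPart_links.1 h1.1).1, h1.2⟩
      obtain ⟨l₀, hl₀⟩ := (hτ false).1
      obtain ⟨l₁, hl₁⟩ := (hτ true).1
      have hmem : ∀ {c l}, l ∈ (lam.ampPart (lam.ampPart μ s c) r b).links →
          l ∈ μ.links ∧ lam.Chooses (lam.pieceOf μ.links l) s c := fun {c l} hl =>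
        mem_ampPart_links.1 (mem_ampPart_links.1 hl).1
      have hconf : lam.conflict.Adj l₀ l₁ := by
        refine joined_of_conflict (K := μ.links) (fun heq => ?_) (hmem hl₀).1 (hmem hl₁).1
        have h1 := (hmem hl₀).2
        rw [heq] at h1
        exact absurd (h1.unique (hmem hl₁).2) (by simp)
      have hj01 : Joined lam.graph (lam.ampPart μ r b).carrier (.inr l₁) (.inr l₀) :=
        Joined.single (graph_adj_link.2 hconf.symm) (hle true hl₁) (hle false hl₀)
      have hjτ : ∀ c z, z ∈ (lam.ampPart (lam.ampPart μ s c) r b).carrier →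
          Joined lam.graph (lam.ampPart μ r b).carrier z (.inr l₀) := by
        rintro (_ | _) z hz
        · exact ((connectedPart_iff.1 (hτ false)).2 z hz _ hl₀).mono (hle false)
        · exact (((connectedPart_iff.1 (hτ true)).2 z hz _ hl₁).mono (hle true)).trans hj01
      have hvert : ∀ v ∈ (lam.ampPart μ r b).verts, v ≠ s →
          Joined lam.graph (lam.ampPart μ r b).carrier (.inl v) (.inr l₀) := by
        intro v hv hvs
        -- A vertex other than `s` is missing from at most one of the two slicings, as it is not
        -- below both arguments of `s`.
        have : ∃ c, ¬ InArg (!c) v s := by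
          by_contra! hcon
          exact absurd ((hcon false).disjoint (hcon true)) (by simp)
        obtain ⟨c, hc⟩ := this
        exact hjτ c _ ⟨⟨hv.1, hvs, hc⟩, hv.2⟩
      refine connectedPart_of_forall (y := .inr l₀) 
        ⟨l₀, hle false (show Sum.inr l₀ ∈ _ from hl₀)⟩ fun z hz => ?_
      rcases z with v | l
      · by_cases hvs : v = s
        · subst hvs
          obtain ⟨u, hu⟩ := exists_isArg hsk false
          have hu' := hclρ _ _ _ hsρ hu
          exact (Joined.single (graph_adj_vertex.2 ⟨_, Or.inr hu⟩) hz hu').trans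
            (hvert u hu' hu.ne)
        · exact hvert v hz hvs
      · have h1 := mem_ampPart_links.1 hz
        obtain ⟨c, hc⟩ := hs.amp hsk h1.1
        have h2 : l ∈ (lam.ampPart μ s c).links := mem_ampPart_links.2 ⟨h1.1, hc⟩
        refine hjτ c _ (mem_ampPart_links.2 ⟨h2, ?_⟩)
        rw [pieceOf_ampPart h2]
        exact h1.2
    · have hrσ : r ∉ deleted s o := not_mem_deleted hμ hr.2.1 hs.2.1.1 hrs
      have hτ := (hc ⟨μ.verts \ deleted s o, μ.links⟩ (by rw [ho.erase]; rfl)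
        ⟨hr.2.1.1, hrσ⟩).2 (lam.ampPart _ r b) ((mem_erase_amp hk).2 ⟨b, rfl⟩)
      have hle : (lam.ampPart ⟨μ.verts \ deleted s o, μ.links⟩ r b).carrier ⊆
          (lam.ampPart μ r b).carrier :=
        Part.carrier_mono (fun v hv => ⟨hv.1.1, hv.2⟩) (fun l hl => hl)
      rw [connectedPart_iff] at hτ
      obtain ⟨⟨l₀, hl₀⟩, hj⟩ := hτ
      refine connectedPart_of_forall (y := .inr l₀) ⟨l₀, hl₀⟩ fun z hz => ?_
      rcases z with v | l
      -- With a par or plus at `s`, the slicing in question only has extra vertices at and below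
      -- `s`, and these are joined to an argument of `s` that stays.
      · by_cases hv : v ∈ deleted s o
        · obtain ⟨u, hu, hu', hvu⟩ := exists_joined_of_deleted hclρ hsρ ho hv
          exact hvu.trans ((hj (.inl u) ⟨⟨hu.1, hu'⟩, hu.2⟩ _ hl₀).mono hle)
        · exact (hj (.inl v) ⟨⟨hz.1, hv⟩, hz.2⟩ _ hl₀).mono hle
      · exact (hj (.inr l) hz _ hl₀).mono hle

/-! ### Commutation of erasures -/

theorem Deletes.of_ready (h : lam.Deletes μ r o) (h' : lam.Ready σ r)
    (hσ : σ.links ⊆ μ.links) : lam.Deletes σ r o := by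
  rcases h with h | ⟨hk, b, rfl, hb⟩
  · exact Or.inl h
  · obtain ⟨c, hc⟩ := deletes_of_ready h' hk
    obtain rfl := hc.of_subset hb hσ
    exact Or.inr ⟨hk, c, rfl, hc⟩

/-- Deletion of a root and formation of a component commute. -/
theorem tensorPart_delete (hμ : μ.Closed) (hr : lam.Ready μ r) (hk : r.label = .conn .tensor)
    (hs : IsRoot μ s) (hrs : r ≠ s)
    (hσ : lam.ConnectedPart ⟨μ.verts \ deleted s o, μ.links⟩) :
    lam.tensorPart ⟨μ.verts \ deleted s o, μ.links⟩ r b =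
      ⟨(lam.tensorPart μ r b).verts \ deleted s o, (lam.tensorPart μ r b).links⟩ := by
  set σ : Part Γ L := ⟨μ.verts \ deleted s o, μ.links⟩ with hσdef
  have hcl : σ.Closed := closed_diff_deleted hμ hs
  have hle : σ.carrier ⊆ μ.carrier := Part.carrier_mono (Set.sdiff_subset) le_rfl
  have hrσ : IsRoot σ r := isRoot_of_mem hr.2.1 Set.sdiff_subset
    ⟨hr.2.1.1, not_mem_deleted hμ hr.2.1 hs.1 hrs⟩
  obtain ⟨u, hu⟩ := exists_isArg hk b
  have key : ∀ z, z ∈ (lam.tensorPart σ r b).carrier ↔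
      z ∈ (lam.tensorPart μ r b).carrier ∧ z ∈ σ.carrier := by
    intro z
    rw [mem_tensorPart_carrier_of_isArg hu, mem_tensorPart_carrier_of_isArg hu]
    constructor
    · intro h
      exact ⟨h.mono (Set.sdiff_subset_sdiff_left hle), (h.mem (isArg_mem hcl hrσ hu)).1⟩
    · rintro ⟨h, hz⟩
      have hzr := (h.mem (isArg_mem hμ hr.2.1 hu)).2
      obtain ⟨c, u', hu', hj⟩ := exists_isArg_joined hrσ hk hzr
        ((connectedPart_iff.1 hσ).2 z hz _ hrσ.1)
      have hj' := hj.mono (Set.sdiff_subset_sdiff_left (t := {.inl r}) hle)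
      -- A surviving vertex still reaches an argument of `r` after the deletion; it must be `A_b`,
      -- because before the deletion the two components were disjoint.
      have hc : c = b := tensorPart_disjoint hr hμ hk
        (mem_tensorPart_carrier.2 ⟨u', hu', hj'.symm⟩) (mem_tensorPart_carrier.2 ⟨u, hu, h⟩)
      subst hc
      rw [← hu'.unique hu]
      exact hj.symm
  apply Part.carrier_injective
  ext z
  rw [key]
  rcases z with v | l
  · constructor
    · rintro ⟨h, h'⟩; exact ⟨h, h'.2⟩
    · rintro ⟨h, h'⟩
      exact ⟨h, ((tensorPart_carrier_subset hμ hr.2.1) (show Sum.inl v ∈ _ from h)).1, h'⟩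
  · exact ⟨fun h => h.1, fun h =>
      ⟨h, ((tensorPart_carrier_subset hμ hr.2.1) (show Sum.inr l ∈ _ from h)).1⟩⟩

/-- A component that contains a vertex below `s` also contains `s`, by climbing to it; so if `s` is
absent there is nothing to delete. -/
theorem diff_deleted_of_not_mem (hμ : μ.Closed) (hr : IsRoot μ r) (hs : IsRoot μ s)
    (hrs : r ≠ s) (hk : r.label = .conn .tensor) (h : s ∉ (lam.tensorPart μ r b).verts) :
    (lam.tensorPart μ r b).verts \ deleted s o = (lam.tensorPart μ r b).verts := by
  refine sdiff_eq_left.2 (Set.disjoint_left.2 fun v hv hvd => h ?_)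
  rcases hvd with rfl | ⟨c, -, hin⟩
  · exact hv
  obtain ⟨u, hu⟩ := exists_isArg hk b
  have hv' : Sum.inl v ∈ (lam.tensorPart μ r b).carrier := hv
  rw [mem_tensorPart_carrier_of_isArg hu] at hv'
  obtain ⟨w, hw, -⟩ := inArg_iff.1 hin
  have hS : ∀ w, InArg (!c) w s → (.inl w : Vertex Γ ⊕ L) ∈ μ.carrier \ {.inl r} := by
    intro w hw
    refine ⟨hμ.inArg hw hs.1, ?_⟩
    rintro ⟨⟩
    exact hμ.not_inArg hr hs.1 hw
  have : Sum.inl s ∈ (lam.tensorPart μ r b).carrier := by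
    rw [mem_tensorPart_carrier_of_isArg hu]
    refine hv'.trans ((joined_inArg hw hin hS).symm.trans (Joined.single
      (graph_adj_vertex.2 ⟨_, Or.inl hw⟩) (hS _ hw.inArg) ⟨hs.1, ?_⟩))
    simpa using hrs.symm
  exact this

/-- Inside the component that remains at one side of a tensor, further deletions can be done in
the whole slicing. -/
theorem joined_tensorPart_iff {z : Vertex Γ ⊕ L} (hμ : μ.Closed) (hr : IsRoot μ r) (hk : r.label = .conn .tensor)
    (hv : v ∈ (lam.tensorPart μ r b).verts) (hvs : v ≠ s) :
    Joined lam.graph ((lam.tensorPart μ r b).carrier \ {.inl s}) (.inl v) z ↔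
      Joined lam.graph ((μ.carrier \ {.inl r}) \ {.inl s}) (.inl v) z := by
  obtain ⟨u, hu⟩ := exists_isArg hk b
  have hv' : Sum.inl v ∈ (lam.tensorPart μ r b).carrier := hv
  rw [mem_tensorPart_carrier_of_isArg hu] at hv'
  constructor
  · intro h
    exact h.mono (Set.sdiff_subset_sdiff_left (tensorPart_carrier_subset hμ hr))
  · intro h
    refine h.within fun w hw => ⟨?_, ?_⟩
    · exact (mem_tensorPart_carrier_of_isArg hu).2 (hv'.trans (hw.mono Set.sdiff_subset))
    · rcases Relation.ReflTransGen.cases_tail hw with h | ⟨y, -, h⟩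
      · rw [h]; simpa using hvs
      · exact h.2.2.2

/-- The left side is the set of everything reachable from an argument `v` of `s` while avoiding both
`r` and `s`. If `r` lies in the component of `v` at `s`, this is a component there after deleting
`r`; otherwise avoiding `r` is no restriction. -/
theorem tensorPart_tensorPart (hμ : μ.Closed) (hr : lam.Ready μ r) (hs : lam.Ready μ s)
    (hrk : r.label = .conn .tensor) (hsk : s.label = .conn .tensor)
    (hρs : s ∈ (lam.tensorPart μ r b).verts)
    (hσ : lam.ConnectedPart (lam.tensorPart μ s c)) :
    (∃ d, r ∈ (lam.tensorPart μ s c).verts ∧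
      lam.tensorPart (lam.tensorPart μ r b) s c = lam.tensorPart (lam.tensorPart μ s c) r d) ∨
    lam.tensorPart (lam.tensorPart μ r b) s c = lam.tensorPart μ s c := by
  have hρ := (mem_erase_tensor (lam := lam) (μ := μ) hrk).2 ⟨b, rfl⟩
  have hσ' := (mem_erase_tensor (lam := lam) (μ := μ) hsk).2 ⟨c, rfl⟩
  obtain ⟨v, hv⟩ := exists_isArg hsk c
  have hvρ := erase_closed hμ hr hρ _ _ _ hρs hv
  have hvσ : v ∈ (lam.tensorPart μ s c).verts := by
    have : Sum.inl v ∈ (lam.tensorPart μ s c).carrier :=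
      (mem_tensorPart_carrier_of_isArg hv).2 (Joined.refl _)
    exact this
  have hvr : v ≠ r := fun h => hr.2.1.2 s hs.2.1.1 c (h ▸ hv)
  have hτ : ∀ z, z ∈ (lam.tensorPart (lam.tensorPart μ r b) s c).carrier ↔
      Joined lam.graph ((μ.carrier \ {.inl r}) \ {.inl s}) (.inl v) z := fun z => by
    rw [mem_tensorPart_carrier_of_isArg hv, joined_tensorPart_iff hμ hr.2.1 hrk hvρ hv.ne]
  by_cases hrσ : r ∈ (lam.tensorPart μ s c).verts
  · left
    have hroot := isRoot_of_mem hr.2.1 (erase_verts_subset hμ hs hσ') hrσ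
    obtain ⟨d, u, hu, hj⟩ := exists_isArg_joined hroot hrk (x := .inl v) (by simpa using hvr)
      ((connectedPart_iff.1 hσ).2 _ hvσ _ hrσ)
    refine ⟨d, hrσ, Part.carrier_injective (Set.ext fun z => ?_)⟩
    have huσ := erase_closed hμ hs hσ' _ _ _ hrσ hu
    rw [hτ, mem_tensorPart_carrier_of_isArg hu,
      joined_tensorPart_iff hμ hs.2.1 hsk huσ hu.ne, sdiff_right_comm]
    rw [joined_tensorPart_iff hμ hs.2.1 hsk hvσ hvr] at hj
    exact ⟨fun h => hj.symm.trans h, fun h => hj.trans h⟩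
  · right
    refine Part.carrier_injective (Set.ext fun z => ?_)
    rw [hτ, mem_tensorPart_carrier_of_isArg hv, sdiff_right_comm]
    refine ⟨fun h => h.mono Set.sdiff_subset, fun h => h.within fun w hw => ⟨?_, ?_⟩⟩
    · exact hw.mem (isArg_mem hμ hs.2.1 hv)
    · rintro rfl
      exact hrσ ((mem_tensorPart_carrier_of_isArg hv).2 hw)

theorem ampPart_delete : lam.ampPart ⟨μ.verts \ deleted s o, μ.links⟩ r b =
    ⟨(lam.ampPart μ r b).verts \ deleted s o, (lam.ampPart μ r b).links⟩ := by
  have h : (lam.ampPart ⟨μ.verts \ deleted s o, μ.links⟩ r b).links =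
    (lam.ampPart μ r b).links := rfl
  rw [ampPart_eq, h]
  conv_rhs => rw [ampPart_eq]
  rw [sdiff_right_comm]

theorem ampPart_ampPart : lam.ampPart (lam.ampPart μ r b) s c =
    lam.ampPart (lam.ampPart μ s c) r b := by
  ext x
  · constructor
    · rintro ⟨⟨h1, h2⟩, h3⟩; exact ⟨⟨h1, h3⟩, h2⟩
    · rintro ⟨⟨h1, h2⟩, h3⟩; exact ⟨⟨h1, h3⟩, h2⟩
  · have key : ∀ {r s : Vertex Γ} {b c : Bool}, x ∈ (lam.ampPart (lam.ampPart μ r b) s c).links ↔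
        x ∈ μ.links ∧ lam.Chooses (lam.pieceOf μ.links x) r b ∧
          lam.Chooses (lam.pieceOf μ.links x) s c := by
      intro r s b c
      rw [mem_ampPart_links]
      constructor
      · rintro ⟨h, h'⟩
        rw [pieceOf_ampPart h] at h'
        have := mem_ampPart_links.1 h
        exact ⟨this.1, this.2, h'⟩
      · rintro ⟨h, h1, h2⟩
        have h3 := mem_ampPart_links.2 ⟨h, h1⟩
        exact ⟨h3, by rwa [pieceOf_ampPart h3]⟩
    rw [key, key]
    tauto

/-- Erasures of different roots commute. -/
theorem erase_erase (hμ : μ.Closed) (hr : lam.Ready μ r) (hs : lam.Ready μ s)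
    (hrs : r ≠ s) (hrF : lam.Full μ r) (hsF : lam.Full μ s)
    (hcr : ∀ ρ ∈ lam.erase μ r, lam.ConnectedPart ρ)
    (hcs : ∀ σ ∈ lam.erase μ s, lam.ConnectedPart σ) (hρ : ρ ∈ lam.erase μ r)
    (hsρ : s ∈ ρ.verts) (hτ : τ ∈ lam.erase ρ s) :
    (∃ σ ∈ lam.erase μ s, r ∈ σ.verts ∧ τ ∈ lam.erase σ r) ∨ τ ∈ lam.erase μ s := by
  have hrd : ∀ o, r ∉ deleted s o := fun o => not_mem_deleted hμ hr.2.1 hs.2.1.1 hrs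
  have hsr : lam.Ready ρ s := hs.of_erase hμ hr hsF hrF hρ (hcr ρ hρ) hsρ
  have hready : ∀ σ ∈ lam.erase μ s, r ∈ σ.verts → lam.Ready σ r := fun σ hσ hrσ =>
    hr.of_erase hμ hs hrF hsF hσ (hcs σ hσ) hrσ
  have hsub : ∀ σ ∈ lam.erase μ s, σ.links ⊆ μ.links := fun σ hσ => erase_links_subset hμ hs hσ
  rcases hr.cases with hrk | hrk | ⟨o, ho⟩
  · obtain ⟨b, rfl⟩ := (mem_erase_tensor hrk).1 hρ
    rcases hs.cases with hsk | hsk | ⟨o', ho'⟩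
    · obtain ⟨c, rfl⟩ := (mem_erase_tensor hsk).1 hτ
      have hσ := (mem_erase_tensor (lam := lam) (μ := μ) hsk).2 ⟨c, rfl⟩
      rcases tensorPart_tensorPart hμ hr hs hrk hsk hsρ (hcs _ hσ) with ⟨d, h1, h2⟩ | h
      · exact Or.inl ⟨_, hσ, h1, (mem_erase_tensor hrk).2 ⟨d, h2⟩⟩
      · exact Or.inr (h ▸ hσ)
    · exact (not_ready_tensor_amp hμ hr hs hrk hsk hrF hsF).elim
    · rw [(ho'.of_ready hsr (erase_links_subset hμ hr hρ)).erase] at hτ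
      have hσ : (⟨μ.verts \ deleted s o', μ.links⟩ : Part Γ L) ∈ lam.erase μ s := by
        rw [ho'.erase]; rfl
      refine Or.inl ⟨_, hσ, ⟨hr.2.1.1, hrd _⟩, (mem_erase_tensor hrk).2 ⟨b, ?_⟩⟩
      rw [tensorPart_delete hμ hr hrk hs.2.1 hrs (hcs _ hσ)]
      exact hτ
  · obtain ⟨b, rfl⟩ := (mem_erase_amp hrk).1 hρ
    rcases hs.cases with hsk | hsk | ⟨o', ho'⟩
    · exact (not_ready_tensor_amp hμ hs hr hsk hrk hsF hrF).elim
    · obtain ⟨c, rfl⟩ := (mem_erase_amp hsk).1 hτ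
      refine Or.inl ⟨_, (mem_erase_amp hsk).2 ⟨c, rfl⟩, ?_, (mem_erase_amp hrk).2
        ⟨b, ampPart_ampPart⟩⟩
      rw [ampPart_eq]
      exact ⟨hr.2.1.1, hrd _⟩
    · rw [(ho'.of_ready hsr (erase_links_subset hμ hr hρ)).erase] at hτ
      have hσ : (⟨μ.verts \ deleted s o', μ.links⟩ : Part Γ L) ∈ lam.erase μ s := by
        rw [ho'.erase]; rfl
      refine Or.inl ⟨_, hσ, ⟨hr.2.1.1, hrd _⟩, (mem_erase_amp hrk).2 ⟨b, ?_⟩⟩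
      rw [ampPart_delete]
      exact hτ
  · rw [ho.erase] at hρ
    obtain rfl := hρ
    have hρ : (⟨μ.verts \ deleted r o, μ.links⟩ : Part Γ L) ∈ lam.erase μ r := by
      rw [ho.erase]; rfl
    rcases hs.cases with hsk | hsk | ⟨o', ho'⟩
    · obtain ⟨c, rfl⟩ := (mem_erase_tensor hsk).1 hτ
      have hσ := (mem_erase_tensor (lam := lam) (μ := μ) hsk).2 ⟨c, rfl⟩
      rw [tensorPart_delete hμ hs hsk hr.2.1 hrs.symm (hcr _ hρ)]
      by_cases hrσ : r ∈ (lam.tensorPart μ s c).verts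
      · refine Or.inl ⟨_, hσ, hrσ, ?_⟩
        rw [(ho.of_ready (hready _ hσ hrσ) (hsub _ hσ)).erase]
        rfl
      · rw [diff_deleted_of_not_mem hμ hs.2.1 hr.2.1 hrs.symm hsk hrσ]
        exact Or.inr hσ
    · obtain ⟨c, rfl⟩ := (mem_erase_amp hsk).1 hτ
      have hσ := (mem_erase_amp (lam := lam) (μ := μ) hsk).2 ⟨c, rfl⟩
      have hrσ : r ∈ (lam.ampPart μ s c).verts := by
        rw [ampPart_eq]
        exact ⟨hr.2.1.1, hrd _⟩
      refine Or.inl ⟨_, hσ, hrσ, ?_⟩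
      rw [(ho.of_ready (hready _ hσ hrσ) (hsub _ hσ)).erase, ampPart_delete]
      rfl
    · have hσ : (⟨μ.verts \ deleted s o', μ.links⟩ : Part Γ L) ∈ lam.erase μ s := by
        rw [ho'.erase]; rfl
      have hrσ : r ∈ (⟨μ.verts \ deleted s o', μ.links⟩ : Part Γ L).verts := ⟨hr.2.1.1, hrd _⟩
      rw [(ho'.of_ready hsr le_rfl).erase] at hτ
      refine Or.inl ⟨_, hσ, hrσ, ?_⟩
      rw [(ho.of_ready (hready _ hσ hrσ) le_rfl).erase]
      rw [Set.mem_singleton_iff] at hτ ⊢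
      rw [hτ, sdiff_right_comm]

/-- Only a tensor at `r` can separate off a result without `s`. Such a component does not notice the
erasure of `s`, so it also arises after `s` has been erased. -/
theorem mem_erase_of_not_mem (hμ : μ.Closed) (hr : lam.Ready μ r) (hs : lam.Ready μ s)
    (hrs : r ≠ s) (hrF : lam.Full μ r) (hsF : lam.Full μ s)
    (hcs : ∀ σ ∈ lam.erase μ s, lam.ConnectedPart σ) (hρ : ρ ∈ lam.erase μ r)
    (hsρ : s ∉ ρ.verts) : ∃ σ ∈ lam.erase μ s, r ∈ σ.verts ∧ ρ ∈ lam.erase σ r := by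
  have hsd : ∀ o, s ∉ deleted r o := fun o => not_mem_deleted hμ hs.2.1 hr.2.1.1 hrs.symm
  have hrd : ∀ o, r ∉ deleted s o := fun o => not_mem_deleted hμ hr.2.1 hs.2.1.1 hrs
  rcases hr.cases with hrk | hrk | ⟨o, ho⟩
  · obtain ⟨b, rfl⟩ := (mem_erase_tensor hrk).1 hρ
    rcases hs.cases with hsk | hsk | ⟨o', ho'⟩
    · obtain ⟨σ, hσ, hrσ⟩ := exists_mem_erase hμ hs hr.2.1 hrs
      obtain ⟨c, rfl⟩ := (mem_erase_tensor hsk).1 hσ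
      refine ⟨_, hσ, hrσ, (mem_erase_tensor hrk).2 ⟨b, Part.carrier_injective
        (Set.ext fun z => ?_)⟩⟩
      obtain ⟨u, hu⟩ := exists_isArg hrk b
      have huσ := erase_closed hμ hs hσ _ _ _ hrσ hu
      rw [mem_tensorPart_carrier_of_isArg hu, mem_tensorPart_carrier_of_isArg hu,
        joined_tensorPart_iff hμ hs.2.1 hsk huσ hu.ne, sdiff_right_comm]
      refine ⟨fun h => h.within fun w hw => ⟨hw.mem (isArg_mem hμ hr.2.1 hu), ?_⟩,
        fun h => h.mono Set.sdiff_subset⟩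
      rintro rfl
      exact hsρ ((mem_tensorPart_carrier_of_isArg hu).2 hw)
    · exact (not_ready_tensor_amp hμ hr hs hrk hsk hrF hsF).elim
    · have hσ : (⟨μ.verts \ deleted s o', μ.links⟩ : Part Γ L) ∈ lam.erase μ s := by
        rw [ho'.erase]; rfl
      refine ⟨_, hσ, ⟨hr.2.1.1, hrd _⟩, (mem_erase_tensor hrk).2 ⟨b, ?_⟩⟩
      rw [tensorPart_delete hμ hr hrk hs.2.1 hrs (hcs _ hσ),
        diff_deleted_of_not_mem hμ hr.2.1 hs.2.1 hrs hrk hsρ]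
  · obtain ⟨b, rfl⟩ := (mem_erase_amp hrk).1 hρ
    rw [ampPart_eq] at hsρ
    exact absurd ⟨hs.2.1.1, hsd _⟩ hsρ
  · rw [ho.erase] at hρ
    obtain rfl := hρ
    exact absurd ⟨hs.2.1.1, hsd _⟩ hsρ

/-! ### Confluence -/

/-- A slicing that reduces to the empty cluster. -/
inductive Reduces (lam : Links Γ L) (bar : A → A) : Part Γ L → Prop
  | ax (μ : Part Γ L) : lam.IsAxiomPart bar μ → Reduces lam bar μ
  | step (μ : Part Γ L) (r : Vertex Γ) : lam.Ready μ r →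
      (∀ ν ∈ lam.erase μ r, Reduces lam bar ν) → Reduces lam bar μ

variable {bar : A → A}

theorem IsAxiomPart.connectedPart (h : lam.IsAxiomPart bar μ) : lam.ConnectedPart μ := by
  obtain ⟨l, x, y, -, hl, hv, hrel⟩ := h
  have hl' : l ∈ μ.links := by rw [hl]; rfl
  refine connectedPart_of_forall (y := .inr l) ⟨l, hl'⟩ fun z hz => ?_
  rcases z with v | m
  · have : v = x.1 ∨ v = y.1 := by
      have : v ∈ μ.verts := hz
      rw [hv] at this
      exact this
    refine Joined.single (graph_adj_leaf'.2 ?_) hz hl'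
    rcases this with rfl | rfl
    · exact ⟨x, (hrel x).2 (Or.inl rfl), rfl⟩
    · exact ⟨y, (hrel y).2 (Or.inr rfl), rfl⟩
  · have : m ∈ μ.links := hz
    rw [hl] at this
    rw [Set.mem_singleton_iff.1 this]
    exact Joined.refl _

theorem IsAxiomPart.not_label (h : lam.IsAxiomPart bar μ) (hr : r ∈ μ.verts) :
    r.label ≠ .conn k := by
  obtain ⟨l, ⟨x, a, ha⟩, ⟨y, a', ha'⟩, -, -, hv, -⟩ := h
  rw [hv] at hr
  intro hk
  rcases hr with rfl | rfl
  · rw [ha] at hk; cases hk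
  · rw [ha'] at hk; cases hk

theorem Reduces.connectedPart (h : lam.Reduces bar μ) : lam.ConnectedPart μ := by
  cases h with
  | ax _ h => exact h.connectedPart
  | step _ r h _ => exact h.1

/-- An axiom has no connectives, so `r` is erased at some point along a branch that keeps it. Both
results of that erasure have links, which touch the respective arguments; and earlier slicings have
at least these links. -/
theorem Reduces.full (h : lam.Reduces bar μ) (hμ : μ.Closed) (hr : IsRoot μ r) :
    lam.Full μ r := by
  intro hk b
  induction h with
  | ax μ h => rcases hk with hk | hk <;> exact absurd hk (h.not_label hr.1)
  | step μ s hs he ih =>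
    by_cases hrs : r = s
    · subst hrs
      rcases hk with hk | hk
      · have hν := he _ ((mem_erase_tensor hk).2 ⟨b, rfl⟩)
        obtain ⟨l, hl⟩ := hν.connectedPart.1
        by_contra hcon
        have hl' : Sum.inr l ∈ (lam.tensorPart μ r b).carrier := hl
        obtain ⟨u, hu, hj⟩ := mem_tensorPart_carrier.1 hl'
        obtain ⟨w, hw, -⟩ := inArg_of_joined (S := μ.carrier \ {.inl r}) (b := b) (r := r) (by simp)
          (fun m hm x hx hin => hcon ⟨m, hm.1, x, hx, hin⟩) hj hu.inArg
        cases hw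
      · have hν := he _ ((mem_erase_amp hk).2 ⟨b, rfl⟩)
        obtain ⟨l, hl⟩ := hν.connectedPart.1
        have := mem_ampPart_links.1 hl
        exact this.2.1.mono (pieceOf_subset this.1)
    · obtain ⟨σ, hσ, hrσ⟩ := exists_mem_erase hμ hs hr hrs
      exact (ih σ hσ (erase_closed hμ hs hσ)
        (isRoot_of_mem hr (erase_verts_subset hμ hs hσ) hrσ)).mono (erase_links_subset hμ hs hσ)

/-- Erasing a ready root never does any harm. -/
theorem Reduces.erase (h : lam.Reduces bar μ) (hμ : μ.Closed) (hr : lam.Ready μ r) :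
    ∀ ρ ∈ lam.erase μ r, lam.Reduces bar ρ := by
  induction h generalizing r with
  | ax μ h =>
    obtain ⟨k, hk⟩ := hr.label
    exact absurd hk (h.not_label hr.2.1.1)
  | step μ s hs he ih =>
    by_cases hrs : r = s
    · subst hrs
      exact he
    have hrF := (Reduces.step μ s hs he).full hμ hr.2.1
    have hsF := (Reduces.step μ s hs he).full hμ hs.2.1
    have hcs : ∀ σ ∈ lam.erase μ s, lam.ConnectedPart σ := fun σ hσ => (he σ hσ).connectedPart
    -- The derivation begins with `s`. In each result that contains `r`, the root `r` is still
    -- ready, so the induction hypothesis applies there.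
    have hσr : ∀ σ ∈ lam.erase μ s, r ∈ σ.verts → ∀ τ ∈ lam.erase σ r, lam.Reduces bar τ :=
      fun σ hσ hrσ => ih σ hσ (erase_closed hμ hs hσ)
        (hr.of_erase hμ hs hrF hsF hσ (hcs σ hσ) hrσ)
    have hcr : ∀ ρ ∈ lam.erase μ r, lam.ConnectedPart ρ := fun ρ hρ =>
      connectedPart_of_erase hμ hr hs hrs hrF hsF (fun σ hσ hrσ =>
        ⟨hcs σ hσ, fun τ hτ => (hσr σ hσ hrσ τ hτ).connectedPart⟩) hρ
    intro ρ hρ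
    by_cases hsρ : s ∈ ρ.verts
    -- Erase `s` from `ρ`: each result is also reached by erasing `s` first, whether or not `r` has
    -- to be erased afterwards.
    · refine Reduces.step ρ s (hs.of_erase hμ hr hsF hrF hρ (hcr ρ hρ) hsρ) fun τ hτ => ?_
      rcases erase_erase hμ hr hs hrs hrF hsF hcr hcs hρ hsρ hτ with ⟨σ, hσ, hrσ, hτσ⟩ | h
      · exact hσr σ hσ hrσ τ hτσ
      · exact he τ h
    · obtain ⟨σ, hσ, hrσ, hτσ⟩ := mem_erase_of_not_mem hμ hr hs hrs hrF hsF hcs hρ hsρ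
      exact hσr σ hσ hrσ ρ hτσ

/-! ### Clusters -/

theorem erase_finite (hr : lam.Ready μ r) : (lam.erase μ r).Finite := by
  rcases hr.cases with h | h | ⟨o, h⟩
  · rw [erase_tensor h]; exact Set.toFinite _
  · rw [erase_amp h]; exact Set.toFinite _
  · rw [h.erase]; exact Set.toFinite _

theorem steps_of_reduces_finite {Y : Set (Part Γ L)} (hY : Y.Finite)
    (h : ∀ μ ∈ Y, ∀ X : Set (Part Γ L), (∀ ν ∈ X, lam.ConnectedPart ν) →
      Relation.ReflTransGen (lam.Step bar) (.slicings (X ∪ {μ})) (.slicings X))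
    (hc : ∀ μ ∈ Y, lam.ConnectedPart μ)
    {X : Set (Part Γ L)} (hX : ∀ ν ∈ X, lam.ConnectedPart ν) :
    Relation.ReflTransGen (lam.Step bar) (.slicings (X ∪ Y)) (.slicings X) := by
  induction Y, hY using Set.Finite.induction_on with
  | empty => rw [Set.union_empty]
  | @insert μ Y _ _ ih =>
    rw [Set.insert_eq, Set.union_comm {μ}, ← Set.union_assoc]
    refine Relation.ReflTransGen.trans (h μ (Set.mem_insert _ _) (X ∪ Y) ?_)
      (ih (fun ν hν => h ν (Set.mem_insert_of_mem _ hν))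
        (fun ν hν => hc ν (Set.mem_insert_of_mem _ hν)))
    rintro ν (hν | hν)
    · exact hX ν hν
    · exact hc ν (Set.mem_insert_of_mem _ hν)

/-- A cluster is a set, so a slicing that already occurs in `X` is absorbed at no cost; this is the
case `μ ∈ X`. Connectedness of `X` is what the erasure rules require of the other slicings. -/
theorem Reduces.steps (h : lam.Reduces bar μ) (X : Set (Part Γ L))
    (hX : ∀ ν ∈ X, lam.ConnectedPart ν) :
    Relation.ReflTransGen (lam.Step bar) (.slicings (X ∪ {μ})) (.slicings X) := by
  induction h generalizing X with
  | ax μ h =>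
    by_cases hμ : μ ∈ X
    · rw [Set.union_eq_self_of_subset_right (by simpa using hμ)]
    · exact .single (.ax X μ hμ hX h)
  | step μ r hr he ih =>
    by_cases hμ : μ ∈ X
    · rw [Set.union_eq_self_of_subset_right (by simpa using hμ)]
    · exact .head (.erase X μ r hμ hX hr) (steps_of_reduces_finite (erase_finite hr) ih
        (fun ν hν => (he ν hν).connectedPart) hX)

/-- No rule applies to the error symbol, and each other rule acts on one slicing, so reading a
successful sequence backwards builds a derivation tree for every slicing in it. -/
theorem erasable_iff : lam.Erasable bar ↔ lam.Reduces bar ⟨Set.univ, Set.univ⟩ := by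
  constructor
  · intro h
    have key : ∀ Y : Cluster Γ L, Relation.ReflTransGen (lam.Step bar) Y (.slicings ∅) →
        ∃ X, Y = .slicings X ∧ ∀ μ ∈ X, lam.Reduces bar μ := by
      intro Y hY
      induction hY using Relation.ReflTransGen.head_induction_on with
      | refl => exact ⟨∅, rfl, by simp⟩
      | head hst _ ih =>
        obtain ⟨X', hX', hred⟩ := ih
        cases hst with
        | error => cases hX'
        | erase X μ r _ _ hr =>
          cases hX'
          refine ⟨_, rfl, ?_⟩
          rintro ν (hν | rfl)
          · exact hred ν (Or.inl hν)
          · exact .step _ r hr fun ρ hρ => hred ρ (Or.inr hρ)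
        | ax X μ _ _ hax =>
          cases hX'
          refine ⟨_, rfl, ?_⟩
          rintro ν (hν | rfl)
          · exact hred ν hν
          · exact .ax _ hax
    obtain ⟨X, hX, hred⟩ := key _ h
    cases hX
    exact hred _ rfl
  · intro h
    have := h.steps (∅ : Set (Part Γ L)) (by simp)
    rwa [Set.empty_union] at this

end Links

end MALL

namespace MALL

variable {A : Type*} {Γ : Sequent A} {L : Type*}

namespace Links

variable {lam : Links Γ L} {μ ν σ ρ τ : Part Γ L} {u v r s : Vertex Γ} {b c : Bool} {k : Conn}
  {K K' : Set L} {o : Option Bool} {bar : A → A} {i : L}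

/-! ### Following one link through the erasure -/

/-- Ready, and not bound to lead to a slicing without links. -/
def Erases (lam : Links Γ L) (μ : Part Γ L) (r : Vertex Γ) : Prop :=
  lam.Ready μ r ∧ lam.Full μ r

theorem exists_mem_links (hr : lam.Ready μ r) (hi : i ∈ μ.links) :
    ∃ ν ∈ lam.erase μ r, i ∈ ν.links := by
  rcases hr.cases with h | h | ⟨o, h⟩
  · obtain ⟨b, hb⟩ := exists_joined_tensorPart hr.1 hr.2.1 h (z := .inr i) hi (by simp)
    exact ⟨_, (mem_erase_tensor h).2 ⟨b, rfl⟩, hb⟩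
  · obtain ⟨b, hb⟩ := hr.amp h hi
    exact ⟨_, (mem_erase_amp h).2 ⟨b, rfl⟩, mem_ampPart_links.2 ⟨hi, hb⟩⟩
  · refine ⟨⟨μ.verts \ deleted r o, μ.links⟩, ?_, hi⟩
    rw [h.erase]; rfl

/-- The components at a ready tensor are disjoint and a piece chooses only one side of a with. So
following a link is deterministic. -/
theorem erase_eq_of_mem (hμ : μ.Closed) (hr : lam.Ready μ r) (hν : ν ∈ lam.erase μ r)
    (hσ : σ ∈ lam.erase μ r) (hi : i ∈ ν.links) (hi' : i ∈ σ.links) : ν = σ := by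
  rcases hr.cases with h | h | ⟨o, h⟩
  · obtain ⟨b, rfl⟩ := (mem_erase_tensor h).1 hν
    obtain ⟨c, rfl⟩ := (mem_erase_tensor h).1 hσ
    rw [tensorPart_disjoint hr hμ h (z := .inr i) hi hi']
  · obtain ⟨b, rfl⟩ := (mem_erase_amp h).1 hν
    obtain ⟨c, rfl⟩ := (mem_erase_amp h).1 hσ
    rw [(mem_ampPart_links.1 hi).2.unique (mem_ampPart_links.1 hi').2]
  · rw [h.erase] at hν hσ
    rw [hν, hσ]

/-- Without the fullness requirement, a result with no links could arise, and no run would notice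
the failure. -/
theorem Erases.links_nonempty (h : lam.Erases μ r) (hμ : μ.Closed) (hν : ν ∈ lam.erase μ r) :
    ν.links.Nonempty := by
  obtain ⟨hr, hF⟩ := h
  rcases hr.cases with h | h | ⟨o, h⟩
  · obtain ⟨b, rfl⟩ := (mem_erase_tensor h).1 hν
    obtain ⟨l, hl, x, hx, hin⟩ := hF (Or.inl h) b
    exact ⟨l, mem_tensorPart_of_touches hμ hr.2.1 hl hx hin⟩
  · obtain ⟨b, rfl⟩ := (mem_erase_amp h).1 hν
    obtain ⟨l, hl, hx⟩ := hF (Or.inr h) b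
    obtain ⟨c, hc⟩ := hr.amp h hl
    refine ⟨l, mem_ampPart_links.2 ⟨hl, ?_⟩⟩
    by_cases hcb : c = b
    · exact hcb ▸ hc
    · rw [eq_not_of_ne hcb] at hc
      have hx' : lam.Touches (lam.pieceOf μ.links l) r b := ⟨l, mem_pieceOf_self, hx⟩
      exact absurd hx' (by simpa using hc.2)
  · rw [h.erase] at hν
    obtain rfl := hν
    exact hr.1.1

open Classical in
/-- The slicing that contains the link `i` after the erasure of `r`, if `r` may be erased. -/
noncomputable def next (lam : Links Γ L) (i : L) (z : Vertex Γ ⊕ L) (μ : Part Γ L) : Part Γ L :=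
  if h : ∃ ν, ∃ r, z = .inl r ∧ lam.Erases μ r ∧ ν ∈ lam.erase μ r ∧ i ∈ ν.links then
    h.choose
  else μ

theorem next_eq (hμ : μ.Closed) (hr : lam.Erases μ r) (hν : ν ∈ lam.erase μ r)
    (hi : i ∈ ν.links) : lam.next i (.inl r) μ = ν := by
  have h : ∃ ν, ∃ r', (.inl r : Vertex Γ ⊕ L) = .inl r' ∧ lam.Erases μ r' ∧
      ν ∈ lam.erase μ r' ∧ i ∈ ν.links := ⟨ν, r, rfl, hr, hν, hi⟩
  rw [next, dif_pos h]
  obtain ⟨r', h1, -, h2, h3⟩ := h.choose_spec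
  obtain rfl := Sum.inl.inj h1
  exact erase_eq_of_mem hμ hr.1 h2 hν h3 hi

theorem next_of_not {z : Vertex Γ ⊕ L} (h : ∀ r, z = .inl r → ¬ lam.Erases μ r) :
    lam.next i z μ = μ := by
  rw [next, dif_neg]
  rintro ⟨ν, r, hz, hr, -⟩
  exact h r hz hr

theorem next_cases (hμ : μ.Closed) (hi : i ∈ μ.links) (z : Vertex Γ ⊕ L) :
    ((∀ r, z = .inl r → ¬ lam.Erases μ r) ∧ lam.next i z μ = μ) ∨
      ∃ r, z = .inl r ∧ lam.Erases μ r ∧ lam.next i z μ ∈ lam.erase μ r ∧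
        i ∈ (lam.next i z μ).links := by
  by_cases h : ∃ r, z = .inl r ∧ lam.Erases μ r
  · obtain ⟨r, rfl, hr⟩ := h
    obtain ⟨ν, hν, hi⟩ := exists_mem_links hr.1 hi
    exact Or.inr ⟨r, rfl, hr, by rw [next_eq hμ hr hν hi]; exact ⟨hν, hi⟩⟩
  · have h' : ∀ r, z = .inl r → ¬ lam.Erases μ r := fun r hz hr => h ⟨r, hz, hr⟩
    exact Or.inl ⟨h', next_of_not h'⟩

/-- Attempt to erase all vertices of a list, following the link `i`. -/
noncomputable def run (lam : Links Γ L) (i : L) (l : List (Vertex Γ ⊕ L)) (μ : Part Γ L) :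
    Part Γ L :=
  l.foldl (fun μ z => lam.next i z μ) μ

/-- The links of one slicing make the same moves until an erasure separates them, so their runs fit
together into a derivation tree; every result contains a link that certifies it. -/
theorem reduces_of_run (l : List (Vertex Γ ⊕ L)) (hμ : μ.Closed) (hne : μ.links.Nonempty)
    (h : ∀ i ∈ μ.links, lam.IsAxiomPart bar (lam.run i l μ)) : lam.Reduces bar μ := by
  induction l generalizing μ with
  | nil =>
    obtain ⟨i, hi⟩ := hne
    exact .ax _ (h i hi)
  | cons z l ih =>
    by_cases hz : ∃ r, z = .inl r ∧ lam.Erases μ r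
    · obtain ⟨r, rfl, hr⟩ := hz
      refine .step μ r hr.1 fun ν hν => ih (erase_closed hμ hr.1 hν)
        (hr.links_nonempty hμ hν) fun i hi => ?_
      have := h i (erase_links_subset hμ hr.1 hν hi)
      rwa [run, List.foldl_cons, next_eq hμ hr hν hi] at this
    · refine ih hμ hne fun i hi => ?_
      have := h i hi
      rwa [run, List.foldl_cons, next_of_not fun r hz' hr => hz ⟨r, hz', hr⟩] at this

theorem Reduces.next (h : lam.Reduces bar μ) (hμ : μ.Closed) (hi : i ∈ μ.links)
    (z : Vertex Γ ⊕ L) : lam.Reduces bar (lam.next i z μ) ∧ (lam.next i z μ).Closed ∧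
      i ∈ (lam.next i z μ).links := by
  rcases next_cases hμ hi z with ⟨-, he⟩ | ⟨r, rfl, hr, hν, hi'⟩
  · rw [he]; exact ⟨h, hμ, hi⟩
  · exact ⟨h.erase hμ hr.1 _ hν, erase_closed hμ hr.1 hν, hi'⟩

theorem next_closed (hμ : μ.Closed) (hi : i ∈ μ.links) (z : Vertex Γ ⊕ L) :
    (lam.next i z μ).Closed ∧ i ∈ (lam.next i z μ).links := by
  rcases next_cases (lam := lam) hμ hi z with ⟨-, he⟩ | ⟨r, rfl, hr, hν, hi'⟩
  · rw [he]; exact ⟨hμ, hi⟩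
  · exact ⟨erase_closed hμ hr.1 hν, hi'⟩

theorem Reduces.run (h : lam.Reduces bar μ) (hμ : μ.Closed) (hi : i ∈ μ.links)
    (l : List (Vertex Γ ⊕ L)) : lam.Reduces bar (lam.run i l μ) ∧ (lam.run i l μ).Closed ∧
      i ∈ (lam.run i l μ).links := by
  induction l generalizing μ with
  | nil => exact ⟨h, hμ, hi⟩
  | cons z l ih =>
    obtain ⟨h1, h2, h3⟩ := h.next hμ hi z
    exact ih h1 h2 h3

theorem run_verts_subset (hμ : μ.Closed) (hi : i ∈ μ.links) (l : List (Vertex Γ ⊕ L)) :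
    (lam.run i l μ).verts ⊆ μ.verts := by
  induction l generalizing μ with
  | nil => exact le_rfl
  | cons z l ih =>
    obtain ⟨h2, h3⟩ := next_closed (lam := lam) hμ hi z
    refine (ih h2 h3).trans ?_
    rcases next_cases (lam := lam) hμ hi z with ⟨-, he⟩ | ⟨r, rfl, hr, hν, hi'⟩
    · rw [he]
    · exact erase_verts_subset hμ hr.1 hν

/-- Each erasure removes at least the erased root, and vertices never return; this bounds the number
of productive sweeps. -/
theorem run_cases [Finite (Vertex Γ)] (hμ : μ.Closed) (hi : i ∈ μ.links)
    (l : List (Vertex Γ ⊕ L)) :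
    ((∀ r, .inl r ∈ l → ¬ lam.Erases μ r) ∧ lam.run i l μ = μ) ∨
      (lam.run i l μ).verts.ncard < μ.verts.ncard := by
  induction l with
  | nil => exact Or.inl ⟨by simp, rfl⟩
  | cons z l ih =>
    rcases next_cases (lam := lam) hμ hi z with ⟨hz, he⟩ | ⟨r, rfl, hr, hν, hi'⟩
    · rw [run, List.foldl_cons, he]
      refine ih.imp (fun h => ⟨fun r hr => ?_, h.2⟩) id
      rcases List.mem_cons.1 hr with hr | hr
      · exact hz r hr.symm
      · exact h.1 r hr
    · right
      refine Set.ncard_lt_ncard (Set.ssubset_iff_of_subset (run_verts_subset hμ hi _) |>.2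
        ⟨r, hr.1.2.1.1, fun hmem => ?_⟩) (Set.toFinite _)
      exact not_mem_erase_verts hμ hr.1 hν
        (run_verts_subset (erase_closed hμ hr.1 hν) hi' l hmem)

theorem Reduces.exists_erases (h : lam.Reduces bar μ) (hμ : μ.Closed)
    (hax : ¬ lam.IsAxiomPart bar μ) : ∃ r, lam.Erases μ r := by
  cases h with
  | ax _ h => exact absurd h hax
  | step _ r hr he => exact ⟨r, hr, (Reduces.step μ r hr he).full hμ hr.2.1⟩

theorem IsAxiomPart.run_eq (h : lam.IsAxiomPart bar μ) (l : List (Vertex Γ ⊕ L)) :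
    lam.run i l μ = μ := by
  induction l with
  | nil => rfl
  | cons z l ih =>
    rw [run, List.foldl_cons, next_of_not]
    · exact ih
    · rintro r - hr
      obtain ⟨k, hk⟩ := hr.1.label
      exact h.not_label hr.1.2.1.1 hk

theorem run_append (l l' : List (Vertex Γ ⊕ L)) :
    lam.run i (l ++ l') μ = lam.run i l' (lam.run i l μ) :=
  List.foldl_append

/-- While no axiom is reached, some root can be erased, so every sweep loses a vertex. The greedy
choice is harmless by `Reduces.erase`. -/
theorem Reduces.isAxiomPart_run [Finite (Vertex Γ)] {l : List (Vertex Γ ⊕ L)}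
    (hl : ∀ r, .inl r ∈ l) (n : ℕ) (h : lam.Reduces bar μ) (hμ : μ.Closed) (hi : i ∈ μ.links)
    (hn : μ.verts.ncard ≤ n) : lam.IsAxiomPart bar (lam.run i (List.replicate n l).flatten μ) := by
  induction n generalizing μ with
  | zero =>
    have : μ.verts = ∅ := (Set.ncard_eq_zero (Set.toFinite _)).1 (by omega)
    by_contra hax
    obtain ⟨r, hr⟩ := h.exists_erases hμ hax
    have := hr.1.2.1.1
    simp_all
  | succ n ih =>
    rw [List.replicate_succ, List.flatten_cons, run_append]
    by_cases hax : lam.IsAxiomPart bar μ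
    · rw [hax.run_eq, hax.run_eq]
      exact hax
    obtain ⟨r, hr⟩ := h.exists_erases hμ hax
    obtain ⟨h1, h2, h3⟩ := h.run hμ hi l
    refine ih h1 h2 h3 ?_
    rcases run_cases (lam := lam) hμ hi l with ⟨hcon, -⟩ | hlt
    · exact absurd hr (hcon r (hl r))
    · omega

theorem closed_univ : Part.Closed (⟨Set.univ, Set.univ⟩ : Part Γ L) := fun _ _ _ _ _ => trivial

/-- Erasability, in terms of the fate of each link. -/
theorem erasable_iff_run [Finite (Vertex Γ)] {l : List (Vertex Γ ⊕ L)} (hl : ∀ r, .inl r ∈ l)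
    {n : ℕ} (hn : Nat.card (Vertex Γ) ≤ n) : lam.Erasable bar ↔ Nonempty L ∧
      ∀ i, lam.IsAxiomPart bar (lam.run i (List.replicate n l).flatten ⟨Set.univ, Set.univ⟩) := by
  rw [erasable_iff]
  constructor
  · intro h
    obtain ⟨i, -⟩ := h.connectedPart.1
    exact ⟨⟨i⟩, fun i => h.isAxiomPart_run hl n closed_univ trivial
      (by rwa [Set.ncard_univ])⟩
  · rintro ⟨⟨i⟩, h⟩
    exact reduces_of_run _ closed_univ ⟨i, trivial⟩ fun i _ => h i

end Links

end MALL

namespace RAM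

/-! ### First-order formulas with transitive closure -/

/-- Formulas over a family `α` of binary relations; variables are natural numbers. -/
inductive Form (α : Type)
  | atom (a : α) (x y : ℕ)
  | neg (φ : Form α)
  | and (φ ψ : Form α)
  | ex (x : ℕ) (φ : Form α)
  | tc (a b : ℕ) (φ : Form α) (x y : ℕ)

namespace Form

variable {α : Type} {D : Type*} (I : α → D → D → Prop)

def Sat : Form α → (ℕ → D) → Prop
  | atom a x y, e => I a (e x) (e y)
  | neg φ, e => ¬ φ.Sat e
  | and φ ψ, e => φ.Sat e ∧ ψ.Sat e
  | ex x φ, e => ∃ z, φ.Sat (Function.update e x z)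
  | tc a b φ x y, e => Relation.ReflTransGen
      (fun z w => φ.Sat (Function.update (Function.update e a z) b w)) (e x) (e y)

def or (φ ψ : Form α) : Form α := neg (and (neg φ) (neg ψ))

def imp (φ ψ : Form α) : Form α := neg (and φ (neg ψ))

def all (x : ℕ) (φ : Form α) : Form α := neg (ex x (neg φ))

@[simp] theorem sat_atom {a : α} {x y : ℕ} {e : ℕ → D} :
    (atom a x y).Sat I e ↔ I a (e x) (e y) := Iff.rfl

@[simp] theorem sat_neg {φ : Form α} {e : ℕ → D} : (neg φ).Sat I e ↔ ¬ φ.Sat I e := Iff.rfl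

@[simp] theorem sat_and {φ ψ : Form α} {e : ℕ → D} :
    (and φ ψ).Sat I e ↔ φ.Sat I e ∧ ψ.Sat I e := Iff.rfl

@[simp] theorem sat_ex {x : ℕ} {φ : Form α} {e : ℕ → D} :
    (ex x φ).Sat I e ↔ ∃ z, φ.Sat I (Function.update e x z) := Iff.rfl

theorem sat_tc {a b x y : ℕ} {φ : Form α} {e : ℕ → D} :
    (tc a b φ x y).Sat I e ↔ Relation.ReflTransGen
      (fun z w => φ.Sat I (Function.update (Function.update e a z) b w)) (e x) (e y) := Iff.rfl

@[simp] theorem sat_or {φ ψ : Form α} {e : ℕ → D} :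
    (or φ ψ).Sat I e ↔ φ.Sat I e ∨ ψ.Sat I e := by
  simp only [or, sat_neg, sat_and]; tauto

@[simp] theorem sat_imp {φ ψ : Form α} {e : ℕ → D} :
    (imp φ ψ).Sat I e ↔ (φ.Sat I e → ψ.Sat I e) := by
  simp only [imp, sat_neg, sat_and]; tauto

@[simp] theorem sat_all {x : ℕ} {φ : Form α} {e : ℕ → D} :
    (all x φ).Sat I e ↔ ∀ z, φ.Sat I (Function.update e x z) := by
  simp only [all, sat_neg, sat_ex, not_exists, not_not]

/-- All free variables are in the list `V`. -/
def inScope : Form α → List ℕ → Bool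
  | atom _ x y, V => V.elem x && V.elem y
  | neg φ, V => φ.inScope V
  | and φ ψ, V => φ.inScope V && ψ.inScope V
  | ex x φ, V => φ.inScope (x :: V)
  | tc a b φ x y, V => V.elem x && V.elem y && φ.inScope (b :: a :: V)

/-- The expression that computes the truth value of a formula. The variable `x` of the formula is
the variable `x + 3` of the expression. -/
def expr (t : α → ℕ → ℕ → Expr) : Form α → Expr
  | atom a x y => t a (x + 3) (y + 3)
  | neg φ => .ite (φ.expr t) (.const 0) (.const 1)
  | and φ ψ => .ite (φ.expr t) (ψ.expr t) (.const 0)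
  | ex x φ => .sum (x + 3) (φ.expr t)
  | tc a b φ x y => .tc (a + 3) (b + 3) (φ.expr t) (x + 3) (y + 3)

theorem reflTransGen_transport {N : ℕ} (nd : Fin N ≃ D) {E : ℕ → ℕ → Prop} {S : D → D → Prop}
    (h : ∀ z w, E (nd.symm z) (nd.symm w) ↔ S z w) (z w : D) :
    Relation.ReflTransGen (fun i j => i < N ∧ j < N ∧ E i j) (nd.symm z) (nd.symm w) ↔
      Relation.ReflTransGen S z w := by
  constructor
  · intro hr
    have key : ∀ k, Relation.ReflTransGen (fun i j => i < N ∧ j < N ∧ E i j) (nd.symm z) k →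
        ∃ w, k = nd.symm w ∧ Relation.ReflTransGen S z w := by
      intro k hk
      induction hk with
      | refl => exact ⟨z, rfl, .refl⟩
      | tail _ hst ih =>
        obtain ⟨w, rfl, hw⟩ := ih
        obtain ⟨-, hj, hE⟩ := hst
        refine ⟨nd ⟨_, hj⟩, by simp, hw.tail ((h _ _).1 ?_)⟩
        simpa using hE
    obtain ⟨w', hw, hr'⟩ := key _ hr
    have : w = w' := nd.symm.injective (Fin.ext hw)
    rwa [this]
  · intro hr
    induction hr with
    | refl => exact .refl
    | tail _ hst ih => exact ih.tail ⟨Fin.is_lt _, Fin.is_lt _, (h _ _).2 hst⟩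

/-- The shift by `3` keeps formula variables away from registers `0` and `1` and from variable `2`,
which multiplication binds. An existential quantifier becomes a sum, nonzero iff some term is. -/
theorem eval_expr {N : ℕ} {Ar : ℕ → ℕ → ℕ} (nd : Fin N ≃ D) {t : α → ℕ → ℕ → Expr}
    (ht : ∀ a x y (ρ : ℕ → ℕ) z w, 3 ≤ x → 3 ≤ y → ρ x = nd.symm z → ρ y = nd.symm w →
      ((t a x y).eval N Ar ρ ≠ 0 ↔ I a z w)) (φ : Form α) (V : List ℕ)
    (hφ : φ.inScope V = true) (ρ : ℕ → ℕ) (e : ℕ → D)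
    (hρ : ∀ x ∈ V, ρ (x + 3) = nd.symm (e x)) :
    (φ.expr t).eval N Ar ρ ≠ 0 ↔ φ.Sat I e := by
  have upd : ∀ {V : List ℕ} {ρ : ℕ → ℕ} {e : ℕ → D} (x : ℕ) (z : D),
      (∀ x ∈ V, ρ (x + 3) = nd.symm (e x)) → ∀ y ∈ x :: V,
      Function.update ρ (x + 3) (nd.symm z) (y + 3) = nd.symm (Function.update e x z y) := by
    intro V ρ e x z h y hy
    by_cases hyx : y = x
    · subst hyx; simp
    · rw [Function.update_of_ne (by omega), Function.update_of_ne hyx]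
      exact h y ((List.mem_cons.1 hy).resolve_left hyx)
  induction φ generalizing V ρ e with
  | atom a x y =>
    simp only [inScope, Bool.and_eq_true, List.elem_eq_mem, decide_eq_true_eq] at hφ
    exact ht a _ _ ρ _ _ (by omega) (by omega) (hρ x hφ.1) (hρ y hφ.2)
  | neg φ ih =>
    have h1 := ih V hφ ρ e hρ
    refine Iff.trans ?_ (not_congr h1)
    rw [expr, Expr.eval]
    split_ifs with h <;> simp_all [Expr.eval]
  | and φ ψ ihφ ihψ =>
    simp only [inScope, Bool.and_eq_true] at hφ
    have h1 := ihφ V hφ.1 ρ e hρ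
    have h2 := ihψ V hφ.2 ρ e hρ
    refine Iff.trans ?_ (and_congr h1 h2)
    rw [expr, Expr.eval]
    split_ifs with h <;> simp_all [Expr.eval]
  | ex x φ ih =>
    simp only [expr, Expr.eval, ne_eq, Finset.sum_eq_zero_iff, Finset.mem_range, not_forall,
      sat_ex]
    constructor
    · rintro ⟨i, hi, h⟩
      refine ⟨nd ⟨i, hi⟩, (ih (x :: V) hφ _ _ (upd x _ hρ)).1 ?_⟩
      simpa using h
    · rintro ⟨z, hz⟩
      exact ⟨nd.symm z, Fin.is_lt _, (ih (x :: V) hφ _ _ (upd x _ hρ)).2 hz⟩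
  | tc a b φ x y ih =>
    simp only [inScope, Bool.and_eq_true, List.elem_eq_mem, decide_eq_true_eq] at hφ
    rw [sat_tc, ← reflTransGen_transport nd (E := fun i j => (φ.expr t).eval N Ar
        (Function.update (Function.update ρ (a + 3) i) (b + 3) j) ≠ 0)
        (fun z w => ih _ hφ.2 _ _ (upd b w (upd a z hρ))),
      expr, Expr.eval, hρ x hφ.1.1, hρ y hφ.1.2]
    split_ifs with h
    · simpa using h
    · simpa using h

end Form

end RAM

namespace MALL

variable {A : Type*} {Γ : Sequent A} {L : Type*}

/-! ### The formulas that drive the algorithm -/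

/-- Names of the relations on the vertices of the conflict graph. -/
inductive Rel
  | eq | arg (b : Bool) | kind (c : Conn) | dual | conf | rel | link | cur

open RAM RAM.Form

/-- The relations; `cur` is membership in the current slicing. -/
def Links.interp (lam : Links Γ L) (bar : A → A) (C : Set (Vertex Γ ⊕ L)) :
    Rel → Vertex Γ ⊕ L → Vertex Γ ⊕ L → Prop
  | .eq, z, w => z = w
  | .arg b, .inl u, .inl v => IsArg b u v
  | .kind c, .inl u, _ => u.label = .conn c
  | .dual, .inl u, .inl v => ∃ a, u.label = .lit a ∧ v.label = .lit (bar a)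
  | .conf, .inr l, .inr m => lam.conflict.Adj l m
  | .rel, .inr l, .inl v => ∃ x : Leaf Γ, lam.rel l x ∧ x.1 = v
  | .link, .inr _, _ => True
  | .cur, z, _ => z ∈ C
  | _, _, _ => False

/-! Variable `0` is the link that is followed, `1` the root to be erased, and `2` the vertex whose
survival is decided. -/

abbrev eqF (x y : ℕ) : Form Rel := .atom .eq x y
abbrev argF (b : Bool) (x y : ℕ) : Form Rel := .atom (.arg b) x y
abbrev kindF (c : Conn) (x : ℕ) : Form Rel := .atom (.kind c) x x
abbrev dualF (x y : ℕ) : Form Rel := .atom .dual x y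
abbrev confF (x y : ℕ) : Form Rel := .atom .conf x y
abbrev relF (x y : ℕ) : Form Rel := .atom .rel x y
abbrev linkF (x : ℕ) : Form Rel := .atom .link x x
abbrev curF (x : ℕ) : Form Rel := .atom .cur x x

def adjF (x y : ℕ) : Form Rel :=
  or (or (argF false x y) (argF false y x)) (or (or (argF true x y) (argF true y x))
    (or (confF x y) (or (relF x y) (relF y x))))

/-- The names of bound variables start at `30` and are kept distinct wherever quantifiers are nested
and both variables are needed, so nothing is captured. -/
def joinF (S : ℕ → Form Rel) (x y : ℕ) : Form Rel :=
  tc 40 41 (and (adjF 40 41) (and (S 40) (S 41))) x y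

def curNeF (x : ℕ) : Form Rel := and (curF x) (neg (eqF x 1))

def inF (b : Bool) (v : ℕ) : Form Rel :=
  ex 30 (and (argF b 30 1) (tc 40 41 (or (argF false 41 40) (argF true 41 40)) 30 v))

def touchF (b : Bool) (l : ℕ) : Form Rel := ex 31 (and (relF l 31) (inF b 31))

def touchAllF (b : Bool) : Form Rel := ex 32 (and (curF 32) (touchF b 32))

def pieceF (l m : ℕ) : Form Rel :=
  tc 40 41 (and (and (neg (eqF 40 41)) (neg (confF 40 41)))
    (and (and (linkF 40) (curF 40)) (and (linkF 41) (curF 41)))) l m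

def touchPieceF (b : Bool) (l : ℕ) : Form Rel := ex 33 (and (pieceF l 33) (touchF b 33))

def xorF (φ ψ : Form Rel) : Form Rel := or (and φ (neg ψ)) (and ψ (neg φ))

def connectedF : Form Rel :=
  and (ex 34 (and (linkF 34) (curF 34)))
    (all 34 (all 35 (imp (curF 34) (imp (curF 35) (joinF curF 34 35)))))

def rootF : Form Rel :=
  and (curF 1) (neg (ex 34 (and (curF 34) (or (argF false 1 34) (argF true 1 34)))))

/-- Tensor and with also demand that both arguments are touched, to express `Erases` rather than
mere readiness. For a tensor, the absence of a cycle is replaced by the absence of a path between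
its arguments that avoids it. -/
def erasesF : Form Rel :=
  and connectedF (and rootF
    (or (and (kindF .tensor 1) (and (and (touchAllF false) (touchAllF true))
      (neg (ex 34 (ex 35 (and (argF false 34 1) (and (argF true 35 1) (joinF curNeF 34 35))))))))
    (or (kindF .par 1)
    (or (and (kindF .plus 1) (xorF (touchAllF false) (touchAllF true)))
    (and (kindF .amp 1) (and (and (touchAllF false) (touchAllF true))
      (all 34 (imp (and (linkF 34) (curF 34))
        (xorF (touchPieceF false 34) (touchPieceF true 34))))))))))

/-- Used only when the root in variable `1` may be erased. For a tensor, the result that contains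
the followed link is the component of that link. For a with, touching replaces choosing, since every
piece is then unary. -/
def nextF : Form Rel :=
  or (and (kindF .tensor 1) (joinF curNeF 0 2))
  (and (curNeF 2)
    (or (kindF .par 1)
    (or (and (kindF .plus 1) (or (and (touchAllF false) (neg (inF true 2)))
      (and (touchAllF true) (neg (inF false 2)))))
    (and (kindF .amp 1) (or
      (and (touchPieceF false 0) (and (neg (inF true 2)) (imp (linkF 2) (touchPieceF false 2))))
      (and (touchPieceF true 0)
        (and (neg (inF false 2)) (imp (linkF 2) (touchPieceF true 2)))))))))

def stepF : Form Rel := or (and erasesF nextF) (and (neg erasesF) (curF 2))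

def iffF (φ ψ : Form Rel) : Form Rel := and (imp φ ψ) (imp ψ φ)

def axiomF : Form Rel :=
  ex 34 (ex 35 (ex 36 (and (linkF 34) (and (dualF 35 36)
    (all 37 (and (iffF (curF 37) (or (eqF 37 34) (or (eqF 37 35) (eqF 37 36))))
      (iffF (relF 34 37) (or (eqF 37 35) (eqF 37 36)))))))))

/-! ### Meaning of the formulas -/

namespace Links

variable {lam : Links Γ L} {bar : A → A} {μ : Part Γ L} {C : Set (Vertex Γ ⊕ L)}
  {e : ℕ → Vertex Γ ⊕ L} {r : Vertex Γ} {i : L}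

theorem sat_adjF {x y : ℕ} :
    (adjF x y).Sat (lam.interp bar C) e ↔ lam.graph.Adj (e x) (e y) := by
  simp only [adjF, sat_or, sat_atom]
  rcases e x with u | l <;> rcases e y with v | m
  · rw [graph_adj_vertex]
    simp only [interp, or_false, Bool.exists_bool]
  · rw [graph_adj_leaf']
    simp [interp]
  · rw [graph_adj_leaf]
    simp [interp]
  · rw [graph_adj_link]
    simp [interp]

/-- The hypothesis ranges over assignments that agree below `40`, because `S` may refer to the root
in variable `1` while `40` and `41` are rebound. -/
theorem sat_joinF {S : ℕ → Form Rel} {T : Set (Vertex Γ ⊕ L)} {x y : ℕ}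
    (hS : ∀ e' : ℕ → Vertex Γ ⊕ L, (∀ k < 40, e' k = e k) → ∀ v,
      ((S v).Sat (lam.interp bar C) e' ↔ e' v ∈ T)) :
    (joinF S x y).Sat (lam.interp bar C) e ↔ Joined lam.graph T (e x) (e y) := by
  rw [joinF, sat_tc, Joined]
  have : ∀ z w, (and (adjF 40 41) (and (S 40) (S 41))).Sat (lam.interp bar C)
      (Function.update (Function.update e 40 z) 41 w) ↔ lam.graph.Adj z w ∧ z ∈ T ∧ w ∈ T := by
    intro z w
    have hk : ∀ k < 40, Function.update (Function.update e 40 z) 41 w k = e k := by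
      intro k hk
      rw [Function.update_of_ne (by omega), Function.update_of_ne (by omega)]
    rw [sat_and, sat_and, sat_adjF, hS _ hk, hS _ hk]
    simp
  simp only [this]

theorem sat_curNeF (h1 : e 1 = .inl r) {v : ℕ} :
    (curNeF v).Sat (lam.interp bar C) e ↔ e v ∈ C \ {.inl r} := by
  simp [curNeF, interp, h1]

theorem sat_joinF_cur {x y : ℕ} :
    (joinF curF x y).Sat (lam.interp bar C) e ↔ Joined lam.graph C (e x) (e y) :=
  sat_joinF fun e' _ v => by simp [interp]

theorem sat_joinF_curNe (h1 : e 1 = .inl r) {x y : ℕ} :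
    (joinF curNeF x y).Sat (lam.interp bar C) e ↔
      Joined lam.graph (C \ {.inl r}) (e x) (e y) :=
  sat_joinF fun e' he' v => sat_curNeF (by rw [he' 1 (by omega), h1])

theorem sat_inF (h1 : e 1 = .inl r) {b : Bool} {v : ℕ} (hv : v ≠ 30) :
    (inF b v).Sat (lam.interp bar C) e ↔ ∃ w, e v = .inl w ∧ InArg b w r := by
  have key : ∀ z w : Vertex Γ ⊕ L, ∀ e' : ℕ → Vertex Γ ⊕ L,
      (or (argF false 41 40) (argF true 41 40)).Sat (lam.interp bar C)
        (Function.update (Function.update e' 40 z) 41 w) ↔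
      ∃ u v, z = .inl u ∧ w = .inl v ∧ ∃ c, IsArg c v u := by
    intro z w e'
    rcases z with u | l <;> rcases w with v | m <;> simp [interp]
  simp only [inF, sat_ex, sat_and, sat_tc, key, sat_atom, Function.update_self,
    Function.update_of_ne hv, Function.update_of_ne (show (1 : ℕ) ≠ 30 by omega), h1]
  constructor
  · rintro ⟨z, hz, hd⟩
    rcases z with u | l
    · have : ∃ w, e v = .inl w ∧
          Relation.ReflTransGen (fun x y : Vertex Γ => ∃ c, IsArg c y x) u w := by
        generalize e v = y at hd
        induction hd with
        | refl => exact ⟨u, rfl, .refl⟩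
        | tail _ h ih =>
          obtain ⟨w, rfl, hw⟩ := ih
          obtain ⟨u', v', h1, rfl, h2⟩ := h
          obtain rfl := Sum.inl.inj h1
          exact ⟨v', rfl, hw.tail h2⟩
      obtain ⟨w, hw, hd'⟩ := this
      exact ⟨w, hw, inArg_iff.2 ⟨u, hz, hd'⟩⟩
    · exact hz.elim
  · rintro ⟨w, hw, hin⟩
    obtain ⟨u, hu, hd⟩ := inArg_iff.1 hin
    refine ⟨.inl u, hu, ?_⟩
    rw [hw]
    clear hin hw
    induction hd with
    | refl => exact .refl
    | tail _ h ih => exact ih.tail ⟨_, _, rfl, rfl, h⟩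

theorem sat_touchF (h1 : e 1 = .inl r) {b : Bool} {l : ℕ} (hl : l ≠ 31) :
    (touchF b l).Sat (lam.interp bar C) e ↔ ∃ m, e l = .inr m ∧ lam.Touches {m} r b := by
  simp only [touchF, sat_ex, sat_and]
  constructor
  · rintro ⟨z, hz, hin⟩
    rw [sat_inF (r := r) (by simpa using h1) (by omega)] at hin
    obtain ⟨w, hw, hin⟩ := hin
    simp only [sat_atom, Function.update_self, Function.update_of_ne hl] at hz hw
    subst hw
    revert hz
    rcases e l with u | m
    · exact fun h => h.elim
    · rintro ⟨x, hx, rfl⟩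
      exact ⟨m, rfl, m, rfl, x, hx, hin⟩
  · rintro ⟨m, hm, _, rfl, x, hx, hin⟩
    refine ⟨.inl x.1, ?_, ?_⟩
    · simp only [sat_atom, Function.update_self, Function.update_of_ne hl, hm]
      exact ⟨x, hx, rfl⟩
    · rw [sat_inF (r := r) (by simpa using h1) (by omega)]
      exact ⟨x.1, by simp, hin⟩

theorem sat_touchAllF (h1 : e 1 = .inl r) {b : Bool} :
    (touchAllF b).Sat (lam.interp bar μ.carrier) e ↔ lam.Touches μ.links r b := by
  simp only [touchAllF, sat_ex, sat_and]
  constructor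
  · rintro ⟨z, hz, ht⟩
    rw [sat_touchF (r := r) (by simpa using h1) (by omega)] at ht
    obtain ⟨m, hm, _, rfl, ht⟩ := ht
    simp only [sat_atom, Function.update_self] at hz hm
    subst hm
    exact ⟨_, hz, ht⟩
  · rintro ⟨m, hm, ht⟩
    refine ⟨.inr m, ?_, ?_⟩
    · simp only [sat_atom, Function.update_self]
      exact hm
    · rw [sat_touchF (r := r) (by simpa using h1) (by omega)]
      exact ⟨m, by simp, m, rfl, ht⟩

theorem sat_pieceF {l m : ℕ} (hl : e l = .inr i) :
    (pieceF l m).Sat (lam.interp bar μ.carrier) e ↔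
      ∃ j, e m = .inr j ∧ j ∈ lam.pieceOf μ.links i := by
  have key : ∀ z w : Vertex Γ ⊕ L, ∀ e' : ℕ → Vertex Γ ⊕ L,
      (and (and (neg (eqF 40 41)) (neg (confF 40 41)))
        (and (and (linkF 40) (curF 40)) (and (linkF 41) (curF 41)))).Sat
          (lam.interp bar μ.carrier) (Function.update (Function.update e' 40 z) 41 w) ↔
      ∃ i j, z = .inr i ∧ w = .inr j ∧ lam.conflictᶜ.Adj i j ∧ i ∈ μ.links ∧ j ∈ μ.links := by
    intro z w e'
    rcases z with u | l <;> rcases w with v | m <;> simp [interp, SimpleGraph.compl_adj]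
  simp only [pieceF, sat_tc, key, hl]
  constructor
  · generalize e m = y
    intro hd
    induction hd with
    | refl => exact ⟨i, rfl, mem_pieceOf_self⟩
    | tail _ h ih =>
      obtain ⟨j, rfl, hj⟩ := ih
      obtain ⟨i', j', h1, rfl, h2⟩ := h
      obtain rfl := Sum.inr.inj h1
      exact ⟨j', rfl, Relation.ReflTransGen.tail hj h2⟩
  · rintro ⟨j, hj, hd⟩
    rw [hj]
    clear hj
    induction hd with
    | refl => exact .refl
    | tail _ h ih => exact ih.tail ⟨_, _, rfl, rfl, h⟩

theorem sat_touchPieceF (h1 : e 1 = .inl r) {b : Bool} {l : ℕ} (hl' : l ≠ 33)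
    (hl : e l = .inr i) :
    (touchPieceF b l).Sat (lam.interp bar μ.carrier) e ↔
      lam.Touches (lam.pieceOf μ.links i) r b := by
  simp only [touchPieceF, sat_ex, sat_and]
  have hp : ∀ z, (pieceF l 33).Sat (lam.interp bar μ.carrier) (Function.update e 33 z) ↔
      ∃ j, z = .inr j ∧ j ∈ lam.pieceOf μ.links i := by
    intro z
    rw [sat_pieceF (i := i) (by rw [Function.update_of_ne hl', hl])]
    simp
  have ht : ∀ z, (touchF b 33).Sat (lam.interp bar μ.carrier) (Function.update e 33 z) ↔
      ∃ j, z = .inr j ∧ lam.Touches {j} r b := by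
    intro z
    rw [sat_touchF (r := r) (by simpa using h1) (by omega)]
    simp
  simp only [hp, ht]
  constructor
  · rintro ⟨_, ⟨j, rfl, hj⟩, j', h, _, rfl, ht⟩
    obtain rfl := Sum.inr.inj h
    exact ⟨j, hj, ht⟩
  · rintro ⟨j, hj, ht⟩
    exact ⟨.inr j, ⟨j, rfl, hj⟩, j, rfl, j, rfl, ht⟩

theorem sat_connectedF :
    connectedF.Sat (lam.interp bar μ.carrier) e ↔ lam.ConnectedPart μ := by
  simp only [connectedF, sat_and, sat_ex, sat_all, sat_imp, sat_joinF_cur, sat_atom,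
    Function.update_self, connectedPart_iff, ne_eq, Nat.reduceEqDiff,
    not_false_eq_true, Function.update_of_ne]
  refine and_congr ⟨?_, ?_⟩ ⟨fun h x hx y hy => h x y hx hy, fun h x y hx hy => h x hx y hy⟩
  · rintro ⟨z | l, hz, hz'⟩
    · exact hz.elim
    · exact ⟨l, hz'⟩
  · rintro ⟨l, hl⟩
    exact ⟨.inr l, trivial, hl⟩

theorem sat_rootF (h1 : e 1 = .inl r) :
    rootF.Sat (lam.interp bar μ.carrier) e ↔ IsRoot μ r := by
  simp only [rootF, sat_and, sat_ex, sat_neg, sat_or, sat_atom,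
    Function.update_self, ne_eq, OfNat.one_ne_ofNat,
    not_false_eq_true, Function.update_of_ne, h1, IsRoot]
  refine and_congr Iff.rfl ?_
  constructor
  · intro h u hu b hb
    refine h ⟨.inl u, hu, ?_⟩
    cases b
    · exact Or.inl hb
    · exact Or.inr hb
  · rintro h ⟨u | l, hu, hb⟩
    · rcases hb with hb | hb
      · exact h u hu _ hb
      · exact h u hu _ hb
    · rcases hb with hb | hb <;> exact hb

theorem sat_xorF {φ ψ : Form Rel} : (xorF φ ψ).Sat (lam.interp bar C) e ↔
    (φ.Sat (lam.interp bar C) e ∧ ¬ ψ.Sat (lam.interp bar C) e) ∨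
      (ψ.Sat (lam.interp bar C) e ∧ ¬ φ.Sat (lam.interp bar C) e) := by
  simp only [xorF, sat_or, sat_and, sat_neg]

theorem unary_iff {K : Set L} : lam.Unary K r ↔
    (lam.Touches K r false ∧ ¬ lam.Touches K r true) ∨
      (lam.Touches K r true ∧ ¬ lam.Touches K r false) := by
  simp [Unary, Chooses]

theorem sat_erasesF (hμ : μ.Closed) (h1 : e 1 = .inl r) :
    erasesF.Sat (lam.interp bar μ.carrier) e ↔ lam.Erases μ r := by
  have hT : ∀ b, (touchAllF b).Sat (lam.interp bar μ.carrier) e ↔ lam.Touches μ.links r b :=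
    fun b => sat_touchAllF h1
  have hK : ∀ c, (kindF c 1).Sat (lam.interp bar μ.carrier) e ↔ r.label = .conn c := by
    intro c; simp [interp, h1]
  have hten : (ex 34 (ex 35 (and (argF false 34 1) (and (argF true 35 1)
      (joinF curNeF 34 35))))).Sat (lam.interp bar μ.carrier) e ↔ ∃ u v, IsArg false u r ∧
        IsArg true v r ∧ Joined lam.graph (μ.carrier \ {.inl r}) (.inl u) (.inl v) := by
    simp only [sat_ex, sat_and]
    have hj : ∀ z w, (joinF curNeF 34 35).Sat (lam.interp bar μ.carrier)
        (Function.update (Function.update e 34 z) 35 w) ↔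
        Joined lam.graph (μ.carrier \ {.inl r}) z w := by
      intro z w
      rw [sat_joinF_curNe (r := r) (by simpa using h1)]
      simp
    simp only [hj, sat_atom, Function.update_self, ne_eq, Nat.reduceEqDiff, OfNat.one_ne_ofNat,
      not_false_eq_true, Function.update_of_ne, h1]
    constructor
    · rintro ⟨u | l, v | m, hu, hv, h⟩
      · exact ⟨u, v, hu, hv, h⟩
      · exact hv.elim
      · exact hu.elim
      · exact hu.elim
    · rintro ⟨u, v, hu, hv, h⟩
      exact ⟨.inl u, .inl v, hu, hv, h⟩
  have hamp : (all 34 (imp (and (linkF 34) (curF 34))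
        (xorF (touchPieceF false 34) (touchPieceF true 34)))).Sat (lam.interp bar μ.carrier) e ↔
      ∀ K, lam.IsPiece μ K → lam.Unary K r := by
    simp only [sat_all, sat_imp, sat_and, sat_xorF]
    have htp : ∀ i b, (touchPieceF b 34).Sat (lam.interp bar μ.carrier)
        (Function.update e 34 (.inr i)) ↔ lam.Touches (lam.pieceOf μ.links i) r b := fun i b =>
      sat_touchPieceF (by simpa using h1) (by omega) (by simp)
    constructor
    · intro h K hK
      obtain ⟨i, hi, rfl⟩ := isPiece_iff.1 hK
      have := h (.inr i) (by simp [interp, hi])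
      rwa [htp, htp, ← unary_iff] at this
    · rintro h (u | i) ⟨hz, hz'⟩
      · simp [interp] at hz
      · rw [htp, htp, ← unary_iff]
        refine h _ (isPiece_iff.2 ⟨i, ?_, rfl⟩)
        simpa [interp] using hz'
  rw [erasesF]
  simp only [sat_and, sat_or, sat_xorF, hT, hK, hamp, sat_connectedF, sat_rootF h1, ← unary_iff]
  rw [sat_neg, hten, Erases, Full, Ready]
  cases hl : r.label with
  | lit a => simp
  | conn k =>
    cases k with
    | tensor =>
      have h2 : ∀ hr : IsRoot μ r, lam.ConnectedPart μ →
          ((¬ ∃ w : (restrict lam.graph μ.carrier).Walk (.inl r) (.inl r), w.IsCycle) ↔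
          ¬ ∃ u v, IsArg false u r ∧ IsArg true v r ∧
            Joined lam.graph (μ.carrier \ {.inl r}) (.inl u) (.inl v)) := by
        intro hr hc
        have := tensor_ready_iff hμ hr hl (lam := lam)
        rw [Ready, hl] at this
        simp only [hc, hr, true_and] at this
        rw [this]
        push Not
        rfl
      simp only [reduceCtorEq, true_and, false_and, or_false,
        forall_const, Bool.forall_bool, Label.conn.injEq]
      constructor
      · rintro ⟨hc, hr, ht, h⟩
        exact ⟨⟨hc, hr, (h2 hr hc).2 h⟩, ht⟩
      · rintro ⟨⟨hc, hr, h⟩, ht⟩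
        exact ⟨hc, hr, ht, (h2 hr hc).1 h⟩
    | par => simp
    | plus => simp [and_assoc]
    | amp =>
      simp only [reduceCtorEq, true_and, false_and, false_or, or_true,
        forall_const, Bool.forall_bool, Label.conn.injEq]
      tauto

theorem sat_stepF (hμ : μ.Closed) (h0 : e 0 = .inr i) (hi : i ∈ μ.links) :
    stepF.Sat (lam.interp bar μ.carrier) e ↔ e 2 ∈ (lam.next i (e 1) μ).carrier := by
  have hcur : (curF 2).Sat (lam.interp bar μ.carrier) e ↔ e 2 ∈ μ.carrier := by
    simp [interp]
  rw [stepF, sat_or, sat_and, sat_and, sat_neg, hcur]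
  rcases h1 : e 1 with r | m
  swap
  · have hno : ¬ erasesF.Sat (lam.interp bar μ.carrier) e := by
      simp [erasesF, interp, h1]
    rw [next_of_not (by simp)]
    simp [hno]
  rw [sat_erasesF hμ h1]
  rcases next_cases (lam := lam) hμ hi (.inl r) with ⟨hno, he⟩ | ⟨r', hr', hr, hν, hi'⟩
  · rw [he]
    simp [hno r rfl]
  obtain rfl := Sum.inl.inj hr'
  simp only [hr, true_and, not_true_eq_false, false_and, or_false]
  set ν := lam.next i (.inl r) μ with hνdef
  clear_value ν
  have hT : ∀ b, (touchAllF b).Sat (lam.interp bar μ.carrier) e ↔ lam.Touches μ.links r b :=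
    fun b => sat_touchAllF h1
  have hK : ∀ c, (kindF c 1).Sat (lam.interp bar μ.carrier) e ↔ r.label = .conn c := by
    intro c; simp [interp, h1]
  have hin : ∀ b, (inF b 2).Sat (lam.interp bar μ.carrier) e ↔ ∃ w, e 2 = .inl w ∧ InArg b w r :=
    fun b => sat_inF h1 (by omega)
  rw [nextF]
  simp only [sat_and, sat_or, sat_neg, sat_imp, hK, hT, hin, sat_curNeF h1, sat_joinF_curNe h1, h0]
  rcases hr.1.cases with h | h | ⟨o, h⟩
  · obtain ⟨b, rfl⟩ := (mem_erase_tensor h).1 hν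
    obtain ⟨u, hu⟩ := exists_isArg h b
    have hi2 : Sum.inr i ∈ (lam.tensorPart μ r b).carrier := hi'
    rw [mem_tensorPart_carrier_of_isArg hu] at hi2 ⊢
    simp only [h, true_and, Label.conn.injEq, reduceCtorEq, false_and, or_false, and_false]
    -- The component was defined from the root of `A_b`; it contains `i`, so it can equally be
    -- described from `i`.
    exact ⟨fun h => hi2.trans h, fun h => hi2.symm.trans h⟩
  · obtain ⟨b, rfl⟩ := (mem_erase_amp h).1 hν
    have htp : ∀ b, (touchPieceF b 0).Sat (lam.interp bar μ.carrier) e ↔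
        lam.Touches (lam.pieceOf μ.links i) r b := fun b => sat_touchPieceF h1 (by omega) h0
    have hib := (mem_ampPart_links.1 hi').2
    have hself : ∀ c, lam.Touches (lam.pieceOf μ.links i) r c ↔ c = b := by
      intro c
      refine ⟨fun h => ?_, fun h => h ▸ hib.1⟩
      by_contra hcb
      rw [eq_not_of_ne hcb] at h
      exact hib.2 h
    -- By `hself`, the piece of `i` selects the side `b`, which decides between the two alternatives
    -- of the formula.
    simp only [h, true_and, Label.conn.injEq, reduceCtorEq, false_and, false_or, htp,
      hself]
    rcases h2 : e 2 with v | m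
    · have hl : ¬ (linkF 2).Sat (lam.interp bar μ.carrier) e := by simp [interp, h2]
      have : Sum.inl v ∈ (lam.ampPart μ r b).carrier ↔ (v ∈ μ.verts ∧ v ≠ r) ∧ ¬ InArg (!b) v r := by
        rw [ampPart_eq, ← chooseVerts_eq]
        exact and_assoc.symm
      rw [this]
      cases b <;> simp [hl]
    · have hl : (linkF 2).Sat (lam.interp bar μ.carrier) e := by simp [interp, h2]
      have htm : ∀ b, (touchPieceF b 2).Sat (lam.interp bar μ.carrier) e ↔
          lam.Touches (lam.pieceOf μ.links m) r b := fun b => sat_touchPieceF h1 (by omega) h2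
      have : Sum.inr m ∈ (lam.ampPart μ r b).carrier ↔
          m ∈ μ.links ∧ lam.Touches (lam.pieceOf μ.links m) r b := by
        refine mem_ampPart_links.trans (and_congr_right fun hm => ⟨fun h => h.1, fun ht => ?_⟩)
        obtain ⟨c, hc⟩ := hr.1.amp h hm
        by_cases hcb : c = b
        · exact hcb ▸ hc
        · rw [eq_not_of_ne hcb] at hc
          exact absurd ht (by simpa using hc.2)
      rw [this]
      cases b <;> simp [hl, htm]
  · rw [h.erase] at hν
    obtain rfl := hν
    rcases h with ⟨hk, rfl⟩ | ⟨hk, b, rfl, hb⟩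
    · simp only [hk, Label.conn.injEq, reduceCtorEq, false_and, or_false, false_or, and_true]
      rcases e 2 with v | m <;> simp [deleted]
    · have hself : ∀ c, lam.Touches μ.links r c ↔ c = b := by
        intro c
        refine ⟨fun h => ?_, fun h => h ▸ hb.1⟩
        by_contra hcb
        rw [eq_not_of_ne hcb] at h
        exact hb.2 h
      simp only [hk, Label.conn.injEq, reduceCtorEq, false_and, or_false, false_or, true_and, hself]
      rcases e 2 with v | m
      · cases b <;> simp [deleted, and_assoc]
      · cases b <;> simp

theorem sat_axiomF : axiomF.Sat (lam.interp bar μ.carrier) e ↔ lam.IsAxiomPart bar μ := by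
  simp only [axiomF, iffF, sat_ex, sat_and, sat_all, sat_imp, sat_or, sat_atom,
    Function.update_self, ne_eq, Nat.reduceEqDiff, not_false_eq_true, Function.update_of_ne,
    ← iff_def]
  constructor
  · rintro ⟨u | l, x, y, hl, hxy, hz⟩
    · exact hl.elim
    rcases x with x | x
    swap
    · exact hxy.elim
    rcases y with y | y
    swap
    · exact hxy.elim
    obtain ⟨a, hx, hy⟩ := hxy
    refine ⟨l, ⟨x, a, hx⟩, ⟨y, _, hy⟩, ⟨a, hx, hy⟩, ?_, ?_, fun z => ?_⟩
    · ext m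
      have := (hz (.inr m)).1
      simpa [interp] using this
    · ext v
      have := (hz (.inl v)).1
      simpa [interp] using this
    · have := (hz (.inl z.1)).2
      simp only [interp, Sum.inl.injEq] at this
      have hw : ∀ (w : Vertex Γ) hw, z = ⟨w, hw⟩ ↔ z.1 = w := fun _ _ => Subtype.ext_iff
      rw [hw, hw, ← this]
      constructor
      · intro h; exact ⟨z, h, rfl⟩
      · rintro ⟨x', h, h'⟩; exact Subtype.ext h' ▸ h
  · rintro ⟨l, x, y, ⟨a, hx, hy⟩, hl, hv, hrel⟩
    refine ⟨.inr l, .inl x.1, .inl y.1, trivial, ⟨a, hx, hy⟩, ?_⟩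
    rintro (v | m)
    · simp only [interp, Part.inl_mem_carrier, hv, reduceCtorEq, false_or, Sum.inl.injEq,
        Set.mem_insert_iff, Set.mem_singleton_iff, true_and]
      constructor
      · rintro ⟨z, hz, rfl⟩
        rcases (hrel z).1 hz with rfl | rfl
        · exact Or.inl rfl
        · exact Or.inr rfl
      · rintro (rfl | rfl)
        · exact ⟨x, (hrel x).2 (Or.inl rfl), rfl⟩
        · exact ⟨y, (hrel y).2 (Or.inr rfl), rfl⟩
    · simp [interp, hl]

end Links

end MALL

namespace RAM.Expr

/-! ### Tests on the input tables -/

def conj (e f : Expr) : Expr := ite e f (const 0)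

def eqv (e f : Expr) : Expr := ite (add (sub e f) (sub f e)) (const 0) (const 1)

/-- The product of `e` and `f`, if `e` is at most the size of the domain. -/
def mul (e f : Expr) : Expr := sum 2 (ite (sub e (var 2)) f (const 0))

theorem eval_ite {N : ℕ} {B : ℕ → ℕ → ℕ} {c e f : Expr} {ρ : ℕ → ℕ} :
    (ite c e f).eval N B ρ ≠ 0 ↔ (c.eval N B ρ ≠ 0 ∧ e.eval N B ρ ≠ 0) ∨
      (c.eval N B ρ = 0 ∧ f.eval N B ρ ≠ 0) := by
  by_cases h : c.eval N B ρ = 0 <;> simp [eval, h]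

theorem eval_conj {N : ℕ} {B : ℕ → ℕ → ℕ} {e f : Expr} {ρ : ℕ → ℕ} :
    (conj e f).eval N B ρ ≠ 0 ↔ e.eval N B ρ ≠ 0 ∧ f.eval N B ρ ≠ 0 := by
  simp only [conj, eval]
  split_ifs with h <;> simp [h]

theorem eval_eqv {N : ℕ} {B : ℕ → ℕ → ℕ} {e f : Expr} {ρ : ℕ → ℕ} :
    (eqv e f).eval N B ρ ≠ 0 ↔ e.eval N B ρ = f.eval N B ρ := by
  simp [eqv, eval]
  omega

/-- The value `n` is added once for every `i < m`. Variable `2` is bound by the sum, so neither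
factor may depend on it. -/
theorem eval_mul {N m n : ℕ} {B : ℕ → ℕ → ℕ} {e f : Expr} {ρ : ℕ → ℕ}
    (he : ∀ i, e.eval N B (Function.update ρ 2 i) = m)
    (hf : ∀ i, f.eval N B (Function.update ρ 2 i) = n) (hm : m ≤ N) :
    (mul e f).eval N B ρ = m * n := by
  simp only [mul, eval, he, hf, Function.update_self]
  rw [← Finset.sum_filter, Finset.sum_const, smul_eq_mul]
  congr 1
  have : (Finset.range N).filter (fun i => m - i ≠ 0) = Finset.range m := by
    ext i; simp only [Finset.mem_filter, Finset.mem_range]; omega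
  rw [this, Finset.card_range]

end RAM.Expr

/-! ### Decoding the input tables -/

namespace MALL

open RAM

variable {A : Type*} {Γ : Sequent A} {L : Type*}

def Conn.code : Conn → ℕ
  | .tensor => 1
  | .par => 2
  | .amp => 3
  | .plus => 4

theorem Label.code_eq_iff {k : Label A} {c : Conn} : k.code = c.code ↔ k = .conn c := by
  rcases k with a | d
  · cases c <;> simp [Label.code, Conn.code]
  · cases c <;> cases d <;> simp [Label.code, Conn.code]

/-- Equality is tested before duality; since no literal is its own dual, code `1` never hides a dual
pair. -/
theorem Label.compare_eq_two_iff {bar : A → A} (hb : ∀ a, bar a ≠ a) {j k : Label A} :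
    j.compare bar k = 2 ↔ ∃ a, j = .lit a ∧ k = .lit (bar a) := by
  rcases j with a | c <;> rcases k with b | d <;> simp only [Label.compare, reduceCtorEq,
    false_and, and_false, exists_false, Label.lit.injEq]
  · split_ifs with h1 h2
    · simp only [OfNat.one_ne_ofNat, false_iff]
      rintro ⟨a', rfl, rfl⟩
      exact hb _ h1.symm
    · simp [h2]
    · simp only [false_iff]
      rintro ⟨a', rfl, rfl⟩
      exact h2 rfl

theorem getD_table {n m : ℕ} (f : Fin n → Fin m → ℕ) (i : Fin n) (j : Fin m) :
    (table n m f).getD (i * m + j) 0 = f i j := by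
  have h : (i : ℕ) * m + j < n * m := by
    calc (i : ℕ) * m + j < i * m + m := by have := j.2; omega
      _ = (i + 1) * m := by ring
      _ ≤ n * m := Nat.mul_le_mul_right m i.2
  have hm : 0 < m := j.pos
  rw [table, List.getD_eq_getElem _ _ (by simpa using h), List.getElem_ofFn]
  congr 1
  · apply Fin.ext
    simp [Fin.divNat, Nat.add_comm _ (j : ℕ), Nat.add_mul_div_right _ _ hm, Nat.div_eq_of_lt j.2]
  · apply Fin.ext
    simp [Fin.modNat, Nat.mod_eq_of_lt j.2]

/-- The vertices of the conflict graph, enumerated. -/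
def nodes {g l : ℕ} (eV : Fin g ≃ Vertex Γ) (eL : Fin l ≃ L) : Fin (g + l) ≃ Vertex Γ ⊕ L :=
  finSumFinEquiv.symm.trans (Equiv.sumCongr eV eL)

section

variable {g l : ℕ} {eV : Fin g ≃ Vertex Γ} {eL : Fin l ≃ L}

theorem nodes_symm_inl (v : Vertex Γ) : ((nodes eV eL).symm (.inl v) : ℕ) = eV.symm v := by
  simp [nodes]

theorem nodes_symm_inr (m : L) : ((nodes eV eL).symm (.inr m) : ℕ) = g + eL.symm m := by
  simp [nodes]

end

open Classical in
/-- The arrays below `6` hold the input. -/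
structure Presents (lam : Links Γ L) (bar : A → A) {g l : ℕ} (eV : Fin g ≃ Vertex Γ)
    (eL : Fin l ≃ L) (B : ℕ → ℕ → ℕ) : Prop where
  card_verts : B 0 0 = g
  card_links : B 0 1 = l
  kind (v) : B 1 (eV.symm v) = v.label.code
  arg (u v) : B 2 (eV.symm u * g + eV.symm v) =
    if IsArg false u v then 1 else if IsArg true u v then 2 else 0
  dual (u v) : B 3 (eV.symm u * g + eV.symm v) = u.label.compare bar v.label
  conf (i j) : B 4 (eL.symm i * l + eL.symm j) = if lam.conflict.Adj i j then 1 else 0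
  rel (i v) : B 5 (eL.symm i * g + eV.symm v) = if ∃ x : Leaf Γ, lam.rel i x ∧ x.1 = v then 1 else 0

open Classical in
theorem presents_init (lam : Links Γ L) (bar : A → A) {g l : ℕ} (eV : Fin g ≃ Vertex Γ)
    (eL : Fin l ≃ L) : Presents lam bar eV eL (State.init (lam.encode bar eV eL)).arr where
  card_verts := rfl
  card_links := rfl
  kind v := by
    change (List.ofFn _).getD _ _ = _
    rw [List.getD_eq_getElem _ _ (by simp), List.getElem_ofFn]
    simp
  arg u v := by
    refine (getD_table (fun u v => if IsArg false (eV u) (eV v) then 1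
      else if IsArg true (eV u) (eV v) then 2 else 0) _ _).trans ?_
    simp
  dual u v := by
    refine (getD_table (fun u v => Label.compare bar (eV u).label (eV v).label) _ _).trans ?_
    simp
  conf u v := by
    refine (getD_table (fun i j => if lam.conflict.Adj (eL i) (eL j) then 1 else 0) _ _).trans ?_
    simp
  rel u v := by
    refine (getD_table (fun i v => if ∃ x : Leaf Γ, lam.rel (eL i) x ∧ x.1 = eV v then 1 else 0) _ _).trans ?_
    simp

theorem Presents.congr {lam : Links Γ L} {bar : A → A} {g l : ℕ} {eV : Fin g ≃ Vertex Γ}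
    {eL : Fin l ≃ L} {B B' : ℕ → ℕ → ℕ} (h : Presents lam bar eV eL B)
    (hB : ∀ a < 6, B' a = B a) : Presents lam bar eV eL B' where
  card_verts := by rw [hB 0 (by omega)]; exact h.card_verts
  card_links := by rw [hB 0 (by omega)]; exact h.card_links
  kind v := by rw [hB 1 (by omega)]; exact h.kind v
  arg u v := by rw [hB 2 (by omega)]; exact h.arg u v
  dual u v := by rw [hB 3 (by omega)]; exact h.dual u v
  conf i j := by rw [hB 4 (by omega)]; exact h.conf i j
  rel i v := by rw [hB 5 (by omega)]; exact h.rel i v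

open Expr in
/-- Tests for the relations. Array `6` holds the characteristic function of the current slicing. -/
def Rel.test : Rel → ℕ → ℕ → Expr
  | .eq, x, y => eqv (var x) (var y)
  | .arg b, x, y => conj (sub (rd 0 (const 0)) (var x)) (conj (sub (rd 0 (const 0)) (var y))
      (eqv (rd 2 (add (mul (var x) (rd 0 (const 0))) (var y))) (const (if b then 2 else 1))))
  | .kind c, x, _ => conj (sub (rd 0 (const 0)) (var x)) (eqv (rd 1 (var x)) (const c.code))
  | .dual, x, y => conj (sub (rd 0 (const 0)) (var x)) (conj (sub (rd 0 (const 0)) (var y))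
      (eqv (rd 3 (add (mul (var x) (rd 0 (const 0))) (var y))) (const 2)))
  | .conf, x, y => ite (sub (rd 0 (const 0)) (var x)) (const 0)
      (ite (sub (rd 0 (const 0)) (var y)) (const 0)
        (rd 4 (add (mul (sub (var x) (rd 0 (const 0))) (rd 0 (const 1)))
          (sub (var y) (rd 0 (const 0))))))
  | .rel, x, y => ite (sub (rd 0 (const 0)) (var x)) (const 0)
      (conj (sub (rd 0 (const 0)) (var y))
        (rd 5 (add (mul (sub (var x) (rd 0 (const 0))) (rd 0 (const 0))) (var y))))
  | .link, x, _ => ite (sub (rd 0 (const 0)) (var x)) (const 0) (const 1)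
  | .cur, x, _ => rd 6 (var x)

section

variable {lam : Links Γ L} {bar : A → A} {g l : ℕ} {eV : Fin g ≃ Vertex Γ} {eL : Fin l ≃ L}
  {B : ℕ → ℕ → ℕ}

open Expr in
-- Forest vertices have numbers below `g`, and links follow from `g` on. So each test on the tables
-- first determines the sorts by truncated subtraction and then looks up a row-by-row address.
theorem Rel.eval_test (hb : ∀ a, bar a ≠ a) (hB : Presents lam bar eV eL B)
    {C : Set (Vertex Γ ⊕ L)} (hC : ∀ z, B 6 ((nodes eV eL).symm z) ≠ 0 ↔ z ∈ C) (a : Rel)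
    (x y : ℕ) (ρ : ℕ → ℕ) (z w : Vertex Γ ⊕ L) (hx : 3 ≤ x) (hy : 3 ≤ y)
    (hz : ρ x = (nodes eV eL).symm z) (hw : ρ y = (nodes eV eL).symm w) :
    (a.test x y).eval (g + l) B ρ ≠ 0 ↔ lam.interp bar C a z w := by
  have hx2 : x ≠ 2 := by omega
  have hy2 : y ≠ 2 := by omega
  have inl : ∀ v : Vertex Γ, g - (eV.symm v : ℕ) ≠ 0 := fun v => by
    have := (eV.symm v).2
    omega
  have inl_le : ∀ v : Vertex Γ, (eV.symm v : ℕ) ≤ g + l := fun v => by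
    have := (eV.symm v).2
    omega
  have inr_le : ∀ m : L, (eL.symm m : ℕ) ≤ g + l := fun m => by
    have := (eL.symm m).2
    omega
  cases a with
  | eq =>
    rw [Rel.test, eval_eqv]
    simp only [eval, hz, hw, Links.interp, Fin.val_inj, EmbeddingLike.apply_eq_iff_eq]
  | cur => simp only [Rel.test, eval, hz, Links.interp, hC]
  | link =>
    rcases z with v | m
    · rw [nodes_symm_inl] at hz
      simp [Rel.test, eval, hz, hB.card_verts, Links.interp, inl v]
    · rw [nodes_symm_inr] at hz
      simp [Rel.test, eval, hz, hB.card_verts, Links.interp]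
  | kind c =>
    rw [Rel.test, eval_conj, eval_eqv]
    rcases z with v | m
    · rw [nodes_symm_inl] at hz
      simp only [eval, hz, hB.card_verts, Links.interp, hB.kind, Label.code_eq_iff]
      exact and_iff_right (inl v)
    · rw [nodes_symm_inr] at hz
      simp [eval, hz, hB.card_verts, Links.interp]
  | arg b =>
    rw [Rel.test, eval_conj, eval_conj, eval_eqv]
    rcases z with u | m
    · rw [nodes_symm_inl] at hz
      rcases w with v | m
      · rw [nodes_symm_inl] at hw
        have h1 := eval_mul (N := g + l) (B := B) (e := var x) (f := rd 0 (const 0)) (ρ := ρ)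
          (m := eV.symm u) (n := g) (fun i => by simp [eval, hx2, hz])
          (fun i => by simp [eval, hB.card_verts]) (inl_le u)
        simp only [eval, h1, hz, hw, hB.card_verts, Links.interp, hB.arg]
        rw [and_iff_right (inl u), and_iff_right (inl v)]
        cases b
        · split_ifs <;> simp_all
        · have hne : IsArg false u v → ¬ IsArg true u v := fun h h' => by
            have := h.symm.trans h'
            simp at this
          by_cases h : IsArg false u v
          · simp [h, hne h]
          · by_cases h' : IsArg true u v <;> simp [h, h']
      · rw [nodes_symm_inr] at hw
        simp [eval, hw, hB.card_verts, Links.interp]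
    · rw [nodes_symm_inr] at hz
      simp [eval, hz, hB.card_verts, Links.interp]
  | dual =>
    rw [Rel.test, eval_conj, eval_conj, eval_eqv]
    rcases z with u | m
    · rw [nodes_symm_inl] at hz
      rcases w with v | m
      · rw [nodes_symm_inl] at hw
        have h1 := eval_mul (N := g + l) (B := B) (e := var x) (f := rd 0 (const 0)) (ρ := ρ)
          (m := eV.symm u) (n := g) (fun i => by simp [eval, hx2, hz])
          (fun i => by simp [eval, hB.card_verts]) (inl_le u)
        simp only [eval, h1, hz, hw, hB.card_verts, Links.interp, hB.dual]
        rw [and_iff_right (inl u), and_iff_right (inl v), Label.compare_eq_two_iff hb]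
      · rw [nodes_symm_inr] at hw
        simp [eval, hw, hB.card_verts, Links.interp]
    · rw [nodes_symm_inr] at hz
      simp [eval, hz, hB.card_verts, Links.interp]
  | conf =>
    rcases z with u | m
    · rw [nodes_symm_inl] at hz
      simp [Rel.test, eval, hz, hB.card_verts, Links.interp, inl u]
    · rw [nodes_symm_inr] at hz
      rcases w with v | m'
      · rw [nodes_symm_inl] at hw
        simp [Rel.test, eval, hz, hw, hB.card_verts, Links.interp, inl v]
      · rw [nodes_symm_inr] at hw
        have h1 := eval_mul (N := g + l) (B := B) (e := sub (var x) (rd 0 (const 0)))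
          (f := rd 0 (const 1)) (ρ := ρ) (m := eL.symm m) (n := l)
          (fun i => by simp [eval, hx2, hz, hB.card_verts])
          (fun i => by simp [eval, hB.card_links]) (inr_le m)
        simp [Rel.test, eval, h1, hz, hw, hB.card_verts, Links.interp, hB.conf]
  | rel =>
    rcases z with u | m
    · rw [nodes_symm_inl] at hz
      simp [Rel.test, eval, hz, hB.card_verts, Links.interp, inl u]
    · rw [nodes_symm_inr] at hz
      rcases w with v | m'
      · rw [nodes_symm_inl] at hw
        have h1 := eval_mul (N := g + l) (B := B) (e := sub (var x) (rd 0 (const 0)))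
          (f := rd 0 (const 0)) (ρ := ρ) (m := eL.symm m) (n := g)
          (fun i => by simp [eval, hx2, hz, hB.card_verts])
          (fun i => by simp [eval, hB.card_verts]) (inr_le m)
        have h2 := hB.rel m v
        by_cases hP : ∃ x : Leaf Γ, lam.rel m x ∧ x.1 = v
        · have hI : lam.interp bar C .rel (.inr m) (.inl v) := hP
          rw [if_pos hP] at h2
          simp [Rel.test, conj, eval, h1, hz, hw, hB.card_verts, h2, inl v, hI]
        · have hI : ¬ lam.interp bar C .rel (.inr m) (.inl v) := hP
          rw [if_neg hP] at h2
          simp [Rel.test, conj, eval, h1, hz, hw, hB.card_verts, h2, hI]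
      · rw [nodes_symm_inr] at hw
        simp [Rel.test, conj, eval, hz, hw, hB.card_verts, Links.interp]

end

end MALL

namespace MALL

open RAM

variable {A : Type*} {Γ : Sequent A} {L : Type*}

/-! ### The program -/

/-- Erase the root in register `4` if possible, and keep the part with the link in register `3`. -/
def stepStmt : Stmt := .upd 6 5 (stepF.expr Rel.test)

/-- Follow the link in register `3`. -/
def followStmt : Stmt := .seq (.upd 6 5 (.const 1)) (.loop 48 (.loop 4 stepStmt))

/-- Count in register `47` the links that do not end up in an axiom. -/
def countStmt : Stmt := .asg 47 (.add (.var 47) (.ite (Rel.link.test 3 3)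
  (.ite (axiomF.expr Rel.test) (.const 0) (.const 1)) (.const 0)))

def decideStmt : Stmt := .seq (.loop 3 (.seq followStmt countStmt))
  (.asg 47 (.ite (.rd 0 (.const 1)) (.ite (.var 47) (.const 0) (.const 1)) (.const 0)))

theorem decideStmt_wf : decideStmt.WF 50 = true := by decide +kernel

theorem stepF_inScope : stepF.inScope [0, 1, 2] = true := by decide +kernel

theorem axiomF_inScope : axiomF.inScope [] = true := by decide +kernel

/-! ### Correctness of the program -/

section

variable {lam : Links Γ L} {bar : A → A} {g l : ℕ} {eV : Fin g ≃ Vertex Γ} {eL : Fin l ≃ L}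
  {μ : Part Γ L} {i : L} {k f : ℕ} {s : State}

/-- The input is intact, register `3` holds `k`, and register `47` holds `f`. -/
structure Base (lam : Links Γ L) (bar : A → A) (eV : Fin g ≃ Vertex Γ) (eL : Fin l ≃ L) (k f : ℕ)
    (s : State) : Prop where
  presents : Presents lam bar eV eL s.arr
  reg3 : s.reg 3 = k
  reg47 : s.reg 47 = f

/-- The slicing `μ` around the link `i` is stored in array `6`. -/
structure Tracks (eV : Fin g ≃ Vertex Γ) (eL : Fin l ≃ L) (i : L) (μ : Part Γ L) (s : State) :
    Prop where
  mem (z) : s.arr 6 ((nodes eV eL).symm z) ≠ 0 ↔ z ∈ μ.carrier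
  closed : μ.Closed
  link : i ∈ μ.links

theorem Base.upd {N x : ℕ} {e : Expr} (h : Base lam bar eV eL k f s) :
    Base lam bar eV eL k f ((Stmt.upd 6 x e).den N s) where
  presents := h.presents.congr fun a ha => by
    simp only [Stmt.den]
    exact Function.update_of_ne (by omega) _ _
  reg3 := h.reg3
  reg47 := h.reg47

theorem Base.setReg {x n : ℕ} (h : Base lam bar eV eL k f s) (h3 : x ≠ 3) (h47 : x ≠ 47) :
    Base lam bar eV eL k f (s.setReg x n) where
  presents := h.presents
  reg3 := by rw [State.reg_setReg, if_neg h3.symm, h.reg3]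
  reg47 := by rw [State.reg_setReg, if_neg h47.symm, h.reg47]

theorem countdown_induction {α : Type*} {F : ℕ → α → α} {p : α → Prop}
    (hF : ∀ j s, p s → p (F j s)) (n : ℕ) {s : α} (h : p s) : p (countdown F n s) := by
  induction n generalizing s with
  | zero => exact h
  | succ n ih => exact ih (hF n s h)

/-- Formula variables `0`, `1`, `2` live in registers `3`, `4`, `5`; the last is bound by the array
update. The update is simultaneous, so the formula is evaluated throughout on the old slicing. -/
theorem Tracks.step (hb : ∀ a, bar a ≠ a) {z : Vertex Γ ⊕ L}
    (h : Base lam bar eV eL ((nodes eV eL).symm (.inr i)) f s) (hs : Tracks eV eL i μ s)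
    (hz : s.reg 4 = (nodes eV eL).symm z) :
    Tracks eV eL i (lam.next i z μ) (stepStmt.den (g + l) s) := by
  obtain ⟨hc, hl⟩ := Links.next_closed (lam := lam) hs.closed hs.link z
  refine ⟨fun w => ?_, hc, hl⟩
  simp only [stepStmt, Stmt.den, Function.update_self, Fin.is_lt, if_true]
  rw [Form.eval_expr (lam.interp bar μ.carrier) (nodes eV eL)
    (fun a x y ρ z w => Rel.eval_test hb h.presents hs.mem a x y ρ z w) stepF _ stepF_inScope _
    (fun x => if x = 0 then .inr i else if x = 1 then z else w) ?_]
  · exact Links.sat_stepF hs.closed rfl hs.link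
  · intro x hx
    simp only [List.mem_cons, List.not_mem_nil, or_false] at hx
    rcases hx with rfl | rfl | rfl
    · simpa using h.reg3
    · simpa using hz
    · simp

/-- The list is the order in which the loop visits the vertices. It must not depend on the link or
the slicing, because the criterion for erasability uses one list for all links. -/
theorem exists_sweep (hb : ∀ a, bar a ≠ a) (n : ℕ) : ∃ ls : List (Vertex Γ ⊕ L),
    (∀ z, ((nodes eV eL).symm z : ℕ) < n → z ∈ ls) ∧ ∀ {i : L} {μ : Part Γ L} {f : ℕ} {s : State},
      Base lam bar eV eL ((nodes eV eL).symm (.inr i)) f s → Tracks eV eL i μ s → n ≤ g + l →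
      Base lam bar eV eL ((nodes eV eL).symm (.inr i)) f
        (countdown (fun r s => stepStmt.den (g + l) (s.setReg 4 r)) n s) ∧
      Tracks eV eL i (lam.run i ls μ)
        (countdown (fun r s => stepStmt.den (g + l) (s.setReg 4 r)) n s) := by
  induction n with
  | zero => exact ⟨[], fun z hz => by omega, fun h hs _ => ⟨h, hs⟩⟩
  | succ n ih =>
    obtain ⟨ls, h1, h2⟩ := ih
    by_cases hn : n < g + l
    · refine ⟨nodes eV eL ⟨n, hn⟩ :: ls, fun z hz => ?_, fun {i μ f s} h hs _ => ?_⟩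
      · rcases Nat.lt_succ_iff_lt_or_eq.1 hz with hz | hz
        · exact List.mem_cons_of_mem _ (h1 z hz)
        · have : z = nodes eV eL ⟨n, hn⟩ := by
            rw [← Equiv.symm_apply_eq]; exact Fin.ext hz
          exact this ▸ List.mem_cons_self
      · have hb' := h.setReg (x := 4) (n := n) (by omega) (by omega)
        refine h2 (hb'.upd) (Tracks.step hb hb' ⟨hs.mem, hs.closed, hs.link⟩ ?_) (by omega)
        simp
    · exact ⟨ls, fun z _ => h1 z (by have := ((nodes eV eL).symm z).2; omega),
        fun _ _ hn' => absurd hn' (by omega)⟩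

theorem exists_follow (hb : ∀ a, bar a ≠ a) (lam : Links Γ L) (eV : Fin g ≃ Vertex Γ)
    (eL : Fin l ≃ L) : ∃ ls : List (Vertex Γ ⊕ L),
    (∀ z, z ∈ ls) ∧ ∀ {i : L} {f : ℕ} {s : State},
      Base lam bar eV eL ((nodes eV eL).symm (.inr i)) f s →
      Base lam bar eV eL ((nodes eV eL).symm (.inr i)) f (followStmt.den (g + l) s) ∧
      Tracks eV eL i (lam.run i (List.replicate (g + l) ls).flatten ⟨Set.univ, Set.univ⟩)
        (followStmt.den (g + l) s) := by
  obtain ⟨ls, h1, h2⟩ := exists_sweep (lam := lam) (eV := eV) (eL := eL) hb (g + l)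
  refine ⟨ls, fun z => h1 z (Fin.is_lt _), fun {i f s} h => ?_⟩
  have key : ∀ (n : ℕ) {s : State} {μ : Part Γ L},
      Base lam bar eV eL ((nodes eV eL).symm (.inr i)) f s → Tracks eV eL i μ s →
      Base lam bar eV eL ((nodes eV eL).symm (.inr i)) f
        (countdown (fun r s => (Stmt.loop 4 stepStmt).den (g + l) (s.setReg 48 r)) n s) ∧
      Tracks eV eL i (lam.run i (List.replicate n ls).flatten μ)
        (countdown (fun r s => (Stmt.loop 4 stepStmt).den (g + l) (s.setReg 48 r)) n s) := by
    intro n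
    induction n with
    | zero => exact fun h hs => ⟨h, hs⟩
    | succ n ih =>
      intro s μ h hs
      rw [List.replicate_succ, List.flatten_cons, Links.run_append]
      have := h2 (h.setReg (x := 48) (n := n) (by omega) (by omega))
        (μ := μ) ⟨hs.mem, hs.closed, hs.link⟩ le_rfl
      exact ih this.1 this.2
  refine key (g + l) h.upd ⟨fun z => ?_, Links.closed_univ, trivial⟩
  simp only [Stmt.den, Function.update_self, Fin.is_lt, if_true, Expr.eval, ne_eq, one_ne_zero,
    not_false_eq_true, true_iff]
  rcases z with v | m <;> trivial

theorem Base.follow (h : Base lam bar eV eL k f s) :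
    Base lam bar eV eL k f (followStmt.den (g + l) s) :=
  countdown_induction (p := Base lam bar eV eL k f) (fun _ _ h => countdown_induction
    (p := Base lam bar eV eL k f)
    (fun _ _ h => (h.setReg (by omega) (by omega)).upd) _ (h.setReg (by omega) (by omega))) _ h.upd

theorem count_vertex {v : Vertex Γ}
    (h : Base lam bar eV eL ((nodes eV eL).symm (.inl v)) f s) :
    (countStmt.den (g + l) s).reg 47 = f := by
  have h1 : (Rel.link.test 3 3).eval (g + l) s.arr s.reg = 0 := by
    simp only [Rel.test, Expr.eval, h.reg3, h.presents.card_verts, nodes_symm_inl]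
    rw [if_pos]
    have := (eV.symm v).2
    omega
  simp only [countStmt, Stmt.den, Expr.eval, State.reg_setReg, if_true, h1, h.reg47]
  simp

/-- Only whether the counter vanishes matters, so failures are accumulated without tracking their
number. -/
theorem count_link (hb : ∀ a, bar a ≠ a)
    (h : Base lam bar eV eL ((nodes eV eL).symm (.inr i)) f s) (hs : Tracks eV eL i μ s) :
    (countStmt.den (g + l) s).reg 47 ≠ 0 ↔ f ≠ 0 ∨ ¬ lam.IsAxiomPart bar μ := by
  have h1 : (Rel.link.test 3 3).eval (g + l) s.arr s.reg = 1 := by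
    simp [Rel.test, Expr.eval, h.reg3, h.presents.card_verts, nodes_symm_inr]
  have h2 := Form.eval_expr (lam.interp bar μ.carrier) (nodes eV eL)
    (fun a x y ρ z w => Rel.eval_test hb h.presents hs.mem a x y ρ z w) axiomF _ axiomF_inScope
    s.reg (fun _ => .inr i) (by simp)
  rw [Links.sat_axiomF] at h2
  simp only [countStmt, Stmt.den, Expr.eval, State.reg_setReg, if_true, h1, h.reg47]
  by_cases hax : lam.IsAxiomPart bar μ
  · simp [h2.2 hax, hax]
  · have h3 : (axiomF.expr Rel.test).eval (g + l) s.arr s.reg = 0 := by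
      by_contra hne; exact hax (h2.1 hne)
    simp [h3, hax]

theorem decideStmt_correct (hb : ∀ a, bar a ≠ a) (hs : Presents lam bar eV eL s.arr)
    (h47 : s.reg 47 = 0) :
    (decideStmt.den (g + l) s).reg 47 ≠ 0 ↔ lam.Erasable bar := by
  obtain ⟨ls, hls, hfol⟩ := exists_follow hb lam eV eL
  have : Finite (Vertex Γ) := .of_equiv _ eV
  have hcard : Nat.card (Vertex Γ) ≤ g + l := by
    rw [← Nat.card_congr eV, Nat.card_fin]; omega
  rw [Links.erasable_iff_run (fun r => hls _) hcard]
  have key : ∀ n ≤ g + l, ∀ s : State, Presents lam bar eV eL s.arr →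
      Presents lam bar eV eL (countdown (fun k s =>
        (Stmt.seq followStmt countStmt).den (g + l) (s.setReg 3 k)) n s).arr ∧
      ((countdown (fun k s =>
        (Stmt.seq followStmt countStmt).den (g + l) (s.setReg 3 k)) n s).reg 47 ≠ 0 ↔
        s.reg 47 ≠ 0 ∨ ∃ i, ((nodes eV eL).symm (.inr i) : ℕ) < n ∧ ¬ lam.IsAxiomPart bar
          (lam.run i (List.replicate (g + l) ls).flatten ⟨Set.univ, Set.univ⟩)) := by
    intro n
    induction n with
    | zero => exact fun _ s hs => ⟨hs, by simp [countdown]⟩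
    | succ n ih =>
      intro hn s hs
      have hbase : Base lam bar eV eL n (s.reg 47) (s.setReg 3 n) := ⟨hs, by simp, by simp⟩
      have hfl := hbase.follow
      obtain ⟨h1, h2⟩ := ih (by omega) (countStmt.den (g + l)
        (followStmt.den (g + l) (s.setReg 3 n))) hfl.presents
      refine ⟨h1, h2.trans ?_⟩
      have hlt : ∀ i : L, ((nodes eV eL).symm (.inr i) : ℕ) < n + 1 ↔
          ((nodes eV eL).symm (.inr i) : ℕ) < n ∨ ((nodes eV eL).symm (.inr i) : ℕ) = n :=
        fun i => Nat.lt_succ_iff_lt_or_eq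
      simp only [hlt, or_and_right, exists_or]
      -- The outer loop runs through all vertices of the conflict graph. At a forest vertex the
      -- computed set is meaningless, but it leaves the input intact and is not counted.
      rcases hz : nodes eV eL ⟨n, by omega⟩ with v | i
      · have hzn : ((nodes eV eL).symm (.inl v) : ℕ) = n := by rw [← hz]; simp
        rw [count_vertex (f := s.reg 47) (v := v) (by rw [hzn]; exact hfl)]
        have : ∀ i : L, ((nodes eV eL).symm (.inr i) : ℕ) ≠ n := by
          intro i hi
          have := (nodes eV eL).symm.injective (Fin.ext (hi.trans hzn.symm))
          cases this
        simp [this]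
      · have hzn : ((nodes eV eL).symm (.inr i) : ℕ) = n := by rw [← hz]; simp
        obtain ⟨h3, h4⟩ := hfol (i := i) (f := s.reg 47) (s := s.setReg 3 n)
          (by rw [hzn]; exact hbase)
        rw [count_link hb h3 h4]
        have : ∀ j : L, ((nodes eV eL).symm (.inr j) : ℕ) = n ↔ j = i := by
          intro j
          constructor
          · intro hj
            exact Sum.inr.inj ((nodes eV eL).symm.injective (Fin.ext (hj.trans hzn.symm)))
          · rintro rfl; exact hzn
        simp only [this, exists_eq_left]
        rw [or_assoc]
        exact or_congr_right or_comm
  obtain ⟨h1, h2⟩ := key (g + l) le_rfl s hs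
  have hL : Nonempty L ↔ l ≠ 0 := by
    rw [← eL.nonempty_congr, ← Fin.pos_iff_nonempty, Nat.pos_iff_ne_zero]
  simp only [h47, ne_eq, not_true_eq_false, false_or, Fin.is_lt, true_and] at h2
  rw [hL]
  rw [decideStmt, Stmt.den, Stmt.den, State.reg_setReg, if_pos rfl]
  simp only [Stmt.den] at h1 h2 ⊢
  rw [Expr.eval_ite, Expr.eval_ite, ← not_exists_not, ← h2]
  simp [Expr.eval, h1.card_links]

end

def decideProgram : Program :=
  .seq (.const 2 0) (.seq (.load 1 0 2) (.seq (.const 2 1) (.seq (.load 2 0 2)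
    (.seq (.add 1 1 2) (.seq (decideStmt.compile 50) (.copy 0 47))))))

theorem decideProgram_correct {lam : Links Γ L} {bar : A → A} (hb : ∀ a, bar a ≠ a) {g l : ℕ}
    (eV : Fin g ≃ Vertex Γ) (eL : Fin l ≃ L) :
    Does decideProgram (State.init (lam.encode bar eV eL)) (decideStmt.time.eval (g + l) + 6)
      (fun s => s.reg 0 ≠ 0 ↔ lam.Erasable bar) := by
  have hp := presents_init lam bar eV eL
  have h0 := hp.card_verts
  have h1 := hp.card_links
  refine Does.mono (T := 1 + (1 + (1 + (1 + (1 + (decideStmt.time.eval (g + l) + 1))))))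
    (Does.seq_const (Does.seq_load (Does.seq_const (Does.seq_load (Does.seq
      (Does.add (Q := fun s => s.reg 1 = g + l ∧ s.reg 47 = 0 ∧ Presents lam bar eV eL s.arr)
        ⟨?_, ?_, hp⟩) fun s hs => Does.seq
          (Stmt.compile_correct decideStmt decideStmt_wf (by omega) 50 le_rfl s hs.1)
          fun s' h => Does.copy ?_))))) (by omega) (fun _ h => h)
  · simp [h0, h1]
  · simp [State.init]
  · rw [State.reg_setReg, if_pos rfl, h.1.1 47 (by omega)]
    exact decideStmt_correct hb hs.2.2 hs.2.1

end MALL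

theorem mainTheorem2 :
    ∃ (P : RAM.Program) (p : Polynomial ℕ),
      ∀ (A : Type*) (bar : A → A), Function.Involutive bar → (∀ a, bar a ≠ a) →
      ∀ (Γ : MALL.Sequent A) (L : Type*) (lam : MALL.Links Γ L), lam.IsSlicing bar →
      ∀ (g l : ℕ) (eV : Fin g ≃ MALL.Vertex Γ) (eL : Fin l ≃ L),
        ∃ (s : RAM.State) (t : ℕ),
          RAM.Runs P (RAM.State.init (lam.encode bar eV eL)) s t ∧
          t ≤ p.eval (l + g) ∧
          (s.reg 0 ≠ 0 ↔ lam.Erasable bar) := by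
  -- The extra `6` pays for the five instructions that put `g + l` into register `1` and for the
  -- final copy of the answer.
  refine ⟨MALL.decideProgram, MALL.decideStmt.time + 6, ?_⟩
  intro A bar _ hb Γ L lam _ g l eV eL
  obtain ⟨s, t, hr, ht, h⟩ := MALL.decideProgram_correct (lam := lam) hb eV eL
  refine ⟨s, t, hr, ?_, h⟩
  rw [Polynomial.eval_add, Polynomial.eval_ofNat, add_comm l g]
  exact ht
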